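/- Let $R$ be a commutative ring and $n\ge 0$. Let $C(\square^1)$ be the complex of free $R$-modules on $[0],[1]$ (degree $0$) and $[0,1]$ (degree $1$), with $\partial[0,1]=[1]-[0]$, let $C(\square^n)=C(\square^1)^{\otimes n}$ be the cellular chains of the cube, and let $C(\triangle^n)$ be the normalized chains of the simplex, with basis the $[v_0,\dots,v_m]$, $0\le v_0<\dots<v_m\le n$, and the usual boundary. Identify the topological simplex with $\{1\ge y_1\ge\dots\ge y_n\ge 0\}$, where $[v_0,\dots,v_m]$ is the oriented cell of the points $(1,\dots,1,y_1,\dots,y_1,\dots,y_m,\dots,y_m,0,\dots,0)$ with $v_0$ entries $1$, $v_k-v_{k-1}$ entries $y_k$ and $n-v_m$ entries $0$. The Cartan--Serre map $[0,1]^n\to\{1\ge y_1\ge\dots\ge y_n\ge0\}$, $(x_1,\dots,x_n)\mapsto(x_1,\,x_1x_2,\,\dots,\,x_1\cdots x_n)$, is cellular. Let $\mathrm{CS}\colon C(\square^n)\to C(\triangle^n)$ be the induced map of cellular chains: the coefficient of a cell $s$ in $\mathrm{CS}(x)$, for cells $x,s$ of the same dimension, is the degree of the map $x/\partial x\to s/\partial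 s$ (all interior points of $s$ are regular values on $x$, so it is the signed number of preimages of any of them). Equip both complexes with a counit $\epsilon$, a coproduct $\Delta$ and a degree $1$ product $\ast$. * On $C(\square^n)$: $\epsilon(x)$ is $1$ on vertices and $0$ on the other basis elements; $\Delta$ is the Serre coproduct, that is, the tensor product coalgebra structure (with Koszul signs) of $n$ copies of $\Delta[0]=[0]\otimes[0]$, $\Delta[1]=[1]\otimes[1]$, $\Delta[0,1]=[0]\otimes[0,1]+[0,1]\otimes[1]$; and $$(x_1\otimes\dots\otimes x_n)\ast(y_1\otimes\dots\otimes y_n)=(-1)^{|x|}\sum_{\ell=1}^n x_{<\ell}\,\epsilon(y_{<\ell})\otimes x_\ell\ast y_\ell\otimes\epsilon(x_{>\ell})\,y_{>\ell},$$ where $[0]\ast[1]=[0,1]$, $[1]\ast[0]=-[0,1]$ and the other products of basis elements of $C(\square^1)$ vanish. * On $C(\triangle^n)$: $\epsilon$ is $1$ on vertices and $0$ on the other basis elements; $\Delta[v_0,\dots,v_m]=\sum_i[v_0,\dots,v_i]\otimes[v_i,\dots,v_m]$; and $[v_0,\dots,v_p]\ast[v_{p+1},\dots,v_m]=(-1)^{p+|\sigma|}[v_{\sigma(0)},\dots,v_{\sigma(m)}]$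 if all the $v_i$ are different, where $\sigma$ is the permutation that orders them and $(-1)^{|\sigma|}$ its sign, and $0$ otherwise. Let $\mathcal M$ be the (graded) $R$-linear prop generated by a counit in biarity $(1,0)$ and a coproduct in biarity $(1,2)$, both of degree $0$, and a product of degree $1$ in biarity $(2,1)$, with the relations $(\epsilon\otimes\mathrm{id})\Delta=\mathrm{id}=(\mathrm{id}\otimes\epsilon)\Delta$ and $\epsilon\circ\ast=0$; it acts on $C(\square^n)$ and $C(\triangle^n)$, with an element of $\mathcal M(m,r)$ giving a map $C^{\otimes m}\to C^{\otimes r}$. Let $\mathrm{forget}(\mathcal M)$ be the operad with $\mathrm{forget}(\mathcal M)(r)=\mathcal M(1,r)$. For $r\ge 0$, $k_1,\dots,k_r\ge 1$ and $k=k_1+\dots+k_r$, a $(k_1,\dots,k_r)$-shuffle is a permutation $\sigma\in\mathbb S_k$ that is increasing on each of the $r$ consecutive blocks of lengths $k_1,\dots,k_r$ of $\{1,\dots,k\}$; its shuffle graph is the element $(\ast^{k_1}\otimes\dots\otimes\ast^{k_r})\circ\sigma^{-1}\Delta^{k-1}$ of $\mathcal M(1,r)$, where $\ast^{j}$ is the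 left comb iterated product with $j$ inputs, $\Delta^{k-1}$ the left comb iterated coproduct with $k$ outputs ($\Delta^{-1}=\epsilon$), and $\sigma^{-1}$ puts the $\sigma(j)$-th tensor factor in position $j$, with the Koszul sign. Let $\mathrm{forget}(\mathcal M_{sh})$ be the suboperad of $\mathrm{forget}(\mathcal M)$ generated by the shuffle graphs. Theorem. $\mathrm{CS}\colon C(\square^n)\to C(\triangle^n)$ is a quasi-isomorphism of $\mathrm{forget}(\mathcal M_{sh})$-coalgebras: it is a chain map inducing isomorphisms in homology, and $\mathrm{CS}^{\otimes r}\circ\Gamma=\Gamma\circ\mathrm{CS}$ for all $r$ and all $\Gamma\in\mathrm{forget}(\mathcal M_{sh})(r)$. In particular, $\mathrm{CS}$ commutes with $(\ast^{k_1}\otimes\dots\otimes\ast^{k_r})\circ\sigma^{-1}\Delta^{k-1}$ for every $(k_1,\dots,k_r)$-shuffle $\sigma$. -/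

import Mathlib

open CategoryTheory

noncomputable section

namespace CartanSerre

universe u

/-! ## Tensor powers of a graded free module and the Koszul sign rule -/

section Tensor

variable (R : Type u) [CommRing R] (B : Type)

/-- For a free module `C` with basis `B`, the tensor power `C^{⊗ n}`: the free module on the
`n`-tuples of basis elements, `x_1 ⊗ ⋯ ⊗ x_n` being `single ![x_1, …, x_n] 1`. -/
abbrev Tens (n : ℕ) : Type u := (Fin n → B) →₀ R

variable {R B}

/-- The degree of a tensor of basis elements. -/
def tdeg (deg : B → ℕ) {n : ℕ} (x : Fin n → B) : ℕ := ∑ i, deg (x i)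

/-- The canonical map `C^{⊗ n} × C^{⊗ q} → C^{⊗ (n+q)}`, `(a, b) ↦ a ⊗ b`. -/
def append {n q : ℕ} : Tens R B n →ₗ[R] Tens R B q →ₗ[R] Tens R B (n + q) :=
  Finsupp.linearCombination R fun u => Finsupp.lmapDomain R R (Fin.append u)

/-- The tensor product of linear maps, for `g` of degree `d`:
`(f ⊗ g)(x ⊗ y) = (-1)^{d |x|} f(x) ⊗ g(y)`. -/
def tensorHom (deg : B → ℕ) (d : ℕ) {m n p q : ℕ}
    (f : Tens R B m →ₗ[R] Tens R B n) (g : Tens R B p →ₗ[R] Tens R B q) :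
    Tens R B (m + p) →ₗ[R] Tens R B (n + q) :=
  Finsupp.linearCombination R fun x : Fin (m + p) → B =>
    (-1 : R) ^ (d * tdeg deg (fun i => x (Fin.castAdd p i))) •
      append (f (Finsupp.single (fun i => x (Fin.castAdd p i)) 1))
        (g (Finsupp.single (fun j => x (Fin.natAdd m j)) 1))

/-- The Koszul sign of permuting the factors of `x_1 ⊗ ⋯ ⊗ x_m` by `e`. -/
def koszulSign (R : Type u) [CommRing R] (deg : B → ℕ) {m n : ℕ} (e : Fin m ≃ Fin n)
    (x : Fin m → B) : R :=
  ∏ i, ∏ j, if i < j ∧ e j < e i then (-1 : R) ^ (deg (x i) * deg (x j)) else 1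

/-- The action of permutations on tensor powers: the factor in position `i` is moved to
position `e i`, with the Koszul sign. (A bijection `Fin m ≃ Fin n` forces `m = n`; allowing
`m` and `n` to be different expressions avoids casts.) -/
def permHom (deg : B → ℕ) {m n : ℕ} (e : Fin m ≃ Fin n) : Tens R B m →ₗ[R] Tens R B n :=
  Finsupp.linearCombination R fun x => Finsupp.single (x ∘ e.symm) (koszulSign R deg e x)

/-- The `r`-th tensor power of a degree `0` linear map `φ : C → C'`. -/
def tensorPower {B' : Type} [Finite B'] (φ : (B →₀ R) →ₗ[R] (B' →₀ R)) (r : ℕ) :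
    Tens R B r →ₗ[R] Tens R B' r :=
  Finsupp.linearCombination R fun x : Fin r → B =>
    Finsupp.equivFunOnFinite.symm fun y : Fin r → B' =>
      ∏ i, φ (Finsupp.single (x i) 1) (y i)

/-- A linear map between tensor powers is homogeneous of degree `d`. -/
def IsHomog (deg : B → ℕ) (d : ℕ) {m n : ℕ} (f : Tens R B m →ₗ[R] Tens R B n) : Prop :=
  ∀ x : Fin m → B,
    f (Finsupp.single x 1) ∈ Finsupp.supported R R {y : Fin n → B | tdeg deg y = tdeg deg x + d}

end Tensor

/-! ## The prop `M`

This is the underlying graded prop. Its differential, determined by `∂ counit = 0`,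
`∂ coprod = 0` and `∂ prod = counit ⊗ id - id ⊗ counit`, plays no role in the definition of a
morphism of coalgebras, which is a chain map commuting with all operations. -/

/-- Formal `(m,n)`-graphs: generated from the counit, the coproduct and the product, and
permutations, under grafting and disjoint union. -/
inductive Graph : ℕ → ℕ → Type
  | counit : Graph 1 0
  | coprod : Graph 1 2
  | prod : Graph 2 1
  | perm {m n : ℕ} (e : Fin m ≃ Fin n) : Graph m n
  | comp {m n p : ℕ} (g : Graph n p) (f : Graph m n) : Graph m p
  | juxt {m n p q : ℕ} (f : Graph m n) (g : Graph p q) : Graph (m + p) (n + q)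

namespace Graph

/-- The identity graph on `n` strands. -/
def id (n : ℕ) : Graph n n := perm (Equiv.refl _)

/-- The degree: counit and coproduct have degree `0`, the product has degree `1`. -/
def deg : {m n : ℕ} → Graph m n → ℕ
  | _, _, counit => 0
  | _, _, coprod => 0
  | _, _, prod => 1
  | _, _, perm _ => 0
  | _, _, comp g f => g.deg + f.deg
  | _, _, juxt f g => f.deg + g.deg

end Graph

/-- The block sum of two permutations. -/
def blockSum {m n p q : ℕ} (e : Fin m ≃ Fin n) (e' : Fin p ≃ Fin q) :
    Fin (m + p) ≃ Fin (n + q) :=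
  finSumFinEquiv.symm.trans ((Equiv.sumCongr e e').trans finSumFinEquiv)

/-- `gr R g` is the basis element of the free module of `(m,n)`-graphs given by `g`. -/
def gr (R : Type u) [CommRing R] {m n : ℕ} (g : Graph m n) : Graph m n →₀ R :=
  Finsupp.single g 1

/-- The relations of the prop `M`: the axioms of a (graded, strict symmetric monoidal) prop, the
three relations between the generators, and closure under grafting and disjoint union. -/
inductive Rel (R : Type u) [CommRing R] : {m n : ℕ} → (Graph m n →₀ R) → Prop
  -- grafting is associative and unital
  | comp_assoc {m n p q : ℕ} (h : Graph p q) (g : Graph n p) (f : Graph m n) :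
      Rel R (gr R ((h.comp g).comp f) - gr R (h.comp (g.comp f)))
  | id_comp {m n : ℕ} (f : Graph m n) : Rel R (gr R ((Graph.id n).comp f) - gr R f)
  | comp_id {m n : ℕ} (f : Graph m n) : Rel R (gr R (f.comp (Graph.id m)) - gr R f)
  -- disjoint union is associative and unital
  | juxt_assoc {m n p q k l : ℕ} (f : Graph m n) (g : Graph p q) (h : Graph k l) :
      Rel R (gr R ((Graph.perm (finCongr (Nat.add_assoc n q l))).comp ((f.juxt g).juxt h)) -
        gr R ((f.juxt (g.juxt h)).comp (Graph.perm (finCongr (Nat.add_assoc m p k)))))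
  | id_juxt {m n : ℕ} (f : Graph m n) :
      Rel R (gr R ((Graph.perm (finCongr (Nat.zero_add n))).comp ((Graph.id 0).juxt f)) -
        gr R (f.comp (Graph.perm (finCongr (Nat.zero_add m)))))
  | juxt_id {m n : ℕ} (f : Graph m n) :
      Rel R (gr R ((Graph.perm (finCongr (Nat.add_zero n))).comp (f.juxt (Graph.id 0))) -
        gr R (f.comp (Graph.perm (finCongr (Nat.add_zero m)))))
  -- the interchange law, with the Koszul sign
  | interchange {m n p m' n' p' : ℕ} (g : Graph n p) (f : Graph m n)
      (g' : Graph n' p') (f' : Graph m' n') :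
      Rel R (gr R ((g.juxt g').comp (f.juxt f')) -
        (-1 : R) ^ (g'.deg * f.deg) • gr R ((g.comp f).juxt (g'.comp f')))
  -- permutations
  | perm_comp {m n p : ℕ} (e : Fin m ≃ Fin n) (e' : Fin n ≃ Fin p) :
      Rel R (gr R ((Graph.perm e').comp (Graph.perm e)) - gr R (Graph.perm (e.trans e')))
  | perm_juxt {m n p q : ℕ} (e : Fin m ≃ Fin n) (e' : Fin p ≃ Fin q) :
      Rel R (gr R ((Graph.perm e).juxt (Graph.perm e')) - gr R (Graph.perm (blockSum e e')))
  | perm_flip {m n p q : ℕ} (f : Graph m n) (g : Graph p q) :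
      Rel R (gr R ((Graph.perm finAddFlip).comp (f.juxt g)) -
        (-1 : R) ^ (f.deg * g.deg) • gr R ((g.juxt f).comp (Graph.perm finAddFlip)))
  -- the relations between the generators
  | counit_left :
      Rel R (gr R ((Graph.counit.juxt (Graph.id 1)).comp Graph.coprod) - gr R (Graph.id 1))
  | counit_right :
      Rel R (gr R (((Graph.id 1).juxt Graph.counit).comp Graph.coprod) - gr R (Graph.id 1))
  | prod_counit : Rel R (gr R (Graph.counit.comp Graph.prod))
  -- closure under grafting and disjoint union
  | comp_left {m n p : ℕ} (g : Graph n p) {u : Graph m n →₀ R} (hu : Rel R u) :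
      Rel R (u.mapDomain fun f => g.comp f)
  | comp_right {m n p : ℕ} {u : Graph n p →₀ R} (hu : Rel R u) (f : Graph m n) :
      Rel R (u.mapDomain fun g => g.comp f)
  | juxt_left {m n p q : ℕ} (f : Graph m n) {u : Graph p q →₀ R} (hu : Rel R u) :
      Rel R (u.mapDomain fun g => f.juxt g)
  | juxt_right {m n p q : ℕ} {u : Graph m n →₀ R} (hu : Rel R u) (g : Graph p q) :
      Rel R (u.mapDomain fun f => f.juxt g)

/-- The biarity `(m,n)` part `M(m,n)` of the prop `M` over `R`: linear combinations of
`(m,n)`-graphs modulo the relations. The operad `forget(M)` has `forget(M)(r) = M(1,r)`. -/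
abbrev PropM (R : Type u) [CommRing R] (m n : ℕ) : Type u :=
  (Graph m n →₀ R) ⧸ Submodule.span R {u : Graph m n →₀ R | Rel R u}

/-- The class in `M(m,n)` of an `(m,n)`-graph. -/
def cls (R : Type u) [CommRing R] {m n : ℕ} (g : Graph m n) : PropM R m n :=
  Submodule.Quotient.mk (gr R g)

/-! ## Shuffle graphs and the operad they generate -/

/-- The left comb iterated coproduct `Δ^{k-1}` with `k` outputs (the counit for `k = 0`). -/
def combCoprod : (k : ℕ) → Graph 1 k
  | 0 => Graph.counit
  | 1 => Graph.id 1
  | k + 2 => ((combCoprod (k + 1)).juxt (Graph.id 1)).comp Graph.coprod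

/-- The left comb iterated product with `k + 1` inputs. -/
def combProd : (k : ℕ) → Graph (k + 1) 1
  | 0 => Graph.id 1
  | k + 1 => Graph.prod.comp ((combProd k).juxt (Graph.id 1))

/-- A tuple of positive integers `(k_1, …, k_r)` is encoded by `ks i = k_{i+1} - 1`, with `i` in
`Fin r`; this is the sum `k_1 + ⋯ + k_r`. -/
def total : (r : ℕ) → (Fin r → ℕ) → ℕ
  | 0, _ => 0
  | r + 1, ks => total r (fun i => ks i.castSucc) + (ks (Fin.last r) + 1)

/-- The disjoint union of the left comb products with `k_1, …, k_r` inputs. -/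
def prodBlock : (r : ℕ) → (ks : Fin r → ℕ) → Graph (total r ks) r
  | 0, _ => Graph.id 0
  | r + 1, ks => (prodBlock r fun i => ks i.castSucc).juxt (combProd (ks (Fin.last r)))

/-- The block of `{1, …, k_1 + ⋯ + k_r}`, cut into consecutive blocks of lengths
`k_1, …, k_r`, that contains a given element. -/
def blockOf : (r : ℕ) → (ks : Fin r → ℕ) → Fin (total r ks) → Fin r
  | 0, _ => fun i => i
  | r + 1, ks => Fin.addCases (fun i => (blockOf r (fun i => ks i.castSucc) i).castSucc)
      fun _ => Fin.last r

/-- `σ` is a `(k_1, …, k_r)`-shuffle: it is increasing on each block. -/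
def IsShuffle (r : ℕ) (ks : Fin r → ℕ) (σ : Equiv.Perm (Fin (total r ks))) : Prop :=
  ∀ i j, i < j → blockOf r ks i = blockOf r ks j → σ i < σ j

/-- The shuffle graph `(∗^{k_1} ⊗ ⋯ ⊗ ∗^{k_r}) ∘ σ⁻¹ Δ^{k-1}`. -/
def shuffleGraph (r : ℕ) (ks : Fin r → ℕ) (σ : Equiv.Perm (Fin (total r ks))) : Graph 1 r :=
  (prodBlock r ks).comp ((Graph.perm σ.symm).comp (combCoprod (total r ks)))

/-- The `(1,r)`-graphs obtained by operadic grafting (and permuting outputs) from shuffle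
graphs. -/
inductive IsShuffleGrafting : {r : ℕ} → Graph 1 r → Prop
  | id : IsShuffleGrafting (Graph.id 1)
  | shuffle (r : ℕ) (ks : Fin r → ℕ) (σ : Equiv.Perm (Fin (total r ks)))
      (hσ : IsShuffle r ks σ) : IsShuffleGrafting (shuffleGraph r ks σ)
  | graft (a b s : ℕ) (Γ : Graph 1 (a + 1 + b)) (Γ' : Graph 1 s)
      (h : IsShuffleGrafting Γ) (h' : IsShuffleGrafting Γ') :
      IsShuffleGrafting ((((Graph.id a).juxt Γ').juxt (Graph.id b)).comp Γ)
  | perm {r s : ℕ} (e : Fin r ≃ Fin s) (Γ : Graph 1 r) (h : IsShuffleGrafting Γ) :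
      IsShuffleGrafting ((Graph.perm e).comp Γ)

/-- The suboperad `forget(M_sh)` of `forget(M)` generated by shuffle graphs, in arity `r`. -/
def shuffleOperad (R : Type u) [CommRing R] (r : ℕ) : Submodule R (PropM R 1 r) :=
  Submodule.span R {γ | ∃ Γ : Graph 1 r, IsShuffleGrafting Γ ∧ γ = cls R Γ}

/-! ## `M`-bialgebras -/

/-- A (graded) `M`-bialgebra on the free graded module with basis `B`: a counit, a coproduct and
a degree `1` product satisfying the relations between the generators of `M`. -/
structure MBialgebra (R : Type u) [CommRing R] (B : Type) where
  deg : B → ℕ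
  counit : Tens R B 1 →ₗ[R] Tens R B 0
  coprod : Tens R B 1 →ₗ[R] Tens R B 2
  prod : Tens R B 2 →ₗ[R] Tens R B 1
  counit_homog : IsHomog deg 0 counit
  coprod_homog : IsHomog deg 0 coprod
  prod_homog : IsHomog deg 1 prod
  counit_left : tensorHom (n := 0) (p := 1) deg 0 counit LinearMap.id ∘ₗ coprod = LinearMap.id
  counit_right : tensorHom (m := 1) (q := 0) deg 0 LinearMap.id counit ∘ₗ coprod = LinearMap.id
  prod_counit : counit ∘ₗ prod = 0

/-- The operation `C^{⊗ m} → C^{⊗ n}` given by an `(m,n)`-graph. -/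
def MBialgebra.eval {R : Type u} [CommRing R] {B : Type} (A : MBialgebra R B) :
    {m n : ℕ} → Graph m n → (Tens R B m →ₗ[R] Tens R B n)
  | _, _, Graph.counit => A.counit
  | _, _, Graph.coprod => A.coprod
  | _, _, Graph.prod => A.prod
  | _, _, Graph.perm e => permHom A.deg e
  | _, _, Graph.comp g f => A.eval g ∘ₗ A.eval f
  | _, _, Graph.juxt f g => tensorHom A.deg g.deg (A.eval f) (A.eval g)

end CartanSerre

namespace CartanSerre

universe u

section Soundness

variable {R : Type u} [CommRing R] {B : Type}

theorem tens_ext {m : ℕ} {M : Type*} [AddCommMonoid M] [Module R M]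
    {f g : Tens R B m →ₗ[R] M}
    (h : ∀ x, f (Finsupp.single x 1) = g (Finsupp.single x 1)) : f = g :=
  Finsupp.lhom_ext' fun x => LinearMap.ext_ring (h x)

theorem append_single {n q : ℕ} (u : Fin n → B) (v : Fin q → B) (a b : R) :
    append (Finsupp.single u a) (Finsupp.single v b)
      = Finsupp.single (Fin.append u v) (a * b) := by
  simp [append, Finsupp.lmapDomain_apply, Finsupp.mapDomain_single]

theorem tdeg_append (deg : B → ℕ) {n q : ℕ} (u : Fin n → B) (v : Fin q → B) :
    tdeg deg (Fin.append u v) = tdeg deg u + tdeg deg v := by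
  simp [tdeg, Fin.sum_univ_add]

theorem tensorHom_single (deg : B → ℕ) (d : ℕ) {m n p q : ℕ}
    (f : Tens R B m →ₗ[R] Tens R B n) (g : Tens R B p →ₗ[R] Tens R B q)
    (x : Fin m → B) (y : Fin p → B) :
    tensorHom deg d f g (Finsupp.single (Fin.append x y) 1) =
      (-1 : R) ^ (d * tdeg deg x) • append (f (Finsupp.single x 1)) (g (Finsupp.single y 1)) := by
  simp [tensorHom]

theorem supported_induction {n : ℕ} {s : Set (Fin n → B)} {P : Tens R B n → Prop}
    (h0 : P 0) (hs : ∀ x ∈ s, P (Finsupp.single x 1)) (ha : ∀ a b, P a → P b → P (a + b))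
    (hm : ∀ (c : R) a, P a → P (c • a)) {a : Tens R B n} (h : a ∈ Finsupp.supported R R s) :
    P a := by
  rw [Finsupp.supported_eq_span_single] at h
  induction h using Submodule.span_induction with
  | mem x hx => obtain ⟨y, hy, rfl⟩ := hx; exact hs y hy
  | zero => exact h0
  | add x y _ _ hx hy => exact ha _ _ hx hy
  | smul c x _ hx => exact hm _ _ hx

theorem tensorHom_append (deg : B → ℕ) (d k : ℕ) {m n p q : ℕ}
    (f : Tens R B m →ₗ[R] Tens R B n) (g : Tens R B p →ₗ[R] Tens R B q)
    {a : Tens R B m} (ha : a ∈ Finsupp.supported R R {y : Fin m → B | tdeg deg y = k})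
    (b : Tens R B p) :
    tensorHom deg d f g (append a b) = (-1 : R) ^ (d * k) • append (f a) (g b) := by
  refine supported_induction (P := fun a => tensorHom deg d f g (append a b)
    = (-1 : R) ^ (d * k) • append (f a) (g b)) ?_ ?_ ?_ ?_ ha
  · simp
  · intro x hx
    have : (tensorHom deg d f g) ∘ₗ (append (Finsupp.single x 1)) =
        ((-1 : R) ^ (d * k) • append (f (Finsupp.single x 1)) ∘ₗ g) := by
      apply tens_ext
      intro y
      simp only [LinearMap.comp_apply, append_single, LinearMap.smul_apply, mul_one]
      rw [tensorHom_single]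
      rw [show tdeg deg x = k from hx]
    simpa using LinearMap.congr_fun this b
  · intro a b ha hb; simp [ha, hb]
  · intro c a ha; simp [ha, smul_comm c]

theorem append_mem (deg : B → ℕ) {n q k l : ℕ} {a : Tens R B n} {b : Tens R B q}
    (ha : a ∈ Finsupp.supported R R {y : Fin n → B | tdeg deg y = k})
    (hb : b ∈ Finsupp.supported R R {y : Fin q → B | tdeg deg y = l}) :
    append a b ∈ Finsupp.supported R R {y : Fin (n + q) → B | tdeg deg y = k + l} := by
  refine supported_induction (P := fun a => append a b ∈ Finsupp.supported R R
    {y : Fin (n + q) → B | tdeg deg y = k + l}) (by simp) ?_ ?_ ?_ ha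
  · intro x hx
    refine supported_induction (P := fun b => append (Finsupp.single x 1) b ∈
      Finsupp.supported R R {y : Fin (n + q) → B | tdeg deg y = k + l}) (by simp) ?_ ?_ ?_ hb
    · intro y hy
      rw [append_single]
      apply Finsupp.single_mem_supported
      simp only [Set.mem_ofPred_eq] at *
      rw [tdeg_append, hx, hy]
    · intro a b ha hb; simpa using Submodule.add_mem _ ha hb
    · intro c a ha; simpa using Submodule.smul_mem _ c ha
  · intro a b ha hb; simpa using Submodule.add_mem _ ha hb
  · intro c a ha; simpa using Submodule.smul_mem _ c ha

theorem IsHomog.map_mem {deg : B → ℕ} {d m n : ℕ} {f : Tens R B m →ₗ[R] Tens R B n}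
    (hf : IsHomog deg d f) {k : ℕ} {a : Tens R B m}
    (ha : a ∈ Finsupp.supported R R {y : Fin m → B | tdeg deg y = k}) :
    f a ∈ Finsupp.supported R R {y : Fin n → B | tdeg deg y = k + d} := by
  refine supported_induction (P := fun a => f a ∈ Finsupp.supported R R
    {y : Fin n → B | tdeg deg y = k + d}) (by simp) ?_ ?_ ?_ ha
  · intro x hx; have := hf x; rwa [show tdeg deg x = k from hx] at this
  · intro a b ha hb; simpa using Submodule.add_mem _ ha hb
  · intro c a ha; simpa using Submodule.smul_mem _ c ha

theorem tens_single_append {m p : ℕ} (x : Fin (m + p) → B) :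
    x = Fin.append (fun i => x (Fin.castAdd p i)) (fun j => x (Fin.natAdd m j)) :=
  (Fin.append_castAdd_natAdd).symm

theorem single_mem_tdeg (deg : B → ℕ) {m : ℕ} (x : Fin m → B) :
    (Finsupp.single x 1 : Tens R B m) ∈
      Finsupp.supported R R {y : Fin m → B | tdeg deg y = tdeg deg x} :=
  Finsupp.single_mem_supported _ _ (by simp)

theorem IsHomog.tensorHom {deg : B → ℕ} {c d m n p q : ℕ} {f : Tens R B m →ₗ[R] Tens R B n}
    {g : Tens R B p →ₗ[R] Tens R B q} (hf : IsHomog deg c f) (hg : IsHomog deg d g) :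
    IsHomog deg (c + d) (tensorHom deg d f g) := by
  intro x
  rw [tens_single_append x, tensorHom_single, tdeg_append]
  refine Submodule.smul_mem _ _ ?_
  have := append_mem deg (hf fun i => x (Fin.castAdd p i)) (hg fun j => x (Fin.natAdd m j))
  convert this using 5
  ring

theorem IsHomog.comp {deg : B → ℕ} {c d m n p : ℕ} {g : Tens R B n →ₗ[R] Tens R B p}
    {f : Tens R B m →ₗ[R] Tens R B n} (hg : IsHomog deg c g) (hf : IsHomog deg d f) :
    IsHomog deg (c + d) (g ∘ₗ f) := by
  intro x
  have := hg.map_mem (hf x)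
  rwa [add_assoc, add_comm d c] at this

theorem permHom_single (deg : B → ℕ) {m n : ℕ} (e : Fin m ≃ Fin n) (x : Fin m → B) :
    permHom deg e (Finsupp.single x (1 : R)) =
      Finsupp.single (x ∘ e.symm) (koszulSign R deg e x) := by
  simp [permHom]

theorem permHom_homog (deg : B → ℕ) {m n : ℕ} (e : Fin m ≃ Fin n) :
    IsHomog deg 0 (permHom (R := R) deg e) := by
  intro x
  rw [permHom_single]
  apply Finsupp.single_mem_supported
  simp only [Set.mem_ofPred_eq, tdeg, add_zero, Function.comp_apply]
  exact Equiv.sum_comp e.symm (fun i => deg (x i))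

theorem koszulSign_mono (deg : B → ℕ) {m n : ℕ} (e : Fin m ≃ Fin n)
    (he : ∀ i j, i < j → e i < e j) (x : Fin m → B) : koszulSign R deg e x = 1 := by
  unfold koszulSign
  refine Finset.prod_eq_one fun i _ => Finset.prod_eq_one fun j _ => ?_
  rw [if_neg]
  rintro ⟨h, h'⟩
  exact absurd (he i j h) (not_lt.2 h'.le)

theorem prod_pairs {m : ℕ} (f : Fin m → Fin m → R) (hf : ∀ i, f i i = 1) :
    ∏ i, ∏ j, f i j = ∏ i, ∏ j, if i < j then f i j * f j i else 1 := by
  have h1 : ∀ i j, f i j = (if i < j then f i j else 1) * (if j < i then f i j else 1) := by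
    intro i j
    rcases lt_trichotomy i j with h | h | h
    · simp [h, h.not_gt]
    · subst h; simp [hf]
    · simp [h, h.not_gt]
  have h2 : ∏ i, ∏ j, f i j = (∏ i, ∏ j, if i < j then f i j else 1) *
      ∏ i, ∏ j, if j < i then f i j else 1 := by
    rw [← Finset.prod_mul_distrib]
    refine Finset.prod_congr rfl fun i _ => ?_
    rw [← Finset.prod_mul_distrib]
    exact Finset.prod_congr rfl fun j _ => h1 i j
  rw [h2, Finset.prod_comm (f := fun i j => if j < i then f i j else 1),
    ← Finset.prod_mul_distrib]
  refine Finset.prod_congr rfl fun i _ => ?_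
  rw [← Finset.prod_mul_distrib]
  refine Finset.prod_congr rfl fun j _ => ?_
  split_ifs <;> simp

theorem koszulSign_trans (deg : B → ℕ) {m n p : ℕ} (e : Fin m ≃ Fin n) (e' : Fin n ≃ Fin p)
    (x : Fin m → B) :
    koszulSign R deg e x * koszulSign R deg e' (x ∘ e.symm) =
      koszulSign R deg (e.trans e') x := by
  have h : koszulSign R deg e' (x ∘ e.symm) = ∏ i, ∏ j,
      if e i < e j ∧ e' (e j) < e' (e i) then (-1 : R) ^ (deg (x i) * deg (x j)) else 1 := by
    unfold koszulSign
    rw [← Equiv.prod_comp e]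
    refine Finset.prod_congr rfl fun i _ => ?_
    rw [← Equiv.prod_comp e]
    simp
  rw [h]
  unfold koszulSign
  rw [← Finset.prod_mul_distrib]
  simp_rw [← Finset.prod_mul_distrib]
  rw [prod_pairs _ (by simp), prod_pairs (fun i j => if i < j ∧ (e.trans e') j < (e.trans e') i
    then (-1 : R) ^ (deg (x i) * deg (x j)) else 1) (by simp)]
  refine Finset.prod_congr rfl fun i _ => Finset.prod_congr rfl fun j _ => ?_
  by_cases hij : i < j
  · have hs : (-1 : R) ^ (deg (x j) * deg (x i)) = (-1 : R) ^ (deg (x i) * deg (x j)) := by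
      rw [mul_comm]
    have hsq : (-1 : R) ^ (deg (x i) * deg (x j)) * (-1 : R) ^ (deg (x i) * deg (x j)) = 1 := by
      rw [← mul_pow]; simp
    have hne : e i ≠ e j := fun h => hij.ne (e.injective h)
    have hne' : e' (e i) ≠ e' (e j) := fun h => hne (e'.injective h)
    rcases hne.lt_or_gt with h1 | h1 <;> rcases hne'.lt_or_gt with h2 | h2 <;>
      simp [hij, hij.not_gt, h1, h1.not_gt, h2, h2.not_gt, hs, hsq]
  · simp [hij]

theorem permHom_trans (deg : B → ℕ) {m n p : ℕ} (e : Fin m ≃ Fin n) (e' : Fin n ≃ Fin p) :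
    permHom (R := R) deg e' ∘ₗ permHom deg e = permHom deg (e.trans e') := by
  apply tens_ext
  intro x
  have : Finsupp.single (x ∘ e.symm) (koszulSign R deg e x)
      = koszulSign R deg e x • Finsupp.single (x ∘ e.symm) 1 := by simp
  rw [LinearMap.comp_apply, permHom_single, this, map_smul, permHom_single, permHom_single,
    ← koszulSign_trans]
  simp [Function.comp_assoc]

theorem permHom_refl (deg : B → ℕ) (n : ℕ) :
    permHom (R := R) deg (Equiv.refl (Fin n)) = LinearMap.id := by
  apply tens_ext
  intro x
  rw [permHom_single, koszulSign_mono _ _ (fun i j h => h)]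
  simp

theorem castAdd_lt_castAdd {m p : ℕ} (i j : Fin m) :
    Fin.castAdd p i < Fin.castAdd p j ↔ i < j := Iff.rfl

theorem castAdd_lt_natAdd {m p : ℕ} (i : Fin m) (j : Fin p) :
    Fin.castAdd p i < Fin.natAdd m j := by
  rw [Fin.lt_def, Fin.val_castAdd, Fin.val_natAdd]; omega

theorem not_natAdd_lt_castAdd {m p : ℕ} (i : Fin m) (j : Fin p) :
    ¬ Fin.natAdd m j < Fin.castAdd p i :=
  (castAdd_lt_natAdd i j).not_gt

theorem permHom_block (deg : B → ℕ) {m n p q : ℕ} (e : Fin m ≃ Fin n) (e' : Fin p ≃ Fin q) :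
    tensorHom deg 0 (permHom (R := R) deg e) (permHom deg e') = permHom deg (blockSum e e') := by
  apply tens_ext
  intro x
  rw [tens_single_append x, tensorHom_single, permHom_single, permHom_single, permHom_single,
    append_single]
  simp only [zero_mul, pow_zero, one_smul]
  congr 1
  · funext i
    refine Fin.addCases (fun i => ?_) (fun i => ?_) i <;> simp [blockSum]
  · simp [koszulSign, Fin.prod_univ_add, blockSum, Finset.prod_mul_distrib,
      not_natAdd_lt_castAdd, castAdd_lt_castAdd]

theorem permHom_flip (deg : B → ℕ) {m p : ℕ} (x : Fin m → B) (y : Fin p → B) :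
    permHom deg finAddFlip (Finsupp.single (Fin.append x y) (1 : R)) =
      (-1 : R) ^ (tdeg deg x * tdeg deg y) • Finsupp.single (Fin.append y x) 1 := by
  rw [permHom_single]
  have h1 : (Fin.append x y) ∘ finAddFlip.symm = Fin.append y x := by
    funext i
    refine Fin.addCases (fun i => ?_) (fun i => ?_) i <;> simp [finAddFlip]
  rw [h1, Finsupp.smul_single]
  congr 1
  have a4 : ∀ {k : ℕ} (i j : Fin k), ¬ (i < j ∧ j < i) := fun i j h => h.1.not_gt h.2
  simp [koszulSign, Fin.prod_univ_add, Finset.prod_mul_distrib, castAdd_lt_natAdd,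
    not_natAdd_lt_castAdd, castAdd_lt_castAdd, a4, tdeg, Finset.sum_mul_sum, Finset.prod_pow_eq_pow_sum]

theorem permHom_flip_append (deg : B → ℕ) {m p k l : ℕ} {a : Tens R B m} {b : Tens R B p}
    (ha : a ∈ Finsupp.supported R R {y : Fin m → B | tdeg deg y = k})
    (hb : b ∈ Finsupp.supported R R {y : Fin p → B | tdeg deg y = l}) :
    permHom deg finAddFlip (append a b) = (-1 : R) ^ (k * l) • append b a := by
  refine supported_induction (P := fun a => permHom deg finAddFlip (append a b) =
    (-1 : R) ^ (k * l) • append b a) (by simp) ?_ ?_ ?_ ha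
  · intro x hx
    refine supported_induction (P := fun b => permHom deg finAddFlip
      (append (Finsupp.single x 1) b) = (-1 : R) ^ (k * l) • append b (Finsupp.single x 1))
      (by simp) ?_ ?_ ?_ hb
    · intro y hy
      simp only [Set.mem_ofPred_eq] at hx hy
      rw [append_single, append_single, mul_one, permHom_flip, hx, hy]
    · intro a b ha hb; simp [ha, hb]
    · intro c a ha; simp [ha, smul_comm c]
  · intro a b ha hb; simp [ha, hb]
  · intro c a ha; simp [ha, smul_comm c]

theorem permHom_assoc (deg : B → ℕ) {n q l : ℕ} (a : Tens R B n) (b : Tens R B q)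
    (c : Tens R B l) :
    permHom deg (finCongr (Nat.add_assoc n q l)) (append (append a b) c) =
      append a (append b c) := by
  induction a using Finsupp.induction_linear with
  | zero => simp
  | add a a' h h' => simp [h, h']
  | single x r =>
    induction b using Finsupp.induction_linear with
    | zero => simp
    | add a a' h h' => simp [h, h']
    | single y s =>
      induction c using Finsupp.induction_linear with
      | zero => simp
      | add a a' h h' => simp [h, h']
      | single z t =>
        have : Finsupp.single (Fin.append (Fin.append x y) z) (r * s * t)
          = (r * s * t) • Finsupp.single (Fin.append (Fin.append x y) z) 1 := by simp
        rw [append_single, append_single, append_single, append_single, this, map_smul,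
          permHom_single, koszulSign_mono _ _ (fun i j h => h), Fin.append_assoc]
        simp only [Finsupp.smul_single, smul_eq_mul, mul_one, mul_assoc]
        rfl

theorem permHom_cast_single (deg : B → ℕ) {m n : ℕ} (h : m = n) (x : Fin m → B) :
    permHom deg (finCongr h) (Finsupp.single x (1 : R)) =
      Finsupp.single (x ∘ (finCongr h).symm) 1 := by
  rw [permHom_single, koszulSign_mono _ _ (fun i j h => h)]

theorem MBialgebra.eval_homog (A : MBialgebra R B) {m n : ℕ} (g : Graph m n) :
    IsHomog A.deg g.deg (A.eval g) := by
  induction g with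
  | counit => exact A.counit_homog
  | coprod => exact A.coprod_homog
  | prod => exact A.prod_homog
  | perm e => exact permHom_homog _ _
  | comp g f hg hf => exact hg.comp hf
  | juxt f g hf hg => exact hf.tensorHom hg

/-- The linear extension of `eval`. -/
def MBialgebra.evalLin (A : MBialgebra R B) (m n : ℕ) :
    (Graph m n →₀ R) →ₗ[R] (Tens R B m →ₗ[R] Tens R B n) :=
  Finsupp.linearCombination R A.eval

theorem MBialgebra.evalLin_gr (A : MBialgebra R B) {m n : ℕ} (g : Graph m n) :
    A.evalLin m n (gr R g) = A.eval g := by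
  simp [evalLin, gr]

theorem MBialgebra.eval_id (A : MBialgebra R B) (n : ℕ) :
    A.eval (Graph.id n) = LinearMap.id := permHom_refl _ _

theorem MBialgebra.evalLin_mapDomain (A : MBialgebra R B) {m n p q : ℕ}
    (F : Graph m n → Graph p q)
    (L : (Tens R B m →ₗ[R] Tens R B n) →ₗ[R] (Tens R B p →ₗ[R] Tens R B q))
    (u : Graph m n →₀ R) (h : ∀ g ∈ u.support, A.eval (F g) = L (A.eval g)) :
    A.evalLin p q (u.mapDomain F) = L (A.evalLin m n u) := by
  simp only [evalLin, Finsupp.linearCombination_mapDomain]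
  rw [Finsupp.linearCombination_apply, Finsupp.linearCombination_apply, Finsupp.sum,
    Finsupp.sum, map_sum]
  exact Finset.sum_congr rfl fun g hg => by simp [h g hg]

/-- `tensorHom` as a bilinear map. -/
def tensorHomBilin (deg : B → ℕ) (d m n p q : ℕ) :
    (Tens R B m →ₗ[R] Tens R B n) →ₗ[R] (Tens R B p →ₗ[R] Tens R B q) →ₗ[R]
      (Tens R B (m + p) →ₗ[R] Tens R B (n + q)) :=
  LinearMap.mk₂ R (tensorHom deg d)
    (fun f f' g => tens_ext fun x => by simp [tensorHom])
    (fun c f g => tens_ext fun x => by simp [tensorHom, smul_comm c])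
    (fun f g g' => tens_ext fun x => by simp [tensorHom])
    (fun c f g => tens_ext fun x => by simp [tensorHom, smul_comm c])

theorem homog_of_sub (R : Type u) [CommRing R] {m n : ℕ} (g g' : Graph m n) (c : R)
    (h : g.deg = g'.deg) :
    ∀ a ∈ (gr R g - c • gr R g').support, a.deg = g.deg := by
  intro a ha
  by_contra hne
  have h1 : g ≠ a := fun h' => hne (by rw [h'])
  have h2 : g' ≠ a := fun h' => hne (by rw [h, h'])
  simp [gr, h1, h2] at ha

theorem homog_of_sub' (R : Type u) [CommRing R] {m n : ℕ} (g g' : Graph m n)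
    (h : g.deg = g'.deg) :
    ∀ a ∈ (gr R g - gr R g').support, a.deg = g.deg := by
  simpa using homog_of_sub R g g' 1 h

theorem Rel.homog {m n : ℕ} {u : Graph m n →₀ R} (h : Rel R u) :
    ∃ d, ∀ g ∈ u.support, g.deg = d := by
  induction h with
  | interchange g f g' f' => exact ⟨_, homog_of_sub R _ _ _ (by simp [Graph.deg]; ring)⟩
  | perm_flip f g => exact ⟨_, homog_of_sub R _ _ _ (by simp [Graph.deg]; ring)⟩
  | prod_counit =>
    refine ⟨(Graph.counit.comp Graph.prod).deg, fun g hg => ?_⟩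
    have := Finsupp.support_single_subset hg
    rw [Finset.mem_singleton] at this
    rw [this]
  | comp_left g hu ih =>
    obtain ⟨d, hd⟩ := ih
    refine ⟨g.deg + d, fun a ha => ?_⟩
    classical
    obtain ⟨b, hb, rfl⟩ := Finset.mem_image.1 (Finsupp.mapDomain_support ha)
    simp [Graph.deg, hd b hb]
  | comp_right hu f ih =>
    obtain ⟨d, hd⟩ := ih
    refine ⟨d + f.deg, fun a ha => ?_⟩
    classical
    obtain ⟨b, hb, rfl⟩ := Finset.mem_image.1 (Finsupp.mapDomain_support ha)
    simp [Graph.deg, hd b hb]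
  | juxt_left f hu ih =>
    obtain ⟨d, hd⟩ := ih
    refine ⟨f.deg + d, fun a ha => ?_⟩
    classical
    obtain ⟨b, hb, rfl⟩ := Finset.mem_image.1 (Finsupp.mapDomain_support ha)
    simp [Graph.deg, hd b hb]
  | juxt_right hu g ih =>
    obtain ⟨d, hd⟩ := ih
    refine ⟨d + g.deg, fun a ha => ?_⟩
    classical
    obtain ⟨b, hb, rfl⟩ := Finset.mem_image.1 (Finsupp.mapDomain_support ha)
    simp [Graph.deg, hd b hb]
  | _ => exact ⟨_, homog_of_sub' R _ _ (by simp [Graph.deg, Graph.id]; try ring)⟩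

theorem tens_single_append' {m p : ℕ} {M : Type*} [AddCommMonoid M] [Module R M]
    {f g : Tens R B (m + p) →ₗ[R] M}
    (h : ∀ x y, f (Finsupp.single (Fin.append x y) 1) = g (Finsupp.single (Fin.append x y) 1)) :
    f = g :=
  tens_ext fun x => by rw [tens_single_append x]; exact h _ _

theorem MBialgebra.evalLin_rel (A : MBialgebra R B) {m n : ℕ} {u : Graph m n →₀ R}
    (h : Rel R u) : A.evalLin m n u = 0 := by
  induction h with
  | comp_assoc h g f => 
    rw [map_sub, evalLin_gr, evalLin_gr, sub_eq_zero]; rfl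
  | id_comp f => rw [map_sub, evalLin_gr, evalLin_gr, sub_eq_zero, eval, eval_id]; rfl
  | comp_id f => rw [map_sub, evalLin_gr, evalLin_gr, sub_eq_zero, eval, eval_id]; rfl
  | juxt_assoc f g h =>
    rw [map_sub, evalLin_gr, evalLin_gr, sub_eq_zero]
    simp only [eval]
    apply tens_single_append'
    intro xy z
    rw [tens_single_append xy]
    generalize (fun i => xy (Fin.castAdd _ i)) = x
    generalize (fun i => xy (Fin.natAdd _ i)) = y
    have e : permHom A.deg (finCongr (Nat.add_assoc _ _ _))
        (Finsupp.single (Fin.append (Fin.append x y) z) (1 : R)) =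
        append (Finsupp.single x 1) (append (Finsupp.single y 1) (Finsupp.single z 1)) := by
      rw [← permHom_assoc A.deg]; simp [append_single]
    rw [LinearMap.comp_apply, LinearMap.comp_apply, e, tensorHom_single, tensorHom_single,
      tensorHom_append _ _ _ _ _ (single_mem_tdeg _ x), 
      tensorHom_append _ _ _ _ _ (single_mem_tdeg _ y)]
    simp only [map_smul, LinearMap.smul_apply, permHom_assoc, smul_smul, ← pow_add, tdeg_append]
    congr 2
    simp only [Graph.deg]
    ring
  | id_juxt f =>
    rw [map_sub, evalLin_gr, evalLin_gr, sub_eq_zero]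
    simp only [eval, eval_id]
    apply tens_single_append'
    intro x y
    have e : ∀ {k : ℕ} (b : Tens R B k), permHom A.deg (finCongr (Nat.zero_add k))
        (append (Finsupp.single x 1) b) = b := by
      intro k b
      induction b using Finsupp.induction_linear with
      | zero => simp
      | add a a' h h' => simp [h, h']
      | single z t =>
        have : Finsupp.single (Fin.append x z) t
          = t • Finsupp.single (Fin.append x z) 1 := by simp
        rw [append_single, one_mul, this, map_smul, permHom_cast_single]
        simp only [Finsupp.smul_single, smul_eq_mul, mul_one]
        congr 1
        funext i
        have : (finCongr (Nat.zero_add k)).symm i = Fin.natAdd 0 i := by ext; simp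
        rw [Function.comp_apply, this, Fin.append_right]
    have e2 := e (Finsupp.single y 1)
    rw [append_single, one_mul] at e2
    rw [LinearMap.comp_apply, LinearMap.comp_apply, e2, tensorHom_single]
    simp [tdeg, e]
  | juxt_id f =>
    rw [map_sub, evalLin_gr, evalLin_gr, sub_eq_zero]
    simp only [eval, eval_id]
    apply tens_single_append'
    intro x y
    have e : ∀ {k : ℕ} (b : Tens R B k), permHom A.deg (finCongr (Nat.add_zero k))
        (append b (Finsupp.single y 1)) = b := by
      intro k b
      induction b using Finsupp.induction_linear with
      | zero => simp
      | add a a' h h' => rw [map_add, LinearMap.add_apply, map_add, h, h']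
      | single z t =>
        have : Finsupp.single (Fin.append z y) t
          = t • Finsupp.single (Fin.append z y) 1 := by simp
        rw [append_single, mul_one, this, map_smul, permHom_cast_single]
        simp only [Finsupp.smul_single, smul_eq_mul, mul_one]
        congr 1
        funext i
        have : (finCongr (Nat.add_zero k)).symm i = Fin.castAdd 0 i := by ext; simp
        rw [Function.comp_apply, this, Fin.append_left]
    have e2 := e (Finsupp.single x 1)
    rw [append_single, one_mul] at e2
    rw [LinearMap.comp_apply, LinearMap.comp_apply, e2, tensorHom_single]
    rw [map_smul, LinearMap.id_apply, e]
    simp [Graph.id, Graph.deg]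
  | interchange g f g' f' =>
    rw [map_sub, map_smul, evalLin_gr, evalLin_gr, sub_eq_zero]
    simp only [eval]
    apply tens_single_append'
    intro x y
    rw [LinearMap.comp_apply, LinearMap.smul_apply, tensorHom_single, tensorHom_single, map_smul,
      tensorHom_append _ _ _ _ _ (A.eval_homog f x)]
    simp only [smul_smul, ← pow_add, LinearMap.comp_apply]
    congr 2
    simp only [Graph.deg]
    ring
  | perm_comp e e' => 
    rw [map_sub, evalLin_gr, evalLin_gr, sub_eq_zero]; exact permHom_trans _ _ _
  | perm_juxt e e' =>
    rw [map_sub, evalLin_gr, evalLin_gr, sub_eq_zero]; exact permHom_block _ _ _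
  | perm_flip f g =>
    rw [map_sub, map_smul, evalLin_gr, evalLin_gr, sub_eq_zero]
    simp only [eval]
    apply tens_single_append'
    intro x y
    rw [LinearMap.comp_apply, LinearMap.smul_apply, LinearMap.comp_apply, permHom_flip, map_smul,
      tensorHom_single, tensorHom_single, map_smul,
      permHom_flip_append _ (A.eval_homog f x) (A.eval_homog g y)]
    simp only [smul_smul, ← pow_add]
    congr 1
    rw [show g.deg * tdeg A.deg x + (tdeg A.deg x + f.deg) * (tdeg A.deg y + g.deg) =
      2 * (g.deg * tdeg A.deg x) + (f.deg * g.deg + (tdeg A.deg x * tdeg A.deg y +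
        f.deg * tdeg A.deg y)) by ring, pow_add, pow_mul]
    simp
  | counit_left =>
    rw [map_sub, evalLin_gr, evalLin_gr, sub_eq_zero]
    simp only [eval, eval_id]
    exact A.counit_left
  | counit_right =>
    rw [map_sub, evalLin_gr, evalLin_gr, sub_eq_zero]
    simp only [eval, eval_id]
    exact A.counit_right
  | prod_counit => rw [evalLin_gr]; exact A.prod_counit
  | comp_left g hu ih =>
    rw [A.evalLin_mapDomain _ (LinearMap.llcomp R _ _ _ (A.eval g)) _ (fun f _ => rfl), ih,
      map_zero]
  | comp_right hu f ih =>
    rw [A.evalLin_mapDomain _ (LinearMap.lcomp R _ (A.eval f)) _ (fun f _ => rfl), ih,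
      map_zero]
  | juxt_left f hu ih =>
    obtain ⟨d, hd⟩ := hu.homog
    rw [A.evalLin_mapDomain _ (tensorHomBilin A.deg d _ _ _ _ (A.eval f)) _
      (fun g hg => by rw [eval, hd g hg]; rfl), ih, map_zero]
  | juxt_right hu g ih =>
    rw [A.evalLin_mapDomain _ ((tensorHomBilin A.deg g.deg _ _ _ _).flip (A.eval g)) _
      (fun g hg => rfl), ih, map_zero]

/-- The action of the prop `M` on an `M`-bialgebra: `M(m,n) → Hom(C^{⊗ m}, C^{⊗ n})`. For
`m = 1` it is the structure of a `forget(M)`-coalgebra. -/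
def MBialgebra.act (A : MBialgebra R B) (m n : ℕ) :
    PropM R m n →ₗ[R] (Tens R B m →ₗ[R] Tens R B n) :=
  Submodule.liftQ (R₂ := R) (M₂ := Tens R B m →ₗ[R] Tens R B n) (τ₁₂ := RingHom.id R)
    (Submodule.span R {u : Graph m n →₀ R | Rel R u}) (A.evalLin m n)
    (Submodule.span_le.2 fun u (hu : Rel R u) => LinearMap.mem_ker.2 (A.evalLin_rel hu))

end Soundness

end CartanSerre

namespace CartanSerre

universe u

/-! ## The cells of the cube and of the simplex -/

/-- The cells `[0]`, `[1]` and `[0,1]` of the interval. -/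
inductive Face
  | zero
  | one
  | edge
  deriving DecidableEq

/-- The cells `x_1 ⊗ ⋯ ⊗ x_n` of the standard cube `□^n`. -/
abbrev CubeCell (n : ℕ) : Type := Fin n → Face

/-- The nondegenerate simplices `[v_0, …, v_m]`, `v_0 < ⋯ < v_m`, of the standard simplex `△^n`,
as nonempty sets of vertices. -/
abbrev SimplexCell (n : ℕ) : Type := {s : Finset (Fin (n + 1)) // s.Nonempty}

section Cells

variable {n : ℕ}

/-- The positions `q_1 < ⋯ < q_m` of the factors `[0,1]` of a cell of the cube. -/
def edges (x : CubeCell n) : Finset (Fin n) := Finset.univ.filter fun i => x i = Face.edge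

/-- The dimension of a cell of the cube. -/
def cubeDim (x : CubeCell n) : ℕ := (edges x).card

/-- The dimension of a cell of the simplex. -/
def simplexDim (s : SimplexCell n) : ℕ := s.1.card - 1

theorem mem_edges {x : CubeCell n} {i : Fin n} : i ∈ edges x ↔ x i = Face.edge := by
  simp [edges]

end Cells

/-! ## The chain complexes `C(□^n)` and `C(△^n)` -/

section Chains

variable (R : Type u) [CommRing R] (n : ℕ)

/-- The boundary of `C(□^n) = C(□^1)^{⊗ n}`, where `∂[0,1] = [1] - [0]`. -/
def cubeBoundary : (CubeCell n →₀ R) →ₗ[R] (CubeCell n →₀ R) :=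
  Finsupp.linearCombination R fun x =>
    ∑ i ∈ edges x, (-1 : R) ^ ((edges x).filter fun j => j < i).card •
      (Finsupp.single (Function.update x i Face.one) 1 -
        Finsupp.single (Function.update x i Face.zero) 1)

/-- The boundary of `C(△^n)`, `∂[v_0, …, v_m] = ∑ (-1)^i [v_0, …, v̂_i, …, v_m]` for `m > 0`. -/
def simplexBoundary : (SimplexCell n →₀ R) →ₗ[R] (SimplexCell n →₀ R) :=
  Finsupp.linearCombination R fun s =>
    ∑ v ∈ s.1, if h : (s.1.erase v).Nonempty then
      Finsupp.single ⟨s.1.erase v, h⟩ ((-1 : R) ^ (s.1.filter fun w => w < v).card) else 0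

variable {R n}

theorem sum_erase_antisymm {α M : Type*} [DecidableEq α] [AddCommGroup M] (E : Finset α)
    (G : α → α → M) (h : ∀ i ∈ E, ∀ j ∈ E, i ≠ j → G i j + G j i = 0) :
    ∑ i ∈ E, ∑ j ∈ E.erase i, G i j = 0 := by
  rw [Finset.sum_sigma']
  refine Finset.sum_involution (fun a _ => ⟨a.2, a.1⟩) ?_ ?_ ?_ ?_
  · rintro ⟨i, j⟩ hij
    simp only [Finset.mem_sigma, Finset.mem_erase] at hij
    exact h i hij.1 j hij.2.2 hij.2.1.symm
  · rintro ⟨i, j⟩ hij _ he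
    simp only [Finset.mem_sigma, Finset.mem_erase] at hij
    simp only [Sigma.mk.injEq, heq_eq_eq] at he
    exact hij.2.1 he.1
  · rintro ⟨i, j⟩ hij
    simp only [Finset.mem_sigma, Finset.mem_erase] at hij ⊢
    exact ⟨hij.2.2, hij.2.1.symm, hij.1⟩
  · rintro ⟨i, j⟩ _; rfl

theorem sign_erase {α : Type*} [LinearOrder α] (R : Type u) [CommRing R] (E : Finset α)
    {i j : α} (hi : i ∈ E) (hj : j ∈ E) (hij : i ≠ j) :
    (-1 : R) ^ (E.filter fun k => k < i).card *
        (-1 : R) ^ ((E.erase i).filter fun k => k < j).card +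
      (-1 : R) ^ (E.filter fun k => k < j).card *
        (-1 : R) ^ ((E.erase j).filter fun k => k < i).card = 0 := by
  wlog h : i < j generalizing i j
  · rw [add_comm]
    exact this hj hi hij.symm (lt_of_le_of_ne (not_lt.1 h) hij.symm)
  have h1 : (E.erase j).filter (fun k => k < i) = E.filter fun k => k < i := by
    ext k
    simp only [Finset.mem_filter, Finset.mem_erase]
    constructor
    · rintro ⟨⟨_, h1⟩, h2⟩; exact ⟨h1, h2⟩
    · rintro ⟨h1, h2⟩; exact ⟨⟨(h2.trans h).ne, h1⟩, h2⟩
  have h2 : (E.filter fun k => k < j).card = ((E.erase i).filter fun k => k < j).card + 1 := by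
    rw [Finset.filter_erase, Finset.card_erase_add_one]
    simp [hi, h]
  rw [h1, h2, pow_succ]
  ring

theorem edges_update {x : CubeCell n} {i : Fin n} {a : Face} (ha : a ≠ Face.edge) :
    edges (Function.update x i a) = (edges x).erase i := by
  ext j
  by_cases h : j = i
  · subst h; simp [mem_edges, ha]
  · simp [mem_edges, h]

theorem cubeBoundary_single (x : CubeCell n) :
    cubeBoundary R n (Finsupp.single x 1) =
      ∑ i ∈ edges x, (-1 : R) ^ ((edges x).filter fun j => j < i).card •
        (Finsupp.single (Function.update x i Face.one) 1 -
          Finsupp.single (Function.update x i Face.zero) 1) := by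
  simp [cubeBoundary]

theorem cubeBoundary_sq : cubeBoundary R n ∘ₗ cubeBoundary R n = 0 := by
  refine Finsupp.lhom_ext' fun x => LinearMap.ext_ring ?_
  simp only [LinearMap.comp_apply, Finsupp.lsingle_apply, LinearMap.zero_apply]
  rw [cubeBoundary_single, map_sum]
  simp only [map_smul, map_sub]
  simp only [cubeBoundary_single, edges_update (show Face.one ≠ Face.edge by decide),
    edges_update (show Face.zero ≠ Face.edge by decide), ← Finset.sum_sub_distrib, Finset.smul_sum]
  refine sum_erase_antisymm _ _ fun i hi j hj hij => ?_
  have hs := sign_erase R (edges x) hi hj hij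
  simp only [← smul_sub, smul_smul]
  rw [Function.update_comm hij, Function.update_comm hij, Function.update_comm hij,
    Function.update_comm hij, eq_neg_of_add_eq_zero_left hs, neg_smul, ← smul_neg, ← smul_add]
  convert smul_zero _
  abel

theorem simplexBoundary_single (s : SimplexCell n) :
    simplexBoundary R n (Finsupp.single s 1) =
      ∑ v ∈ s.1, if h : (s.1.erase v).Nonempty then
        Finsupp.single ⟨s.1.erase v, h⟩ ((-1 : R) ^ (s.1.filter fun w => w < v).card) else 0 := by
  simp [simplexBoundary]

/-- The basis element of a set of vertices, or `0` if this set is empty. -/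
def simplexOrZero (R : Type u) [CommRing R] (s : Finset (Fin (n + 1))) : SimplexCell n →₀ R :=
  if h : s.Nonempty then Finsupp.single ⟨s, h⟩ 1 else 0

theorem simplexBoundary_orZero (s : Finset (Fin (n + 1))) :
    simplexBoundary R n (simplexOrZero R s) =
      ∑ v ∈ s, (-1 : R) ^ (s.filter fun w => w < v).card • simplexOrZero R (s.erase v) := by
  by_cases h : s.Nonempty
  · rw [simplexOrZero, dif_pos h, simplexBoundary_single]
    refine Finset.sum_congr rfl fun v _ => ?_
    unfold simplexOrZero
    split_ifs <;> simp
  · rw [simplexOrZero, dif_neg h, map_zero, Finset.not_nonempty_iff_eq_empty.1 h]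
    simp

theorem simplexBoundary_single' (s : SimplexCell n) :
    simplexBoundary R n (Finsupp.single s 1) =
      ∑ v ∈ s.1, (-1 : R) ^ (s.1.filter fun w => w < v).card • simplexOrZero R (s.1.erase v) := by
  rw [simplexBoundary_single]
  refine Finset.sum_congr rfl fun v _ => ?_
  unfold simplexOrZero
  split_ifs <;> simp

theorem simplexBoundary_sq : simplexBoundary R n ∘ₗ simplexBoundary R n = 0 := by
  refine Finsupp.lhom_ext' fun s => LinearMap.ext_ring ?_
  simp only [LinearMap.comp_apply, Finsupp.lsingle_apply, LinearMap.zero_apply]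
  rw [simplexBoundary_single', map_sum]
  simp only [map_smul]
  simp only [simplexBoundary_orZero, Finset.smul_sum]
  refine sum_erase_antisymm _ _ fun i hi j hj hij => ?_
  have hs := sign_erase R s.1 hi hj hij
  rw [Finset.erase_right_comm, smul_smul, smul_smul, ← add_smul, hs, zero_smul]

/-- The chain complex with `C_m` the span of the basis elements of degree `m`, for a boundary
defined on the whole free module. -/
def complexOf {B : Type} (deg : B → ℕ) (d : (B →₀ R) →ₗ[R] (B →₀ R)) (hd : d ∘ₗ d = 0)
    (hdeg : ∀ m, ∀ z ∈ Finsupp.supported R R {b : B | deg b = m + 1},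
      d z ∈ Finsupp.supported R R {b : B | deg b = m}) : ChainComplex (ModuleCat.{u} R) ℕ :=
  ChainComplex.of (fun m => ModuleCat.of R (Finsupp.supported R R {b : B | deg b = m}))
    (fun m => ModuleCat.ofHom (d.restrict (hdeg m)))
    (fun m => by
      exact ModuleCat.hom_ext (LinearMap.ext fun z => Subtype.ext (LinearMap.congr_fun hd _)))

theorem map_supported {B : Type} {d : (B →₀ R) →ₗ[R] (B →₀ R)} {s t : Set B}
    (h : ∀ b ∈ s, d (Finsupp.single b 1) ∈ Finsupp.supported R R t) :
    ∀ z ∈ Finsupp.supported R R s, d z ∈ Finsupp.supported R R t := by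
  intro z hz
  rw [Finsupp.supported_eq_span_single] at hz
  induction hz using Submodule.span_induction with
  | mem x hx => obtain ⟨y, hy, rfl⟩ := hx; exact h y hy
  | zero => simp
  | add x y _ _ hx hy => simpa using Submodule.add_mem _ hx hy
  | smul c x _ hx => simpa using Submodule.smul_mem _ c hx

theorem cubeBoundary_mem (m : ℕ) :
    ∀ z ∈ Finsupp.supported R R {x : CubeCell n | cubeDim x = m + 1},
      cubeBoundary R n z ∈ Finsupp.supported R R {x : CubeCell n | cubeDim x = m} := by
  refine map_supported fun x (hx : cubeDim x = m + 1) => ?_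
  rw [cubeBoundary_single]
  refine Submodule.sum_mem _ fun i hi => Submodule.smul_mem _ _ (Submodule.sub_mem _ ?_ ?_) <;>
  · apply Finsupp.single_mem_supported
    rw [Set.mem_ofPred_eq, cubeDim, edges_update (by decide), Finset.card_erase_of_mem hi]
    rw [cubeDim] at hx
    omega

theorem simplexBoundary_mem (m : ℕ) :
    ∀ z ∈ Finsupp.supported R R {s : SimplexCell n | simplexDim s = m + 1},
      simplexBoundary R n z ∈ Finsupp.supported R R {s : SimplexCell n | simplexDim s = m} := by
  refine map_supported fun s (hs : simplexDim s = m + 1) => ?_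
  rw [simplexBoundary_single]
  refine Submodule.sum_mem _ fun v hv => ?_
  split_ifs with h
  · apply Finsupp.single_mem_supported
    simp only [Set.mem_ofPred_eq, simplexDim] at hs ⊢
    rw [Finset.card_erase_of_mem hv]
    omega
  · exact Submodule.zero_mem _

variable (R n)

/-- The cellular chain complex `C(□^n)` of the cube. -/
def cubeChains : ChainComplex (ModuleCat.{u} R) ℕ :=
  complexOf cubeDim (cubeBoundary R n) cubeBoundary_sq cubeBoundary_mem

/-- The chain complex `C(△^n)` of normalized chains of the simplex. -/
def simplexChains : ChainComplex (ModuleCat.{u} R) ℕ :=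
  complexOf simplexDim (simplexBoundary R n) simplexBoundary_sq simplexBoundary_mem

end Chains

/-! ## The cubical `M`-bialgebra: the Serre coproduct and the degree one product -/

section CubeBialgebra

variable (R : Type u) [CommRing R] (n : ℕ)

/-- `ε(x) = 1` if `x` has no factor `[0,1]`, and `0` otherwise. -/
def cubeCounit : Tens R (CubeCell n) 1 →ₗ[R] Tens R (CubeCell n) 0 :=
  Finsupp.linearCombination R fun x =>
    if cubeDim (x 0) = 0 then Finsupp.single ![] 1 else 0

/-- The left factor of the term of `Δ x` given by a set `S` of positions of factors `[0,1]`: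
those in `S` are kept and the others are replaced by `[0]`. -/
def serreLeft {n : ℕ} (x : CubeCell n) (S : Finset (Fin n)) : CubeCell n := fun i =>
  if x i = Face.edge then (if i ∈ S then Face.edge else Face.zero) else x i

/-- The right factor of the term of `Δ x` given by a set `S` of positions of factors `[0,1]`:
those in `S` are replaced by `[1]` and the others are kept. -/
def serreRight {n : ℕ} (x : CubeCell n) (S : Finset (Fin n)) : CubeCell n := fun i =>
  if x i = Face.edge then (if i ∈ S then Face.one else Face.edge) else x i

/-- The Serre coproduct: the tensor product of `n` copies of the coalgebra `C(□^1)` with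
`Δ[0] = [0] ⊗ [0]`, `Δ[1] = [1] ⊗ [1]` and `Δ[0,1] = [0] ⊗ [0,1] + [0,1] ⊗ [1]`. The exponent of
the sign counts the pairs `i < j` for which the factor `[0,1]` in position `i` on the right was
moved past the factor `[0,1]` in position `j` on the left. -/
def cubeCoprod : Tens R (CubeCell n) 1 →ₗ[R] Tens R (CubeCell n) 2 :=
  Finsupp.linearCombination R fun x =>
    ∑ S ∈ (edges (x 0)).powerset,
      Finsupp.single ![serreLeft (x 0) S, serreRight (x 0) S]
        ((-1 : R) ^ (((edges (x 0) \ S) ×ˢ S).filter fun p => p.1 < p.2).card)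

/-- The coefficient of `[0,1]` in the product of two cells of the interval:
`[0] ∗ [1] = [0,1]`, `[1] ∗ [0] = -[0,1]` and all other products vanish. -/
def faceProd (R : Type u) [CommRing R] : Face → Face → R
  | Face.zero, Face.one => 1
  | Face.one, Face.zero => -1
  | _, _ => 0

/-- The cell `x_{<l} ⊗ [0,1] ⊗ y_{>l}`. -/
def joinCell {n : ℕ} (x y : CubeCell n) (l : Fin n) : CubeCell n := fun i =>
  if i < l then x i else if i = l then Face.edge else y i

/-- The degree one product
`x ∗ y = (-1)^{|x|} ∑_l x_{<l} ε(y_{<l}) ⊗ x_l ∗ y_l ⊗ ε(x_{>l}) y_{>l}`. -/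
def cubeProd : Tens R (CubeCell n) 2 →ₗ[R] Tens R (CubeCell n) 1 :=
  Finsupp.linearCombination R fun z =>
    (-1 : R) ^ cubeDim (z 0) •
      ∑ l, if (∀ i, i < l → z 1 i ≠ Face.edge) ∧ (∀ i, l < i → z 0 i ≠ Face.edge) then
        Finsupp.single ![joinCell (z 0) (z 1) l] (faceProd R (z 0 l) (z 1 l)) else 0

variable {R n}

theorem edges_serreLeft (x : CubeCell n) {S : Finset (Fin n)} (hS : S ⊆ edges x) :
    edges (serreLeft x S) = S := by
  ext i
  rw [mem_edges, serreLeft]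
  by_cases h : x i = Face.edge
  · by_cases h' : i ∈ S <;> simp [h, h']
  · simp only [h, if_false, false_iff]
    exact fun h' => h (mem_edges.1 (hS h'))

theorem edges_serreRight (x : CubeCell n) (S : Finset (Fin n)) :
    edges (serreRight x S) = edges x \ S := by
  ext i
  rw [mem_edges, Finset.mem_sdiff, mem_edges, serreRight]
  by_cases h : x i = Face.edge
  · by_cases h' : i ∈ S <;> simp [h, h']
  · simp [h]

theorem cubeCoprod_homog : IsHomog (R := R) cubeDim 0 (cubeCoprod R n) := by
  intro x
  simp only [cubeCoprod, Finsupp.linearCombination_single, one_smul]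
  refine Submodule.sum_mem _ fun S hS => Finsupp.single_mem_supported _ _ ?_
  have hS := Finset.mem_powerset.1 hS
  simp only [Set.mem_ofPred_eq, tdeg, Fin.sum_univ_two, Fin.sum_univ_one, cubeDim,
    Matrix.cons_val_zero, Matrix.cons_val_one, edges_serreLeft _ hS, edges_serreRight]
  have := Finset.card_sdiff_add_card_eq_card hS
  omega

theorem cubeCounit_homog : IsHomog (R := R) cubeDim 0 (cubeCounit R n) := by
  intro x
  simp only [cubeCounit, Finsupp.linearCombination_single, one_smul]
  split_ifs with h
  · apply Finsupp.single_mem_supported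
    simp [tdeg, h]
  · exact Submodule.zero_mem _

theorem cubeDim_joinCell {x y : CubeCell n} {l : Fin n}
    (hy : ∀ i, i < l → y i ≠ Face.edge) (hx : ∀ i, l < i → x i ≠ Face.edge)
    (hxl : x l ≠ Face.edge) (hyl : y l ≠ Face.edge) :
    cubeDim (joinCell x y l) = cubeDim x + cubeDim y + 1 := by
  have h : edges (joinCell x y l) = insert l (edges x ∪ edges y) := by
    ext i
    simp only [mem_edges, Finset.mem_insert, Finset.mem_union, joinCell]
    rcases lt_trichotomy i l with h | h | h
    · simp [h, h.ne, hy i h]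
    · simp [h]
    · simp [h.not_gt, h.ne', hx i h]
  have hd : Disjoint (edges x) (edges y) := by
    rw [Finset.disjoint_left]
    intro i hi hi'
    rw [mem_edges] at hi hi'
    rcases lt_trichotomy i l with h | h | h
    · exact hy i h hi'
    · exact hxl (h ▸ hi)
    · exact hx i h hi
  rw [cubeDim, h, Finset.card_insert_of_notMem, Finset.card_union_of_disjoint hd]
  · rfl
  · simp [mem_edges, hxl, hyl]

theorem cubeProd_homog : IsHomog (R := R) cubeDim 1 (cubeProd R n) := by
  intro z
  simp only [cubeProd, Finsupp.linearCombination_single, one_smul]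
  refine Submodule.smul_mem _ _ (Submodule.sum_mem _ fun l _ => ?_)
  split_ifs with h
  · by_cases hx : z 0 l = Face.edge
    · simp [hx, faceProd]
    · by_cases hy : z 1 l = Face.edge
      · cases h0 : z 0 l <;> simp [hy, faceProd]
      · apply Finsupp.single_mem_supported
        simp [tdeg, cubeDim_joinCell h.1 h.2 hx hy]
  · exact Submodule.zero_mem _

theorem cube_prod_counit : cubeCounit R n ∘ₗ cubeProd R n = 0 := by
  apply tens_ext
  intro z
  simp only [cubeProd, cubeCounit, LinearMap.comp_apply, Finsupp.linearCombination_single,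
    one_smul, map_smul, map_sum, LinearMap.zero_apply]
  rw [Finset.sum_eq_zero, smul_zero]
  intro l _
  split_ifs with h
  · rw [Finsupp.linearCombination_single, if_neg, smul_zero]
    simp only [cubeDim, Matrix.cons_val_fin_one, Finset.card_eq_zero]
    intro h
    have : l ∈ edges (joinCell (z 0) (z 1) l) := by simp [mem_edges, joinCell]
    simp [h] at this
  · simp

theorem vec_eq_append {B : Type} (a b : B) :
    (![a, b] : Fin 2 → B) = Fin.append (m := 1) (n := 1) ![a] ![b] := by
  funext i
  fin_cases i <;> rfl

theorem cubeCounit_single (x : CubeCell n) :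
    cubeCounit R n (Finsupp.single ![x] 1) =
      if cubeDim x = 0 then Finsupp.single ![] 1 else 0 := by
  simp [cubeCounit]

theorem cube_counit_left :
    tensorHom (n := 0) (p := 1) cubeDim 0 (cubeCounit R n) LinearMap.id ∘ₗ cubeCoprod R n =
      LinearMap.id := by
  apply tens_ext
  intro x
  simp only [cubeCoprod, LinearMap.comp_apply, Finsupp.linearCombination_single, one_smul, map_sum]
  have key : ∀ (a b : CubeCell n) (c : R),
      tensorHom (m := 1) (n := 0) (p := 1) cubeDim 0 (cubeCounit R n) LinearMap.id
        (Finsupp.single ![a, b] c) = if cubeDim a = 0 then Finsupp.single ![b] c else 0 := by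
    intro a b c
    have : Finsupp.single ![a, b] c = c • Finsupp.single (Fin.append (m := 1) (n := 1) ![a] ![b])
      (1 : R) := by simp [← vec_eq_append]
    rw [this, map_smul, tensorHom_single, cubeCounit_single]
    split_ifs
    · simp only [zero_mul, pow_zero, one_smul, LinearMap.id_apply, append_single, mul_one,
        Finsupp.smul_single, smul_eq_mul]
      congr 1
      funext i
      fin_cases i
      rfl
    · simp
  simp only [key]
  rw [Finset.sum_eq_single ∅]
  · have h1 : cubeDim (serreLeft (x 0) ∅) = 0 := by
      rw [cubeDim, edges_serreLeft _ (by simp), Finset.card_empty]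
    have h2 : serreRight (x 0) ∅ = x 0 := by
      funext i; simp +contextual [serreRight]
    rw [if_pos h1, h2]
    simp only [Finset.product_empty, Finset.filter_empty, Finset.card_empty, pow_zero,
      LinearMap.id_apply]
    congr 1
    funext i
    fin_cases i
    rfl
  · intro S hS hne
    rw [if_neg]
    rw [cubeDim, edges_serreLeft _ (Finset.mem_powerset.1 hS), Finset.card_eq_zero]
    exact hne
  · simp

theorem cube_counit_right :
    tensorHom (m := 1) (q := 0) cubeDim 0 LinearMap.id (cubeCounit R n) ∘ₗ cubeCoprod R n =
      LinearMap.id := by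
  apply tens_ext
  intro x
  simp only [cubeCoprod, LinearMap.comp_apply, Finsupp.linearCombination_single, one_smul, map_sum]
  have key : ∀ (a b : CubeCell n) (c : R),
      tensorHom (m := 1) (p := 1) (q := 0) cubeDim 0 LinearMap.id (cubeCounit R n)
        (Finsupp.single ![a, b] c) = if cubeDim b = 0 then Finsupp.single ![a] c else 0 := by
    intro a b c
    have : Finsupp.single ![a, b] c = c • Finsupp.single (Fin.append (m := 1) (n := 1) ![a] ![b])
      (1 : R) := by simp [← vec_eq_append]
    rw [this, map_smul, tensorHom_single, cubeCounit_single]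
    split_ifs
    · simp only [zero_mul, pow_zero, one_smul, LinearMap.id_apply, append_single, mul_one,
        Finsupp.smul_single, smul_eq_mul]
      congr 1
      funext i
      fin_cases i
      rfl
    · simp
  simp only [key]
  rw [Finset.sum_eq_single (edges (x 0))]
  · have h1 : cubeDim (serreRight (x 0) (edges (x 0))) = 0 := by
      rw [cubeDim, edges_serreRight, Finset.sdiff_self, Finset.card_empty]
    have h2 : serreLeft (x 0) (edges (x 0)) = x 0 := by
      funext i; simp +contextual [serreLeft, mem_edges]
    rw [if_pos h1, h2]
    simp only [Finset.sdiff_self, Finset.empty_product, Finset.filter_empty, Finset.card_empty,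
      pow_zero, LinearMap.id_apply]
    congr 1
    funext i
    fin_cases i
    rfl
  · intro S hS hne
    rw [if_neg]
    rw [cubeDim, edges_serreRight, Finset.card_eq_zero, Finset.sdiff_eq_empty_iff_subset]
    exact fun h => hne ((Finset.mem_powerset.1 hS).antisymm h)
  · simp

variable (R n)

/-- The `M`-bialgebra structure on `C(□^n)`. -/
def cubeBialgebra : MBialgebra R (CubeCell n) where
  deg := cubeDim
  counit := cubeCounit R n
  coprod := cubeCoprod R n
  prod := cubeProd R n
  counit_homog := cubeCounit_homog
  coprod_homog := cubeCoprod_homog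
  prod_homog := cubeProd_homog
  counit_left := cube_counit_left
  counit_right := cube_counit_right
  prod_counit := cube_prod_counit

end CubeBialgebra

/-! ## The simplicial `M`-bialgebra: the Alexander–Whitney coproduct and the join product -/

section SimplexBialgebra

variable (R : Type u) [CommRing R] (n : ℕ)

/-- `ε([v_0, …, v_m]) = 1` if `m = 0`, and `0` otherwise. -/
def simplexCounit : Tens R (SimplexCell n) 1 →ₗ[R] Tens R (SimplexCell n) 0 :=
  Finsupp.linearCombination R fun s =>
    if simplexDim (s 0) = 0 then Finsupp.single ![] 1 else 0

/-- The front face of a simplex, spanned by its vertices `≤ v`. -/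
def frontFace {n : ℕ} (s : SimplexCell n) (v : Fin (n + 1)) (hv : v ∈ s.1) : SimplexCell n :=
  ⟨s.1.filter fun w => w ≤ v, v, by simp [hv]⟩

/-- The back face of a simplex, spanned by its vertices `≥ v`. -/
def backFace {n : ℕ} (s : SimplexCell n) (v : Fin (n + 1)) (hv : v ∈ s.1) : SimplexCell n :=
  ⟨s.1.filter fun w => v ≤ w, v, by simp [hv]⟩

/-- The Alexander–Whitney coproduct
`Δ[v_0, …, v_m] = ∑ [v_0, …, v_i] ⊗ [v_i, …, v_m]`. -/
def simplexCoprod : Tens R (SimplexCell n) 1 →ₗ[R] Tens R (SimplexCell n) 2 :=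
  Finsupp.linearCombination R fun s =>
    ∑ v ∈ (s 0).1.attach,
      Finsupp.single ![frontFace (s 0) v.1 v.2, backFace (s 0) v.1 v.2] 1

/-- The degree one product: `(-1)^{|s| + |σ|}` times the simplex spanned by the vertices of `s`
and `t` if these are disjoint, and `0` otherwise. The sign of the permutation `σ` that orders the
vertices is given by the number of inversions. -/
def simplexProd : Tens R (SimplexCell n) 2 →ₗ[R] Tens R (SimplexCell n) 1 :=
  Finsupp.linearCombination R fun z =>
    if Disjoint (z 0).1 (z 1).1 then
      Finsupp.single ![⟨(z 0).1 ∪ (z 1).1, (z 0).2.mono Finset.subset_union_left⟩]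
        ((-1 : R) ^ (simplexDim (z 0) +
          (((z 0).1 ×ˢ (z 1).1).filter fun p => p.2 < p.1).card)) else 0

variable {R n}

theorem front_back_card (s : SimplexCell n) {v : Fin (n + 1)} (hv : v ∈ s.1) :
    (frontFace s v hv).1.card + (backFace s v hv).1.card = s.1.card + 1 := by
  have h1 : (frontFace s v hv).1 ∪ (backFace s v hv).1 = s.1 := by
    simp only [frontFace, backFace]
    rw [← Finset.filter_or]
    exact Finset.filter_true_of_mem fun w _ => le_total w v
  have h2 : (frontFace s v hv).1 ∩ (backFace s v hv).1 = {v} := by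
    ext w
    simp only [frontFace, backFace, Finset.mem_inter, Finset.mem_filter, Finset.mem_singleton]
    constructor
    · rintro ⟨⟨_, h⟩, _, h'⟩; exact le_antisymm h h'
    · rintro rfl; simp [hv]
  have := Finset.card_union_add_card_inter (frontFace s v hv).1 (backFace s v hv).1
  rw [h1, h2, Finset.card_singleton] at this
  exact this.symm

theorem simplexCoprod_homog : IsHomog (R := R) simplexDim 0 (simplexCoprod R n) := by
  intro s
  simp only [simplexCoprod, Finsupp.linearCombination_single, one_smul]
  refine Submodule.sum_mem _ fun v _ => Finsupp.single_mem_supported _ _ ?_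
  simp only [Set.mem_ofPred_eq, tdeg, Fin.sum_univ_two, Fin.sum_univ_one, simplexDim,
    Matrix.cons_val_zero, Matrix.cons_val_one]
  have h1 := front_back_card (s 0) v.2
  have h2 := (frontFace (s 0) v.1 v.2).2.card_pos
  have h3 := (backFace (s 0) v.1 v.2).2.card_pos
  omega

theorem simplexCounit_homog : IsHomog (R := R) simplexDim 0 (simplexCounit R n) := by
  intro s
  simp only [simplexCounit, Finsupp.linearCombination_single, one_smul]
  split_ifs with h
  · apply Finsupp.single_mem_supported
    simp [tdeg, h]
  · exact Submodule.zero_mem _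

theorem simplexProd_homog : IsHomog (R := R) simplexDim 1 (simplexProd R n) := by
  intro z
  simp only [simplexProd, Finsupp.linearCombination_single, one_smul]
  split_ifs with h
  · apply Finsupp.single_mem_supported
    simp only [Set.mem_ofPred_eq, tdeg, Fin.sum_univ_two, Fin.sum_univ_one, simplexDim,
      Matrix.cons_val_fin_one, Finset.card_union_of_disjoint h]
    have h2 := (z 0).2.card_pos
    have h3 := (z 1).2.card_pos
    omega
  · exact Submodule.zero_mem _

theorem simplex_prod_counit : simplexCounit R n ∘ₗ simplexProd R n = 0 := by
  apply tens_ext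
  intro z
  simp only [simplexProd, simplexCounit, LinearMap.comp_apply, Finsupp.linearCombination_single,
    one_smul, LinearMap.zero_apply]
  split_ifs with h
  · rw [Finsupp.linearCombination_single, if_neg, smul_zero]
    simp only [simplexDim, Matrix.cons_val_fin_one, Finset.card_union_of_disjoint h]
    have h2 := (z 0).2.card_pos
    have h3 := (z 1).2.card_pos
    omega
  · simp

theorem simplexCounit_single (s : SimplexCell n) :
    simplexCounit R n (Finsupp.single ![s] 1) =
      if simplexDim s = 0 then Finsupp.single ![] 1 else 0 := by
  simp [simplexCounit]

theorem simplex_counit_left :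
    tensorHom (n := 0) (p := 1) simplexDim 0 (simplexCounit R n) LinearMap.id ∘ₗ
      simplexCoprod R n = LinearMap.id := by
  apply tens_ext
  intro s
  simp only [simplexCoprod, LinearMap.comp_apply, Finsupp.linearCombination_single, one_smul,
    map_sum]
  have key : ∀ (a b : SimplexCell n),
      tensorHom (m := 1) (n := 0) (p := 1) simplexDim 0 (simplexCounit R n) LinearMap.id
        (Finsupp.single ![a, b] 1) = if simplexDim a = 0 then Finsupp.single ![b] 1 else 0 := by
    intro a b
    rw [vec_eq_append, tensorHom_single, simplexCounit_single]
    split_ifs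
    · simp only [zero_mul, pow_zero, one_smul, LinearMap.id_apply, append_single, mul_one]
      congr 1
      funext i
      fin_cases i
      rfl
    · simp
  simp only [key]
  rw [Finset.sum_eq_single ⟨(s 0).1.min' (s 0).2, Finset.min'_mem _ _⟩]
  · have h1 : (frontFace (s 0) _ (Finset.min'_mem _ (s 0).2)).1 = {(s 0).1.min' (s 0).2} := by
      ext w
      simp only [frontFace, Finset.mem_filter, Finset.mem_singleton]
      constructor
      · rintro ⟨h, h'⟩; exact le_antisymm h' (Finset.min'_le _ _ h)
      · rintro rfl; simp [Finset.min'_mem]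
    have h2 : backFace (s 0) _ (Finset.min'_mem _ (s 0).2) = s 0 := by
      apply Subtype.ext
      exact Finset.filter_true_of_mem fun w hw => Finset.min'_le _ _ hw
    rw [if_pos (by rw [simplexDim, h1]; simp), h2]
    simp only [LinearMap.id_apply]
    congr 1
    funext i
    fin_cases i
    rfl
  · rintro ⟨v, hv⟩ _ hne
    rw [if_neg]
    intro h
    have hlt : (s 0).1.min' (s 0).2 < v :=
      lt_of_le_of_ne (Finset.min'_le _ _ hv) fun h => hne (Subtype.ext h.symm)
    have : 1 < (frontFace (s 0) v hv).1.card := by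
      rw [Finset.one_lt_card]
      exact ⟨_, by simpa [frontFace] using ⟨Finset.min'_mem _ (s 0).2, hlt.le⟩, v,
        by simp [frontFace, hv], hlt.ne⟩
    simp only [simplexDim] at h
    omega
  · simp

theorem simplex_counit_right :
    tensorHom (m := 1) (q := 0) simplexDim 0 LinearMap.id (simplexCounit R n) ∘ₗ
      simplexCoprod R n = LinearMap.id := by
  apply tens_ext
  intro s
  simp only [simplexCoprod, LinearMap.comp_apply, Finsupp.linearCombination_single, one_smul,
    map_sum]
  have key : ∀ (a b : SimplexCell n),
      tensorHom (m := 1) (p := 1) (q := 0) simplexDim 0 LinearMap.id (simplexCounit R n)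
        (Finsupp.single ![a, b] 1) = if simplexDim b = 0 then Finsupp.single ![a] 1 else 0 := by
    intro a b
    rw [vec_eq_append, tensorHom_single, simplexCounit_single]
    split_ifs
    · simp only [zero_mul, pow_zero, one_smul, LinearMap.id_apply, append_single, mul_one]
      congr 1
      funext i
      fin_cases i
      rfl
    · simp
  simp only [key]
  rw [Finset.sum_eq_single ⟨(s 0).1.max' (s 0).2, Finset.max'_mem _ _⟩]
  · have h1 : (backFace (s 0) _ (Finset.max'_mem _ (s 0).2)).1 = {(s 0).1.max' (s 0).2} := by
      ext w
      simp only [backFace, Finset.mem_filter, Finset.mem_singleton]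
      constructor
      · rintro ⟨h, h'⟩; exact le_antisymm (Finset.le_max' _ _ h) h'
      · rintro rfl; simp [Finset.max'_mem]
    have h2 : frontFace (s 0) _ (Finset.max'_mem _ (s 0).2) = s 0 := by
      apply Subtype.ext
      exact Finset.filter_true_of_mem fun w hw => Finset.le_max' _ _ hw
    rw [if_pos (by rw [simplexDim, h1]; simp), h2]
    simp only [LinearMap.id_apply]
    congr 1
    funext i
    fin_cases i
    rfl
  · rintro ⟨v, hv⟩ _ hne
    rw [if_neg]
    intro h
    have hlt : v < (s 0).1.max' (s 0).2 :=
      lt_of_le_of_ne (Finset.le_max' _ _ hv) fun h => hne (Subtype.ext h)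
    have : 1 < (backFace (s 0) v hv).1.card := by
      rw [Finset.one_lt_card]
      exact ⟨v, by simp [backFace, hv], _,
        by simpa [backFace] using ⟨Finset.max'_mem _ (s 0).2, hlt.le⟩, hlt.ne⟩
    simp only [simplexDim] at h
    omega
  · simp

variable (R n)

/-- The `M`-bialgebra structure on `C(△^n)`. -/
def simplexBialgebra : MBialgebra R (SimplexCell n) where
  deg := simplexDim
  counit := simplexCounit R n
  coprod := simplexCoprod R n
  prod := simplexProd R n
  counit_homog := simplexCounit_homog
  coprod_homog := simplexCoprod_homog
  prod_homog := simplexProd_homog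
  counit_left := simplex_counit_left
  counit_right := simplex_counit_right
  prod_counit := simplex_prod_counit

end SimplexBialgebra

end CartanSerre

namespace CartanSerre

universe u

/-! ## The Cartan–Serre map and its cellular chain map -/

section Geometry

variable {n : ℕ}

/-- The Cartan–Serre map `(x_1, …, x_n) ↦ (x_1, x_1 x_2, …, x_1 x_2 ⋯ x_n)` from the cube
`{x | 0 ≤ x_i ≤ 1}` to the simplex `{y | 1 ≥ y_1 ≥ ⋯ ≥ y_n ≥ 0}`, extended to all of `ℝ^n` by the
same formula. -/
def cs (x : Fin n → ℝ) : Fin n → ℝ := fun i => ∏ j ∈ Finset.Iic i, x j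

/-- The characteristic map `ℝ^m ⊇ [0,1]^m → [0,1]^n` of an `m`-dimensional cell of the cube:
the `k`-th coordinate is put in the position of the `k`-th factor `[0,1]`. -/
def cubeChar (x : CubeCell n) {m : ℕ} (hx : cubeDim x = m) (p : Fin m → ℝ) : Fin n → ℝ := fun i =>
  if h : i ∈ edges x then p (((edges x).orderIsoOfFin hx).symm ⟨i, h⟩)
  else if x i = Face.one then 1 else 0

/-- The characteristic map of an `m`-dimensional simplex `[v_0, …, v_m]`:
`(y_1, …, y_m) ↦ (1, …, 1, y_1, …, y_1, …, y_m, …, y_m, 0, …, 0)`, with `v_0` entries `1`, with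
`v_k - v_{k-1}` entries `y_k`, and with `n - v_m` entries `0`. -/
def simplexChar (s : SimplexCell n) (m : ℕ) (y : Fin m → ℝ) : Fin n → ℝ := fun i =>
  let c := (s.1.filter fun v : Fin (n + 1) => (v : ℕ) ≤ (i : ℕ)).card
  if c = 0 then 1 else if h : c - 1 < m then y ⟨c - 1, h⟩ else 0

theorem simplex_card {s : SimplexCell n} {m : ℕ} (hs : simplexDim s = m) : s.1.card = m + 1 := by
  have := s.2.card_pos
  rw [simplexDim] at hs
  omega

/-- The linear left inverse of the characteristic map of `[v_0, …, v_m]`: the coordinate `y_{k+1}`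
is read off in position `v_k + 1` (position `v_k` when counted from `0`); one has `v_k < n` for
`k < m`. -/
def simplexCoord (s : SimplexCell n) {m : ℕ} (hs : simplexDim s = m) (z : Fin n → ℝ) :
    Fin m → ℝ := fun k =>
  if h : ((s.1.orderEmbOfFin (simplex_card hs) k.castSucc : Fin (n + 1)) : ℕ) < n then z ⟨_, h⟩
  else 0

/-- The open cube. -/
def openCube (m : ℕ) : Set (Fin m → ℝ) := {p | ∀ k, 0 < p k ∧ p k < 1}

/-- The closed cube. -/
def closedCube (m : ℕ) : Set (Fin m → ℝ) := {p | ∀ k, 0 ≤ p k ∧ p k ≤ 1}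

/-- The interior of the simplex `1 > y_1 > ⋯ > y_m > 0`. -/
def openSimplex (m : ℕ) : Set (Fin m → ℝ) := {y | (∀ k, 0 < y k ∧ y k < 1) ∧ StrictAnti y}

/-- The closed simplex `1 ≥ y_1 ≥ ⋯ ≥ y_m ≥ 0`. -/
def closedSimplex (m : ℕ) : Set (Fin m → ℝ) := {y | (∀ k, 0 ≤ y k ∧ y k ≤ 1) ∧ Antitone y}

/-- The barycenter of the simplex. -/
def barycenter (m : ℕ) : Fin m → ℝ := fun k => ((m : ℝ) - (k : ℕ)) / ((m : ℝ) + 1)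

/-- A map (defined on `ℝ^n`) sends the `m`-skeleton of the cube to the `m`-skeleton of the
simplex, for all `m`. -/
def IsCellular (f : (Fin n → ℝ) → (Fin n → ℝ)) : Prop :=
  ∀ (x : CubeCell n), ∀ p ∈ closedCube (cubeDim x),
    ∃ s : SimplexCell n, simplexDim s ≤ cubeDim x ∧
      ∃ y ∈ closedSimplex (simplexDim s), f (cubeChar x rfl p) = simplexChar s (simplexDim s) y

/-- The preimages, in the open cell `x`, of the point with coordinates `q` in the cell `s`. -/
def preimages (f : (Fin n → ℝ) → (Fin n → ℝ)) (x : CubeCell n) (s : SimplexCell n) {m : ℕ}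
    (hx : cubeDim x = m) (q : Fin m → ℝ) : Set (Fin m → ℝ) :=
  {p | p ∈ openCube m ∧ f (cubeChar x hx p) = simplexChar s m q}

/-- The Jacobian determinant at `p` of a map `f`, read in the coordinates of the cell `x` of the
cube and of the cell `s` of the simplex, both of dimension `m`. -/
def jacobian (f : (Fin n → ℝ) → (Fin n → ℝ)) (x : CubeCell n) (s : SimplexCell n) {m : ℕ}
    (hx : cubeDim x = m) (hs : simplexDim s = m) (p : Fin m → ℝ) : ℝ :=
  (fderiv ℝ (fun p => simplexCoord s hs (f (cubeChar x hx p))) p).det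

/-- The degree of `f` over the point `q` of the cell `s`, on the cell `x`: the number of preimages
of `q` in the open cell `x`, counted with the sign of the Jacobian determinant. -/
def localDegree (f : (Fin n → ℝ) → (Fin n → ℝ)) (x : CubeCell n) (s : SimplexCell n) {m : ℕ}
    (hx : cubeDim x = m) (hs : simplexDim s = m) (q : Fin m → ℝ) : ℤ :=
  ∑ᶠ p ∈ preimages f x s hx q, (SignType.sign (jacobian f x s hx hs p) : ℤ)

/-- All interior points of the cell `s` are regular values of `f` on the cell `x`, and the degree
of `f` over each of them is `d`. For a cellular map `f` this says that `d` is the degree of the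
map of spheres `x / ∂x → s / ∂s` defined by `f`. -/
def HasDegree (f : (Fin n → ℝ) → (Fin n → ℝ)) (x : CubeCell n) (s : SimplexCell n) {m : ℕ}
    (hx : cubeDim x = m) (hs : simplexDim s = m) (d : ℤ) : Prop :=
  ∀ q ∈ openSimplex m, (preimages f x s hx q).Finite ∧
    (∀ p ∈ preimages f x s hx q, jacobian f x s hx hs p ≠ 0) ∧ localDegree f x s hx hs q = d

/-- The degree of `f` from the cell `x` to the cell `s`, computed at the barycenter of `s`. -/
def cellDegree (f : (Fin n → ℝ) → (Fin n → ℝ)) (x : CubeCell n) (s : SimplexCell n)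
    (h : simplexDim s = cubeDim x) : ℤ :=
  localDegree f x s rfl h (barycenter (cubeDim x))

variable (R : Type u) [CommRing R]

/-- The map on cellular chains induced by a map `f` from the cube to the simplex: the coefficient
of `s` in the image of `x` is the degree of `f` from `x` to `s`. -/
def inducedMap (f : (Fin n → ℝ) → (Fin n → ℝ)) : (CubeCell n →₀ R) →ₗ[R] (SimplexCell n →₀ R) :=
  Finsupp.linearCombination R fun x =>
    ∑ s : SimplexCell n, if h : simplexDim s = cubeDim x then
      Finsupp.single s ((cellDegree f x s h : ℤ) : R) else 0

/-- The map `CS : C(□^n) → C(△^n)` induced by the Cartan–Serre map. -/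
def CS (n : ℕ) : (CubeCell n →₀ R) →ₗ[R] (SimplexCell n →₀ R) := inducedMap R (cs (n := n))

/-- The inclusion of the degree `m` part in the module of all cubical chains. -/
def cubeIncl (n m : ℕ) : (cubeChains R n).X m →ₗ[R] (CubeCell n →₀ R) :=
  (Finsupp.supported R R {x : CubeCell n | cubeDim x = m}).subtype

/-- The inclusion of the degree `m` part in the module of all simplicial chains. -/
def simplexIncl (n m : ℕ) : (simplexChains R n).X m →ₗ[R] (SimplexCell n →₀ R) :=
  (Finsupp.supported R R {s : SimplexCell n | simplexDim s = m}).subtype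

end Geometry

end CartanSerre

end

open CartanSerre CategoryTheory

/-!
# The Cartan–Serre map is a quasi-isomorphism of shuffle coalgebras

*Geometry.* Let `x` be a cell of the cube, let `p` be the position of its first factor `[0]` (or `n`
if there is none), and let `E` be the set of positions of its factors `[0,1]`. On `x` the coordinates
`x_1 ⋯ x_i` of the Cartan–Serre map are constant except for jumps at the positions in `E` before
`p`, and vanish from `p` on. So the interior of `x` is mapped to the interior of the simplex
`csCell x` with vertices `{e ∈ E | e < p} ∪ {p}`, and in the coordinates of the two cells the map is
the Cartan–Serre map `(t_1, …, t_k) ↦ (t_1, …, t_1 ⋯ t_k)` after a projection (`cs_cubeChar`). This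
is a bijection from the open cube to the open simplex, with triangular Jacobian matrix of positive
determinant. As open simplices are disjoint (`eq_of_simplexChar_eq`), all degrees are `0` or `1`, and
`CS x = csCell x` if all elements of `E` are less than `p` (`Nondeg x`), `CS x = 0` otherwise
(`CS_single`). From here on everything is combinatorial.

*Quasi-isomorphism.* Comparing faces shows that `CS` is a chain map (`CS_comp_cubeBoundary`). Both
complexes are contractible to a vertex: the cube by projecting to the faces `x_l = 0` one after the
other (`exists_cube_contraction`), the simplex by the cone with apex `[0]` (`simplexCone_homotopy`).
Since `CS` maps vertices to vertices, it is a homotopy equivalence.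

*Coalgebra structure.* `CS` commutes with the counit, with permutations and with the coproduct
(`commutes_coprod`), but not with the product. It does satisfy `CS (x ∗ y) = CS x ∗ CS y` whenever
`x ≤ y` factor by factor, for the order `[0] ≤ [0,1] ≤ [1]` (`commutes_prod`). All terms of an
iterated Serre coproduct are increasing tuples of cells (`combCoprod_mem_supported`), a shuffle keeps
each of its blocks increasing, and every term of `x ∗ y` with `x ≤ y` is bounded by all common upper
bounds of `x` and `y`. So only products of comparable cells occur in a shuffle graph
(`commutes_shuffleGraph`), and the generated operad follows by induction on graftings.
-/

noncomputable section

namespace CartanSerre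

universe u

/-! ### The cell of the simplex that contains the image of a cell of the cube -/

section ImageCell

variable {n : ℕ}

/-- The position of the first factor `[0]` of a cell of the cube (counted from `0`), or `n` if
there is none. -/
def firstZero (x : CubeCell n) : Fin (n + 1) :=
  (insert (Fin.last n) ((Finset.univ.filter fun i => x i = Face.zero).map Fin.castSuccEmb)).min'
    (Finset.insert_nonempty _ _)

theorem firstZero_le {x : CubeCell n} {i : Fin n} (h : x i = Face.zero) :
    firstZero x ≤ i.castSucc :=
  Finset.min'_le _ _ (by simp [h])

theorem ne_zero_of_lt_firstZero {x : CubeCell n} {i : Fin n} (h : i.castSucc < firstZero x) :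
    x i ≠ Face.zero :=
  fun h' => (firstZero_le h').not_gt h

theorem apply_firstZero {x : CubeCell n} {i : Fin n} (h : i.castSucc = firstZero x) :
    x i = Face.zero := by
  have := Finset.min'_mem (insert (Fin.last n)
    ((Finset.univ.filter fun i => x i = Face.zero).map Fin.castSuccEmb))
    (Finset.insert_nonempty _ _)
  change firstZero x ∈ _ at this
  rw [← h] at this
  simpa [(Fin.castSucc_lt_last i).ne] using this

theorem firstZero_eq {x : CubeCell n} {v : Fin (n + 1)}
    (h : ∀ i : Fin n, i.castSucc < v → x i ≠ Face.zero)
    (h' : ∀ i : Fin n, i.castSucc = v → x i = Face.zero) : firstZero x = v := by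
  rcases lt_trichotomy (firstZero x) v with hlt | heq | hgt
  · have hn : firstZero x ≠ Fin.last n := (hlt.trans_le (Fin.le_last v)).ne
    obtain ⟨i, hi⟩ := Fin.exists_castSucc_eq.2 hn
    exact absurd (apply_firstZero hi) (h i (hi ▸ hlt))
  · exact heq
  · have hn : v ≠ Fin.last n := (hgt.trans_le (Fin.le_last _)).ne
    obtain ⟨i, hi⟩ := Fin.exists_castSucc_eq.2 hn
    exact absurd (h' i hi) (ne_zero_of_lt_firstZero (hi ▸ hgt))

/-- The cell of the simplex whose interior contains the image of the interior of the cell `x` of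
the cube: its vertices are the positions of the factors `[0,1]` that precede the first factor
`[0]`, and the position of this factor `[0]`. -/
def csCell (x : CubeCell n) : SimplexCell n :=
  ⟨insert (firstZero x)
    (((edges x).filter fun i => i.castSucc < firstZero x).map Fin.castSuccEmb),
    Finset.insert_nonempty _ _⟩

/-- The cell `x` is mapped to a cell of the same dimension: no factor `[0,1]` comes after a
factor `[0]`. -/
def Nondeg (x : CubeCell n) : Prop := ∀ i, x i = Face.edge → i.castSucc < firstZero x

instance (x : CubeCell n) : Decidable (Nondeg x) :=
  inferInstanceAs (Decidable (∀ i, x i = Face.edge → i.castSucc < firstZero x))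

theorem mem_csCell {x : CubeCell n} {v : Fin (n + 1)} :
    v ∈ (csCell x).1 ↔
      v = firstZero x ∨ ∃ i, x i = Face.edge ∧ i.castSucc < firstZero x ∧ i.castSucc = v := by
  simp [csCell, mem_edges, and_assoc]

theorem simplexDim_csCell (x : CubeCell n) :
    simplexDim (csCell x) = ((edges x).filter fun i => i.castSucc < firstZero x).card := by
  rw [simplexDim, csCell, Finset.card_insert_of_notMem, Finset.card_map, Nat.add_sub_cancel]
  simp only [Finset.mem_map, Finset.mem_filter, not_exists, not_and, Fin.coe_castSuccEmb]
  exact fun i hi => hi.2.ne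

theorem simplexDim_csCell_le (x : CubeCell n) : simplexDim (csCell x) ≤ cubeDim x := by
  rw [simplexDim_csCell]
  exact Finset.card_filter_le _ _

theorem nondeg_iff (x : CubeCell n) : Nondeg x ↔ simplexDim (csCell x) = cubeDim x := by
  rw [simplexDim_csCell, cubeDim, Finset.card_filter_eq_iff]
  simp [Nondeg, mem_edges]

end ImageCell

/-! ### Coordinates on the simplex -/

section Coordinates

variable {n : ℕ}

theorem lt_card_filter_le_iff {α : Type*} [LinearOrder α] {E : Finset α} {m : ℕ}
    (h : E.card = m) (k : Fin m) (a : α) :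
    (k : ℕ) < (E.filter fun b => b ≤ a).card ↔ E.orderEmbOfFin h k ≤ a := by
  have h1 : E.filter (fun b => b ≤ a) =
      (Finset.univ.filter fun j => E.orderEmbOfFin h j ≤ a).map (E.orderEmbOfFin h).toEmbedding := by
    conv_lhs => rw [← Finset.map_orderEmbOfFin_univ E h]
    rw [Finset.filter_map]
    rfl
  rw [h1, Finset.card_map]
  constructor
  · intro hk
    by_contra hka
    have : (Finset.univ.filter fun j => E.orderEmbOfFin h j ≤ a) ⊆ Finset.Iio k := by
      intro j hj
      simp only [Finset.mem_filter, Finset.mem_univ, true_and] at hj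
      rw [Finset.mem_Iio]
      exact (E.orderEmbOfFin h).lt_iff_lt.1 (hj.trans_lt (not_le.1 hka))
    have := Finset.card_le_card this
    rw [Fin.card_Iio] at this
    omega
  · intro hka
    have : Finset.Iic k ⊆ Finset.univ.filter fun j => E.orderEmbOfFin h j ≤ a := by
      intro j hj
      rw [Finset.mem_Iic] at hj
      simpa using ((E.orderEmbOfFin h).le_iff_le.2 hj).trans hka
    have := Finset.card_le_card this
    rw [Fin.card_Iic] at this
    omega

/-- The `c`-th value of the decreasing sequence `1, y_1, …, y_m, 0, 0, …`. -/
def stepValue (m : ℕ) (y : Fin m → ℝ) (c : ℕ) : ℝ :=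
  if c = 0 then 1 else if h : c - 1 < m then y ⟨c - 1, h⟩ else 0

theorem simplexChar_eq_stepValue (s : SimplexCell n) (m : ℕ) (y : Fin m → ℝ) (i : Fin n) :
    simplexChar s m y i = stepValue m y (s.1.filter fun v => v ≤ i.castSucc).card := rfl

theorem stepValue_succ_ne {m : ℕ} {y : Fin m → ℝ} (hy : y ∈ openSimplex m) {c : ℕ} (hc : c ≤ m) :
    stepValue m y c ≠ stepValue m y (c + 1) := by
  unfold stepValue
  rcases Nat.eq_zero_or_pos c with rfl | hc0
  · by_cases hm : 0 < m
    · simpa [hm] using (hy.1 ⟨0, hm⟩).2.ne'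
    · simp [hm]
  · have h1 : c - 1 < m := by omega
    rw [if_neg hc0.ne', dif_pos h1, if_neg (by omega)]
    by_cases h2 : c + 1 - 1 < m
    · rw [dif_pos h2]
      exact (hy.2 (show (⟨c - 1, h1⟩ : Fin m) < ⟨c + 1 - 1, h2⟩ by
        rw [Fin.mk_lt_mk]; omega)).ne'
    · rw [dif_neg h2]
      exact (hy.1 _).1.ne'

theorem mem_iff_stepValue_ne {s : SimplexCell n} {m : ℕ} (hs : simplexDim s = m)
    {y : Fin m → ℝ} (hy : y ∈ openSimplex m) (v : Fin (n + 1)) :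
    v ∈ s.1 ↔ stepValue m y (s.1.filter fun w => w < v).card ≠
      stepValue m y (s.1.filter fun w => w ≤ v).card := by
  by_cases hv : v ∈ s.1
  · have h1 : (s.1.filter fun w => w ≤ v) = insert v (s.1.filter fun w => w < v) := by
      ext w
      simp only [Finset.mem_filter, Finset.mem_insert, le_iff_eq_or_lt]
      constructor
      · rintro ⟨h, h' | h'⟩
        · exact Or.inl h'
        · exact Or.inr ⟨h, h'⟩
      · rintro (rfl | ⟨h, h'⟩)
        · exact ⟨hv, Or.inl rfl⟩
        · exact ⟨h, Or.inr h'⟩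
    have h2 : (s.1.filter fun w => w < v).card < s.1.card :=
      Finset.card_lt_card (Finset.filter_ssubset.2 ⟨v, hv, lt_irrefl v⟩)
    rw [simplex_card hs] at h2
    rw [h1, Finset.card_insert_of_notMem (by simp)]
    simp only [hv, true_iff]
    exact stepValue_succ_ne hy (by omega)
  · have h1 : (s.1.filter fun w => w ≤ v) = s.1.filter fun w => w < v := by
      refine Finset.filter_congr fun w hw => ?_
      have : w ≠ v := fun h => hv (h ▸ hw)
      exact ⟨fun h => lt_of_le_of_ne h this, le_of_lt⟩
    simp [hv, h1]

/-- The open simplices of the simplex are disjoint. -/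
theorem eq_of_simplexChar_eq {s t : SimplexCell n} {m k : ℕ} (hs : simplexDim s = m)
    (ht : simplexDim t = k) {y : Fin m → ℝ} (hy : y ∈ openSimplex m) {z : Fin k → ℝ}
    (hz : z ∈ openSimplex k) (h : simplexChar s m y = simplexChar t k z) : s = t := by
  have key : ∀ v : Fin (n + 1), stepValue m y (s.1.filter fun w => w ≤ v).card =
      stepValue k z (t.1.filter fun w => w ≤ v).card := by
    intro v
    induction v using Fin.lastCases with
    | last =>
      have : ∀ (r : SimplexCell n), (r.1.filter fun w => w ≤ Fin.last n) = r.1 :=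
        fun r => Finset.filter_true_of_mem fun w _ => Fin.le_last w
      rw [this, this, simplex_card hs, simplex_card ht]
      simp [stepValue]
    | cast i => exact congrFun h i
  have key' : ∀ v : Fin (n + 1), stepValue m y (s.1.filter fun w => w < v).card =
      stepValue k z (t.1.filter fun w => w < v).card := by
    intro v
    induction v using Fin.cases with
    | zero => simp [stepValue]
    | succ i => simpa only [Fin.le_castSucc_iff] using key i.castSucc
  apply Subtype.ext
  ext v
  rw [mem_iff_stepValue_ne hs hy, mem_iff_stepValue_ne ht hz, key, key']

theorem simplexCoord_simplexChar (s : SimplexCell n) {m : ℕ} (hs : simplexDim s = m)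
    (y : Fin m → ℝ) : simplexCoord s hs (simplexChar s m y) = y := by
  funext k
  set e := s.1.orderEmbOfFin (simplex_card hs) with he
  have hlt : e k.castSucc < e k.succ := e.lt_iff_lt.2 Fin.castSucc_lt_succ
  have hn : ((e k.castSucc : Fin (n + 1)) : ℕ) < n := by
    have := (e k.succ).is_lt
    rw [Fin.lt_def] at hlt
    omega
  rw [simplexCoord, dif_pos hn, simplexChar_eq_stepValue]
  have h1 := (lt_card_filter_le_iff (simplex_card hs) k.castSucc (e k.castSucc)).2 le_rfl
  have h2 := (lt_card_filter_le_iff (simplex_card hs) k.succ (e k.castSucc)).not.2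
    (not_le.2 hlt)
  have h3 : (s.1.filter fun b => b ≤ e k.castSucc).card = k + 1 := by
    simp only [Fin.val_castSucc, Fin.val_succ] at h1 h2
    omega
  have h4 : Fin.castSucc ⟨(e k.castSucc : Fin (n + 1)), hn⟩ = e k.castSucc := rfl
  rw [h4, h3]
  simp [stepValue]

end Coordinates

/-! ### The Cartan–Serre map on cells and its degrees -/

section Degree

variable {n : ℕ}

theorem cubeChar_of_edge {x : CubeCell n} {m : ℕ} (hx : cubeDim x = m) (p : Fin m → ℝ)
    (k : Fin m) : cubeChar x hx p ((edges x).orderEmbOfFin hx k) = p k := by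
  have h : (edges x).orderEmbOfFin hx k ∈ edges x := Finset.orderEmbOfFin_mem _ _ _
  rw [cubeChar, dif_pos h]
  congr 1
  rw [OrderIso.symm_apply_eq]
  rfl

/-- On each cell of the cube, the Cartan–Serre map is a coordinate projection followed by the
Cartan–Serre map in lower dimension and the characteristic map of a cell of the simplex. -/
theorem cs_cubeChar (x : CubeCell n) {m k : ℕ} (hx : cubeDim x = m)
    (hk : simplexDim (csCell x) = k) (hkm : k ≤ m) (p : Fin m → ℝ) :
    cs (cubeChar x hx p) = simplexChar (csCell x) k (cs fun j => p (Fin.castLE hkm j)) := by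
  funext i
  rw [simplexChar_eq_stepValue]
  rcases lt_or_ge i.castSucc (firstZero x) with hi | hi
  · have hcard : ((csCell x).1.filter fun v => v ≤ i.castSucc).card =
        ((edges x).filter fun j => j ≤ i).card := by
      rw [← Finset.card_map (s := (edges x).filter fun j => j ≤ i) Fin.castSuccEmb]
      congr 1
      ext v
      simp only [Finset.mem_filter, mem_csCell, Finset.mem_map, mem_edges, Fin.coe_castSuccEmb]
      constructor
      · rintro ⟨rfl | ⟨j, hj, _, rfl⟩, h⟩
        · exact absurd h (not_le.2 hi)
        · exact ⟨j, ⟨hj, h⟩, rfl⟩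
      · rintro ⟨j, ⟨hj, h⟩, rfl⟩
        exact ⟨Or.inr ⟨j, hj, lt_of_le_of_lt h hi, rfl⟩, h⟩
    have hle : ((edges x).filter fun j => j ≤ i).card ≤ k := by
      rw [← hk, simplexDim_csCell]
      refine Finset.card_le_card fun j hj => ?_
      simp only [Finset.mem_filter] at hj ⊢
      exact ⟨hj.1, lt_of_le_of_lt hj.2 hi⟩
    have hprod : cs (cubeChar x hx p) i =
        ∏ j ∈ Finset.univ.filter fun j : Fin m =>
          (j : ℕ) < ((edges x).filter fun j => j ≤ i).card, p j := by
      have h1 : cs (cubeChar x hx p) i =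
          ∏ j ∈ (edges x).filter fun j => j ≤ i, cubeChar x hx p j := by
        rw [cs]
        symm
        refine Finset.prod_subset (fun j hj => ?_) fun j hj hj' => ?_
        · simpa using (Finset.mem_filter.1 hj).2
        · have hji := Finset.mem_Iic.1 hj
          have he : j ∉ edges x := fun h => hj' (Finset.mem_filter.2 ⟨h, hji⟩)
          have h0 : x j ≠ Face.zero := ne_zero_of_lt_firstZero (lt_of_le_of_lt hji hi)
          rw [mem_edges] at he
          rw [cubeChar, dif_neg (by rwa [mem_edges]), if_pos]
          cases hxj : x j <;> simp_all
      rw [h1]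
      have h2 : (edges x).filter (fun j => j ≤ i) =
          (Finset.univ.filter fun j => (edges x).orderEmbOfFin hx j ≤ i).map
            ((edges x).orderEmbOfFin hx).toEmbedding := by
        conv_lhs => rw [← Finset.map_orderEmbOfFin_univ (edges x) hx]
        rw [Finset.filter_map]
        rfl
      have h3 : (Finset.univ.filter fun j : Fin m =>
          (j : ℕ) < ((edges x).filter fun j => j ≤ i).card) =
          Finset.univ.filter fun j => (edges x).orderEmbOfFin hx j ≤ i :=
        Finset.filter_congr fun j _ => lt_card_filter_le_iff hx j i
      rw [h3, h2, Finset.prod_map]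
      exact Finset.prod_congr rfl fun j _ => cubeChar_of_edge hx p j
    rw [hcard, hprod]
    generalize ((edges x).filter fun j => j ≤ i).card = c at hle
    rcases Nat.eq_zero_or_pos c with rfl | hc
    · simp [stepValue]
    · have hc' : c - 1 < k := by omega
      rw [stepValue, if_neg hc.ne', dif_pos hc', cs]
      symm
      refine Finset.prod_bij (fun j _ => Fin.castLE hkm j) ?_ ?_ ?_ ?_
      · intro j hj
        rw [Finset.mem_Iic, Fin.le_def] at hj
        simp only [Finset.mem_filter, Finset.mem_univ, true_and, Fin.val_castLE]
        simp only at hj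
        omega
      · intro a _ b _ h
        exact Fin.castLE_injective hkm h
      · intro j hj
        simp only [Finset.mem_filter, Finset.mem_univ, true_and] at hj
        refine ⟨⟨j, by omega⟩, ?_, rfl⟩
        rw [Finset.mem_Iic, Fin.le_def]
        simp only
        omega
      · intro j _; rfl
  · have hcard : ((csCell x).1.filter fun v => v ≤ i.castSucc) = (csCell x).1 := by
      refine Finset.filter_true_of_mem fun v hv => ?_
      rcases mem_csCell.1 hv with rfl | ⟨j, _, hj, rfl⟩
      · exact hi
      · exact hj.le.trans hi
    rw [hcard, simplex_card hk]
    have : firstZero x ≠ Fin.last n := (hi.trans_lt (Fin.castSucc_lt_last i)).ne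
    obtain ⟨j, hj⟩ := Fin.exists_castSucc_eq.2 this
    have h0 := apply_firstZero hj
    rw [cs, Finset.prod_eq_zero (i := j)]
    · simp [stepValue]
    · rw [Finset.mem_Iic]
      rwa [← hj] at hi
    · rw [cubeChar, dif_neg (by simp [mem_edges, h0]), if_neg (by simp [h0])]

theorem cs_succ {m : ℕ} (p : Fin m → ℝ) (k : ℕ) (hk : k + 1 < m) :
    cs p ⟨k + 1, hk⟩ = cs p ⟨k, by omega⟩ * p ⟨k + 1, hk⟩ := by
  have : Finset.Iic (⟨k + 1, hk⟩ : Fin m) =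
      insert ⟨k + 1, hk⟩ (Finset.Iic (⟨k, by omega⟩ : Fin m)) := by
    ext j
    simp only [Finset.mem_Iic, Finset.mem_insert, Fin.le_def, Fin.ext_iff]
    omega
  rw [cs, this, Finset.prod_insert (by simp [Fin.le_def]), mul_comm]
  rfl

theorem cs_zero {m : ℕ} (p : Fin m → ℝ) (hm : 0 < m) : cs p ⟨0, hm⟩ = p ⟨0, hm⟩ := by
  have : Finset.Iic (⟨0, hm⟩ : Fin m) = {⟨0, hm⟩} := by
    ext j
    simp only [Finset.mem_Iic, Finset.mem_singleton, Fin.le_def, Fin.ext_iff]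
    omega
  rw [cs, this, Finset.prod_singleton]

theorem prod_lt_one_of_pos {ι : Type*} {s : Finset ι} {f : ι → ℝ} (h0 : ∀ i ∈ s, 0 < f i)
    (h1 : ∀ i ∈ s, f i < 1) (hs : s.Nonempty) : ∏ i ∈ s, f i < 1 := by
  simpa using Finset.prod_lt_prod_of_nonempty h0 h1 hs

theorem cs_mem_openSimplex {m : ℕ} {p : Fin m → ℝ} (hp : p ∈ openCube m) :
    cs p ∈ openSimplex m := by
  have hpos : ∀ k, 0 < cs p k := fun k => Finset.prod_pos fun j _ => (hp j).1
  refine ⟨fun k => ⟨hpos k, ?_⟩, fun i j hij => ?_⟩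
  · exact prod_lt_one_of_pos (fun j _ => (hp j).1) (fun j _ => (hp j).2)
      ⟨k, Finset.mem_Iic.2 le_rfl⟩
  · have h1 : Finset.Iic i ⊆ Finset.Iic j := Finset.Iic_subset_Iic.2 hij.le
    rw [cs, cs, ← Finset.prod_sdiff h1]
    refine mul_lt_of_lt_one_left (hpos i) ?_
    refine prod_lt_one_of_pos (fun j _ => (hp j).1) (fun j _ => (hp j).2) ⟨j, ?_⟩
    simpa using hij

theorem cs_mem_closedSimplex {m : ℕ} {p : Fin m → ℝ} (hp : p ∈ closedCube m) :
    cs p ∈ closedSimplex m := by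
  have hpos : ∀ k, 0 ≤ cs p k := fun k => Finset.prod_nonneg fun j _ => (hp j).1
  refine ⟨fun k => ⟨hpos k, ?_⟩, fun i j hij => ?_⟩
  · exact Finset.prod_le_one (fun j _ => (hp j).1) fun j _ => (hp j).2
  · have h1 : Finset.Iic i ⊆ Finset.Iic j := Finset.Iic_subset_Iic.2 hij
    rw [cs, cs, ← Finset.prod_sdiff h1]
    exact mul_le_of_le_one_left (hpos i)
      (Finset.prod_le_one (fun j _ => (hp j).1) fun j _ => (hp j).2)

theorem isCellular_cs : IsCellular (cs (n := n)) := by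
  intro x p hp
  refine ⟨csCell x, simplexDim_csCell_le x, _, ?_,
    cs_cubeChar x rfl rfl (simplexDim_csCell_le x) p⟩
  exact cs_mem_closedSimplex fun j => hp _

/-- The Cartan–Serre map is a bijection of the open cube onto the open simplex. -/
theorem existsUnique_cs_eq {m : ℕ} {q : Fin m → ℝ} (hq : q ∈ openSimplex m) :
    ∃ p ∈ openCube m, cs p = q ∧ ∀ p' ∈ openCube m, cs p' = q → p' = p := by
  set p : Fin m → ℝ := fun k => if h : (k : ℕ) = 0 then q k else q k / q ⟨k - 1, by omega⟩ with hp
  have hpos := fun k => (hq.1 k).1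
  have hsucc : ∀ (k : ℕ) (hk : k + 1 < m), p ⟨k + 1, hk⟩ = q ⟨k + 1, hk⟩ / q ⟨k, by omega⟩ :=
    fun k hk => by simp [hp]
  have hcs : ∀ (k : ℕ) (hk : k < m), cs p ⟨k, hk⟩ = q ⟨k, hk⟩ := by
    intro k
    induction k with
    | zero => intro hk; rw [cs_zero]; simp [hp]
    | succ k ih =>
      intro hk
      rw [cs_succ, ih (by omega), hsucc, mul_div_cancel₀ _ (hpos _).ne']
  refine ⟨p, ?_, funext fun k => hcs k k.2, ?_⟩
  · rintro ⟨k, hk⟩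
    cases k with
    | zero => simpa [hp] using hq.1 ⟨0, hk⟩
    | succ k =>
      rw [hsucc]
      refine ⟨div_pos (hpos _) (hpos _), (div_lt_one (hpos _)).2 (hq.2 ?_)⟩
      rw [Fin.mk_lt_mk]
      omega
  · intro p' _ h
    funext ⟨k, hk⟩
    cases k with
    | zero =>
      rw [← cs_zero p', h]
      simp [hp]
    | succ k =>
      have := cs_succ p' k hk
      rw [h] at this
      rw [hsucc, this, mul_div_cancel_left₀ _ (hpos _).ne']

theorem det_fderiv_cs_pos {m : ℕ} {p : Fin m → ℝ} (hp : p ∈ openCube m) :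
    0 < (fderiv ℝ (cs (n := m)) p).det := by
  have hd : ∀ i : Fin m, HasFDerivAt (fun p : Fin m → ℝ => cs p i)
      (∑ j ∈ Finset.Iic i, (∏ l ∈ (Finset.Iic i).erase j, p l) •
        (ContinuousLinearMap.proj j : (Fin m → ℝ) →L[ℝ] ℝ)) p := fun i =>
    HasFDerivAt.finsetProd (u := Finset.Iic i) (g := fun j (p : Fin m → ℝ) => p j)
      fun j _ => (ContinuousLinearMap.proj j : (Fin m → ℝ) →L[ℝ] ℝ).hasFDerivAt
  have hcs := (hasFDerivAt_pi.2 hd).fderiv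
  rw [show (fun p : Fin m → ℝ => fun i => cs p i) = cs (n := m) from rfl] at hcs
  rw [hcs, ContinuousLinearMap.det, ← LinearMap.det_toMatrix', Matrix.det_of_isLowerTriangular]
  · refine Finset.prod_pos fun i _ => ?_
    have : ∀ c : Fin m → ℝ, ∑ j ∈ Finset.Iic i, c j * (Pi.single i 1 : Fin m → ℝ) j = c i := by
      intro c
      rw [Finset.sum_eq_single i] <;> simp +contextual
    simp only [LinearMap.toMatrix'_apply, ContinuousLinearMap.coe_coe,
      ContinuousLinearMap.coe_pi', FunLike.coe_sum, Finset.sum_apply,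
      FunLike.coe_smul, Pi.smul_apply, ContinuousLinearMap.proj_apply, smul_eq_mul]
    rw [this]
    exact Finset.prod_pos fun j _ => (hp j).1
  · intro i j (hij : i < j)
    simp only [LinearMap.toMatrix'_apply, ContinuousLinearMap.coe_coe,
      ContinuousLinearMap.coe_pi', FunLike.coe_sum, Finset.sum_apply,
      FunLike.coe_smul, Pi.smul_apply, ContinuousLinearMap.proj_apply, smul_eq_mul]
    refine Finset.sum_eq_zero fun l hl => ?_
    have : l ≠ j := ((Finset.mem_Iic.1 hl).trans_lt hij).ne
    simp [this]

theorem hasDegree_cs (x : CubeCell n) (s : SimplexCell n) {m : ℕ} (hx : cubeDim x = m)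
    (hs : simplexDim s = m) : HasDegree cs x s hx hs (if s = csCell x then 1 else 0) := by
  intro q hq
  by_cases h : s = csCell x
  · subst h
    have hcs : ∀ p, cs (cubeChar x hx p) = simplexChar (csCell x) m (cs p) :=
      fun p => cs_cubeChar x hx hs le_rfl p
    obtain ⟨p, hp, hpq, hu⟩ := existsUnique_cs_eq hq
    have hpre : preimages cs x (csCell x) hx q = {p} := by
      ext p'
      simp only [preimages, Set.mem_ofPred_eq, Set.mem_singleton_iff, hcs]
      constructor
      · rintro ⟨h1, h2⟩
        refine hu p' h1 ?_
        rw [← simplexCoord_simplexChar (csCell x) hs (cs p'), h2, simplexCoord_simplexChar]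
      · rintro rfl
        exact ⟨hp, by rw [hpq]⟩
    have hj : 0 < jacobian cs x (csCell x) hx hs p := by
      have h1 : (fun p => simplexCoord (csCell x) hs (cs (cubeChar x hx p))) = cs (n := m) := by
        funext p
        rw [hcs, simplexCoord_simplexChar]
      rw [jacobian, h1]
      exact det_fderiv_cs_pos hp
    refine ⟨by rw [hpre]; exact Set.finite_singleton p, ?_, ?_⟩
    · rw [hpre]
      rintro p' rfl
      exact hj.ne'
    · rw [localDegree, hpre, finsum_mem_singleton, sign_pos hj, if_pos rfl]
      rfl
  · have hpre : preimages cs x s hx q = ∅ := by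
      rw [Set.eq_empty_iff_forall_notMem]
      rintro p ⟨hp, hpq⟩
      have hle : simplexDim (csCell x) ≤ m := hx ▸ simplexDim_csCell_le x
      rw [cs_cubeChar x hx rfl hle] at hpq
      refine h (eq_of_simplexChar_eq rfl hs ?_ hq hpq).symm
      exact cs_mem_openSimplex fun j => hp _
    rw [localDegree, hpre]
    simp [h]

theorem barycenter_mem_openSimplex (m : ℕ) : barycenter m ∈ openSimplex m := by
  have hm : (0 : ℝ) < m + 1 := by positivity
  refine ⟨fun k => ⟨div_pos ?_ hm, (div_lt_one hm).2 ?_⟩, fun i j hij => ?_⟩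
  · have : ((k : ℕ) : ℝ) < m := by exact_mod_cast k.2
    linarith
  · have : (0 : ℝ) ≤ (k : ℕ) := by positivity
    linarith
  · have : ((i : ℕ) : ℝ) < (j : ℕ) := by exact_mod_cast hij
    exact div_lt_div_of_pos_right (by linarith) hm

theorem cellDegree_cs (x : CubeCell n) (s : SimplexCell n) (h : simplexDim s = cubeDim x) :
    cellDegree cs x s h = if s = csCell x then 1 else 0 :=
  (hasDegree_cs x s rfl h _ (barycenter_mem_openSimplex _)).2.2

theorem CS_single (R : Type u) [CommRing R] (x : CubeCell n) :
    CS R n (Finsupp.single x 1) = if Nondeg x then Finsupp.single (csCell x) 1 else 0 := by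
  simp only [CS, inducedMap, Finsupp.linearCombination_single, one_smul]
  rw [Finset.sum_eq_single (csCell x)]
  · simp only [nondeg_iff, cellDegree_cs, if_true, Int.cast_one, dite_eq_ite]
  · intro s _ hs
    split_ifs with h
    · simp [cellDegree_cs, hs]
    · rfl
  · simp

end Degree

/-! ### Supports of operations on tensors of basis elements -/

section Supports

variable {R : Type u} [CommRing R]

theorem map_mem_supported {B B' : Type} {f : (B →₀ R) →ₗ[R] (B' →₀ R)} {s : Set B} {t : Set B'}
    (h : ∀ b ∈ s, f (Finsupp.single b 1) ∈ Finsupp.supported R R t) {a : B →₀ R}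
    (ha : a ∈ Finsupp.supported R R s) : f a ∈ Finsupp.supported R R t := by
  rw [Finsupp.supported_eq_span_single] at ha
  induction ha using Submodule.span_induction with
  | mem x hx => obtain ⟨y, hy, rfl⟩ := hx; exact h y hy
  | zero => simp
  | add x y _ _ hx hy => simpa using Submodule.add_mem _ hx hy
  | smul c x _ hx => simpa using Submodule.smul_mem _ c hx

theorem append_mem_supported {B : Type} {m p : ℕ} {S : Set (Fin m → B)} {T : Set (Fin p → B)}
    {a : Tens R B m} {b : Tens R B p} (ha : a ∈ Finsupp.supported R R S)
    (hb : b ∈ Finsupp.supported R R T) :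
    append a b ∈ Finsupp.supported R R (Set.image2 Fin.append S T) := by
  refine map_mem_supported (f := append.flip b) (fun x hx => ?_) ha
  refine map_mem_supported (f := append (Finsupp.single x 1)) (fun y hy => ?_) hb
  rw [append_single]
  exact Finsupp.single_mem_supported _ _ (Set.mem_image2_of_mem hx hy)

theorem MBialgebra.eval_juxt_mem_supported {B : Type} (A : MBialgebra R B) {m n p q : ℕ}
    {f : Graph m n} {g : Graph p q} {x : Fin m → B} {y : Fin p → B} {S : Set (Fin n → B)}
    {T : Set (Fin q → B)} (hf : A.eval f (Finsupp.single x 1) ∈ Finsupp.supported R R S)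
    (hg : A.eval g (Finsupp.single y 1) ∈ Finsupp.supported R R T) :
    A.eval (f.juxt g) (Finsupp.single (Fin.append x y) 1) ∈
      Finsupp.supported R R (Set.image2 Fin.append S T) := by
  rw [MBialgebra.eval, tensorHom_single]
  exact Submodule.smul_mem _ _ (append_mem_supported hf hg)

theorem MBialgebra.eval_comp_mem_supported {B : Type} (A : MBialgebra R B) {m n p : ℕ}
    {g : Graph n p} {f : Graph m n} {x : Fin m → B} {S : Set (Fin n → B)} {T : Set (Fin p → B)}
    (hf : A.eval f (Finsupp.single x 1) ∈ Finsupp.supported R R S)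
    (hg : ∀ y ∈ S, A.eval g (Finsupp.single y 1) ∈ Finsupp.supported R R T) :
    A.eval (g.comp f) (Finsupp.single x 1) ∈ Finsupp.supported R R T :=
  map_mem_supported hg hf

theorem MBialgebra.eval_id_mem_supported {B : Type} (A : MBialgebra R B) {m : ℕ}
    (x : Fin m → B) :
    A.eval (Graph.id m) (Finsupp.single x 1) ∈ Finsupp.supported R R {x} := by
  rw [MBialgebra.eval_id]
  exact Finsupp.single_mem_supported _ _ rfl

theorem vec_one_eq {B : Type} (x : Fin 1 → B) : x = ![x 0] := by
  funext i
  fin_cases i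
  rfl

theorem vec_two_eq {B : Type} (x : Fin 2 → B) : x = ![x 0, x 1] := by
  funext i
  fin_cases i <;> rfl

end Supports

/-! ### Operations that commute with the Cartan–Serre map -/

section Commutation

variable (R : Type u) [CommRing R] {n : ℕ}

theorem tensorPower_CS_single {r : ℕ} (x : Fin r → CubeCell n) :
    tensorPower (CS R n) r (Finsupp.single x 1) =
      if ∀ i, Nondeg (x i) then Finsupp.single (fun i => csCell (x i)) 1 else 0 := by
  simp only [tensorPower, Finsupp.linearCombination_single, one_smul]
  ext y
  rw [Finsupp.equivFunOnFinite_symm_apply_apply]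
  simp only [CS_single]
  by_cases h : ∀ i, Nondeg (x i)
  · rw [if_pos h]
    simp only [h, if_true]
    by_cases hy : (fun i => csCell (x i)) = y
    · subst hy
      simp
    · rw [Finsupp.single_eq_of_ne' hy]
      obtain ⟨i, hi⟩ := Function.ne_iff.1 hy
      exact Finset.prod_eq_zero (Finset.mem_univ i) (Finsupp.single_eq_of_ne' hi)
  · rw [if_neg h]
    obtain ⟨i, hi⟩ := not_forall.1 h
    exact Finset.prod_eq_zero (Finset.mem_univ i) (by rw [if_neg hi]; rfl)

theorem tensorPower_CS_single_one (x : CubeCell n) :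
    tensorPower (CS R n) 1 (Finsupp.single ![x] 1) =
      if Nondeg x then Finsupp.single ![csCell x] 1 else 0 := by
  rw [tensorPower_CS_single, vec_one_eq fun i => csCell _]
  simp only [Matrix.cons_val_fin_one, forall_const]

theorem tensorPower_CS_single_two (x y : CubeCell n) :
    tensorPower (CS R n) 2 (Finsupp.single ![x, y] 1) =
      if Nondeg x ∧ Nondeg y then Finsupp.single ![csCell x, csCell y] 1 else 0 := by
  rw [tensorPower_CS_single, vec_two_eq fun i => csCell _]
  simp only [Fin.forall_fin_two, Matrix.cons_val_zero, Matrix.cons_val_one]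

theorem tensorPower_CS_append {m p : ℕ} (a : Tens R (CubeCell n) m) (b : Tens R (CubeCell n) p) :
    tensorPower (CS R n) (m + p) (append a b) =
      append (tensorPower (CS R n) m a) (tensorPower (CS R n) p b) := by
  have h : append.compr₂ (tensorPower (CS R n) (m + p)) =
      append.compl₁₂ (tensorPower (CS R n) m) (tensorPower (CS R n) p) := by
    refine tens_ext fun x => tens_ext fun y => ?_
    simp only [LinearMap.compr₂_apply, LinearMap.compl₁₂_apply, append_single, mul_one,
      tensorPower_CS_single, Fin.forall_fin_add, Fin.append_left, Fin.append_right]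
    by_cases h1 : ∀ i, Nondeg (x i) <;> by_cases h2 : ∀ i, Nondeg (y i)
    · rw [if_pos ⟨h1, h2⟩, if_pos h1, if_pos h2, append_single, mul_one]
      congr 1
      funext i
      refine Fin.addCases (fun i => ?_) (fun i => ?_) i <;> simp
    · rw [if_neg fun h => h2 h.2, if_neg h2, map_zero]
    · rw [if_neg fun h => h1 h.1, if_neg h1, map_zero, LinearMap.zero_apply]
    · rw [if_neg fun h => h2 h.2, if_neg h2, map_zero]
  exact LinearMap.congr_fun₂ h a b

theorem tensorPower_CS_mem {r : ℕ} (x : Fin r → CubeCell n) :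
    tensorPower (CS R n) r (Finsupp.single x 1) ∈ Finsupp.supported R R
      {y : Fin r → SimplexCell n | tdeg simplexDim y = tdeg cubeDim x} := by
  rw [tensorPower_CS_single]
  split_ifs with h
  · refine Finsupp.single_mem_supported _ _ ?_
    exact Finset.sum_congr rfl fun i _ => (nondeg_iff _).1 (h i)
  · exact Submodule.zero_mem _

/-- The Cartan–Serre map commutes with the operation `Γ` on the tensor `x` of cells. -/
def Commutes {m r : ℕ} (Γ : Graph m r) (x : Fin m → CubeCell n) : Prop :=
  tensorPower (CS R n) r ((cubeBialgebra R n).eval Γ (Finsupp.single x 1)) =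
    (simplexBialgebra R n).eval Γ (tensorPower (CS R n) m (Finsupp.single x 1))

variable {R}

theorem commutes_comp {m r s : ℕ} {Γ : Graph r s} {Λ : Graph m r} {x : Fin m → CubeCell n}
    {S : Set (Fin r → CubeCell n)} (hΛ : Commutes R Λ x)
    (hS : (cubeBialgebra R n).eval Λ (Finsupp.single x 1) ∈ Finsupp.supported R R S)
    (hΓ : ∀ y : Fin r → CubeCell n, y ∈ S → Commutes R Γ y) : Commutes R (Γ.comp Λ) x := by
  rw [Commutes, MBialgebra.eval, MBialgebra.eval, LinearMap.comp_apply, LinearMap.comp_apply, ← hΛ]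
  exact supported_induction
    (P := fun a => tensorPower (CS R n) s ((cubeBialgebra R n).eval Γ a) =
      (simplexBialgebra R n).eval Γ (tensorPower (CS R n) r a))
    (by simp) hΓ (fun a b ha hb => by simp [ha, hb]) (fun c a ha => by simp [ha]) hS

theorem commutes_comp_of_forall {m r s : ℕ} {Γ : Graph r s} {Λ : Graph m r}
    {x : Fin m → CubeCell n} (hΛ : Commutes R Λ x)
    (hΓ : ∀ y : Fin r → CubeCell n, Commutes R Γ y) : Commutes R (Γ.comp Λ) x :=
  commutes_comp (S := Set.univ) hΛ (by simp) fun y _ => hΓ y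

theorem commutes_juxt {m p q r : ℕ} {Γ : Graph m r} {Λ : Graph p q} {x : Fin m → CubeCell n}
    {y : Fin p → CubeCell n} (hΓ : Commutes R Γ x) (hΛ : Commutes R Λ y) :
    Commutes R (Γ.juxt Λ) (Fin.append x y) := by
  have h1 : (Finsupp.single (Fin.append x y) 1 : Tens R (CubeCell n) (m + p)) =
      append (Finsupp.single x 1) (Finsupp.single y 1) := by rw [append_single, mul_one]
  rw [Commutes, MBialgebra.eval, MBialgebra.eval, tensorHom_single, map_smul,
    tensorPower_CS_append, hΓ, hΛ, h1, tensorPower_CS_append]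
  exact (tensorHom_append _ _ _ _ _ (tensorPower_CS_mem R x) _).symm

theorem commutes_perm {m r : ℕ} (e : Fin m ≃ Fin r) (x : Fin m → CubeCell n) :
    Commutes R (Graph.perm e) x := by
  rw [Commutes, MBialgebra.eval, MBialgebra.eval, permHom_single, tensorPower_CS_single,
    ← mul_one (koszulSign R _ e x), ← smul_eq_mul, ← Finsupp.smul_single, map_smul,
    tensorPower_CS_single]
  by_cases h : ∀ i, Nondeg (x i)
  · rw [if_pos h, if_pos (show ∀ i, Nondeg ((x ∘ e.symm) i) from fun i => h _),
      permHom_single, Finsupp.smul_single, smul_eq_mul, mul_one]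
    congr 1
    simp only [koszulSign]
    refine Finset.prod_congr rfl fun i _ => Finset.prod_congr rfl fun j _ => ?_
    have : ∀ i, (simplexBialgebra R n).deg (csCell (x i)) = (cubeBialgebra R n).deg (x i) :=
      fun i => (nondeg_iff _).1 (h i)
    rw [this, this]
  · rw [if_neg h, if_neg (show ¬ ∀ i, Nondeg ((x ∘ e.symm) i) from
      fun h' => h fun i => by simpa using h' (e i))]
    simp

theorem commutes_id {m : ℕ} (x : Fin m → CubeCell n) : Commutes R (Graph.id m) x :=
  commutes_perm _ x

theorem commutes_counit (x : Fin 1 → CubeCell n) : Commutes R Graph.counit x := by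
  rw [vec_one_eq x, Commutes, tensorPower_CS_single_one]
  change tensorPower (CS R n) 0 (cubeCounit R n _) = simplexCounit R n _
  rw [cubeCounit_single]
  by_cases h : Nondeg (x 0)
  · rw [if_pos h, simplexCounit_single, (nondeg_iff _).1 h]
    split_ifs
    · rw [tensorPower_CS_single, if_pos fun i => i.elim0]
      congr 1
      exact Subsingleton.elim _ _
    · simp
  · rw [if_neg h, if_neg, map_zero, map_zero]
    intro h0
    refine h ((nondeg_iff _).2 ?_)
    have := simplexDim_csCell_le (x 0)
    omega

end Commutation

/-! ### The coproduct -/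

section Coproduct

variable {R : Type u} [CommRing R] {n : ℕ}

theorem not_nondeg {x : CubeCell n} {i j : Fin n} (hij : j < i) (hi : x i = Face.edge)
    (hj : x j = Face.zero) : ¬ Nondeg x := fun h =>
  ((h i hi).trans_le (firstZero_le hj)).not_gt hij

theorem exists_zero_of_not_nondeg {x : CubeCell n} (h : ¬ Nondeg x) :
    ∃ i j, j < i ∧ x i = Face.edge ∧ x j = Face.zero := by
  simp only [Nondeg, not_forall, not_lt] at h
  obtain ⟨i, hi, hle⟩ := h
  obtain ⟨j, hj⟩ := Fin.exists_castSucc_eq.2 (hle.trans_lt (Fin.castSucc_lt_last i)).ne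
  have h0 := apply_firstZero hj
  refine ⟨i, j, lt_of_le_of_ne ?_ ?_, hi, h0⟩
  · rwa [← hj] at hle
  · rintro rfl
    rw [hi] at h0
    cases h0

theorem mem_csCell_of_edge {x : CubeCell n} (h : Nondeg x) {i : Fin n} (hi : x i = Face.edge) :
    i.castSucc ∈ (csCell x).1 :=
  mem_csCell.2 (Or.inr ⟨i, hi, h i hi, rfl⟩)

theorem firstZero_mem_csCell (x : CubeCell n) : firstZero x ∈ (csCell x).1 :=
  mem_csCell.2 (Or.inl rfl)

theorem le_firstZero_of_mem {x : CubeCell n} {v : Fin (n + 1)} (h : v ∈ (csCell x).1) :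
    v ≤ firstZero x := by
  rcases mem_csCell.1 h with rfl | ⟨i, _, hi, rfl⟩
  · exact le_rfl
  · exact hi.le

theorem serreLeft_eq_edge {x : CubeCell n} {S : Finset (Fin n)} {i : Fin n} :
    serreLeft x S i = Face.edge ↔ x i = Face.edge ∧ i ∈ S := by
  unfold serreLeft
  split_ifs <;> simp_all

theorem serreLeft_eq_zero {x : CubeCell n} {S : Finset (Fin n)} {i : Fin n} :
    serreLeft x S i = Face.zero ↔ x i = Face.zero ∨ x i = Face.edge ∧ i ∉ S := by
  unfold serreLeft
  split_ifs <;> simp_all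

theorem serreRight_eq_edge {x : CubeCell n} {S : Finset (Fin n)} {i : Fin n} :
    serreRight x S i = Face.edge ↔ x i = Face.edge ∧ i ∉ S := by
  unfold serreRight
  split_ifs <;> simp_all

theorem serreRight_eq_zero {x : CubeCell n} {S : Finset (Fin n)} {i : Fin n} :
    serreRight x S i = Face.zero ↔ x i = Face.zero := by
  unfold serreRight
  split_ifs <;> simp_all

/-- The factors `[0,1]` of `x` that are kept on the left in the term of the Serre coproduct
corresponding to the vertex `v` in the Alexander–Whitney coproduct. -/
def edgesBefore (x : CubeCell n) (v : Fin (n + 1)) : Finset (Fin n) :=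
  (edges x).filter fun i => i.castSucc < v

theorem mem_edgesBefore {x : CubeCell n} {v : Fin (n + 1)} {i : Fin n} :
    i ∈ edgesBefore x v ↔ x i = Face.edge ∧ i.castSucc < v := by
  simp [edgesBefore, mem_edges]

theorem firstZero_serreLeft {x : CubeCell n} {v : Fin (n + 1)} (hv : v ∈ (csCell x).1) :
    firstZero (serreLeft x (edgesBefore x v)) = v := by
  refine firstZero_eq (fun i hi h => ?_) fun i hi => ?_
  · rw [serreLeft_eq_zero, mem_edgesBefore] at h
    rcases h with h | ⟨h, h'⟩
    · exact ne_zero_of_lt_firstZero (hi.trans_le (le_firstZero_of_mem hv)) h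
    · exact h' ⟨h, hi⟩
  · rw [serreLeft_eq_zero, mem_edgesBefore]
    rcases mem_csCell.1 hv with h | ⟨j, hj, _, h⟩
    · exact Or.inl (apply_firstZero (hi.trans h))
    · rw [← hi] at h
      obtain rfl := Fin.castSucc_injective _ h
      exact Or.inr ⟨hj, fun h' => h'.2.ne hi⟩

theorem firstZero_serreRight (x : CubeCell n) (S : Finset (Fin n)) :
    firstZero (serreRight x S) = firstZero x :=
  firstZero_eq (fun _ hi h => ne_zero_of_lt_firstZero hi (serreRight_eq_zero.1 h))
    fun _ hi => serreRight_eq_zero.2 (apply_firstZero hi)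

theorem csCell_serreLeft {x : CubeCell n} {v : Fin (n + 1)} (hv : v ∈ (csCell x).1) :
    csCell (serreLeft x (edgesBefore x v)) = frontFace (csCell x) v hv := by
  apply Subtype.ext
  ext w
  rw [mem_csCell, firstZero_serreLeft hv]
  simp only [frontFace, Finset.mem_filter, mem_csCell, serreLeft_eq_edge, mem_edgesBefore]
  have hle := le_firstZero_of_mem hv
  constructor
  · rintro (rfl | ⟨i, ⟨h1, _⟩, h3, rfl⟩)
    · exact ⟨mem_csCell.1 hv, le_rfl⟩
    · exact ⟨Or.inr ⟨i, h1, h3.trans_le hle, rfl⟩, h3.le⟩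
  · rintro ⟨h | ⟨i, h1, _, rfl⟩, hw⟩
    · exact Or.inl (le_antisymm hw (h ▸ hle))
    · rcases hw.eq_or_lt with h | h
      · exact Or.inl h
      · exact Or.inr ⟨i, ⟨h1, h1, h⟩, h, rfl⟩

theorem csCell_serreRight {x : CubeCell n} {v : Fin (n + 1)} (hv : v ∈ (csCell x).1) :
    csCell (serreRight x (edgesBefore x v)) = backFace (csCell x) v hv := by
  apply Subtype.ext
  ext w
  rw [mem_csCell, firstZero_serreRight]
  simp only [backFace, Finset.mem_filter, mem_csCell, serreRight_eq_edge, mem_edgesBefore]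
  have hle := le_firstZero_of_mem hv
  constructor
  · rintro (rfl | ⟨i, ⟨h1, h2⟩, h3, rfl⟩)
    · exact ⟨Or.inl rfl, hle⟩
    · exact ⟨Or.inr ⟨i, h1, h3, rfl⟩, not_lt.1 fun h => h2 ⟨h1, h⟩⟩
  · rintro ⟨h | ⟨i, h1, h3, rfl⟩, hw⟩
    · exact Or.inl h
    · exact Or.inr ⟨i, ⟨h1, fun h => h.2.not_ge hw⟩, h3, rfl⟩

theorem simplexCoprod_single (s : SimplexCell n) :
    simplexCoprod R n (Finsupp.single ![s] 1) =
      ∑ v ∈ s.1.attach, Finsupp.single ![frontFace s v.1 v.2, backFace s v.1 v.2] 1 := by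
  rw [simplexCoprod, Finsupp.linearCombination_single, one_smul]
  rfl

theorem commutes_coprod (x : Fin 1 → CubeCell n) : Commutes R Graph.coprod x := by
  rw [vec_one_eq x, Commutes, tensorPower_CS_single_one]
  change tensorPower (CS R n) 2 (cubeCoprod R n _) = simplexCoprod R n _
  generalize x 0 = x
  have key : ∀ (a b : CubeCell n) (c : R),
      tensorPower (CS R n) 2 (Finsupp.single ![a, b] c) =
        if Nondeg a ∧ Nondeg b then Finsupp.single ![csCell a, csCell b] c else 0 := by
    intro a b c
    have : Finsupp.single ![a, b] c = c • Finsupp.single ![a, b] (1 : R) := by simp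
    rw [this, map_smul, tensorPower_CS_single_two]
    split_ifs <;> simp
  simp only [cubeCoprod, Finsupp.linearCombination_single, one_smul, map_sum, key,
    Matrix.cons_val_fin_one]
  by_cases h : Nondeg x
  · rw [if_pos h, simplexCoprod_single]
    symm
    refine Finset.sum_of_injOn (fun v => edgesBefore x v.1) ?_ ?_ ?_ ?_
    · have hlt : ∀ v w : {v // v ∈ (csCell x).1},
          v < w → edgesBefore x v.1 ≠ edgesBefore x w.1 := by
        rintro ⟨v, hv⟩ ⟨w, hw⟩ hvw heq
        rw [Subtype.mk_lt_mk] at hvw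
        rcases mem_csCell.1 hv with rfl | ⟨i, hi, _, rfl⟩
        · exact (le_firstZero_of_mem hw).not_gt hvw
        · have := heq.symm ▸ mem_edgesBefore.2 ⟨hi, hvw⟩
          exact (mem_edgesBefore.1 this).2.false
      intro v _ w _ hvw
      rcases lt_trichotomy v w with h' | h' | h'
      · exact absurd hvw (hlt _ _ h')
      · exact h'
      · exact absurd hvw.symm (hlt _ _ h')
    · intro v _
      exact Finset.mem_coe.2 (Finset.mem_powerset.2 (Finset.filter_subset _ _))
    · intro S hS hS'
      rw [if_neg]
      rintro ⟨hl, -⟩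
      -- the first `[0]` in the left factor is a vertex of `csCell x`, and it determines `S`
      have hv : firstZero (serreLeft x S) ∈ (csCell x).1 := by
        by_cases hlast : firstZero (serreLeft x S) = Fin.last n
        · rw [hlast, ← firstZero_eq (x := x) (v := Fin.last n)]
          · exact firstZero_mem_csCell x
          · intro i hi h0
            rw [← hlast] at hi
            exact ne_zero_of_lt_firstZero hi (serreLeft_eq_zero.2 (Or.inl h0))
          · exact fun i hi => absurd hi (Fin.castSucc_lt_last i).ne
        · obtain ⟨j, hj⟩ := Fin.exists_castSucc_eq.2 hlast
          rcases serreLeft_eq_zero.1 (apply_firstZero hj) with h0 | ⟨h0, -⟩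
          · rw [← firstZero_eq (x := x) (v := firstZero (serreLeft x S))]
            · exact firstZero_mem_csCell x
            · exact fun i hi h0 =>
                ne_zero_of_lt_firstZero hi (serreLeft_eq_zero.2 (Or.inl h0))
            · intro i hi
              rw [← hj] at hi
              rwa [Fin.castSucc_injective _ hi]
          · rw [← hj]
            exact mem_csCell_of_edge h h0
      refine hS' ⟨⟨_, hv⟩, Finset.mem_coe.2 (Finset.mem_attach _ _), ?_⟩
      ext i
      rw [mem_edgesBefore]
      constructor
      · rintro ⟨hi, hlt⟩
        by_contra hiS
        exact ne_zero_of_lt_firstZero hlt (serreLeft_eq_zero.2 (Or.inr ⟨hi, hiS⟩))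
      · intro hi
        have he := mem_edges.1 (Finset.mem_powerset.1 hS hi)
        exact ⟨he, hl i (serreLeft_eq_edge.2 ⟨he, hi⟩)⟩
    · rintro ⟨v, hv⟩ _
      simp only
      have hl : Nondeg (serreLeft x (edgesBefore x v)) := by
        intro i hi
        rw [firstZero_serreLeft hv]
        exact (mem_edgesBefore.1 (serreLeft_eq_edge.1 hi).2).2
      have hr : Nondeg (serreRight x (edgesBefore x v)) := by
        intro i hi
        rw [firstZero_serreRight]
        exact h i (serreRight_eq_edge.1 hi).1
      rw [if_pos ⟨hl, hr⟩, csCell_serreLeft hv, csCell_serreRight hv,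
        Finset.filter_false_of_mem, Finset.card_empty, pow_zero]
      rintro ⟨i, j⟩ hij hlt
      simp only [Finset.mem_product, Finset.mem_sdiff, mem_edges, mem_edgesBefore] at hij hlt
      exact hij.1.2 ⟨hij.1.1, lt_trans (Fin.castSucc_lt_castSucc_iff.2 hlt) hij.2.2⟩
  · rw [if_neg h, map_zero]
    obtain ⟨i, j, hij, hi, hj⟩ := exists_zero_of_not_nondeg h
    refine Finset.sum_eq_zero fun S _ => if_neg ?_
    rintro ⟨hl, hr⟩
    by_cases hS : i ∈ S
    · exact not_nondeg hij (serreLeft_eq_edge.2 ⟨hi, hS⟩) (serreLeft_eq_zero.2 (Or.inl hj)) hl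
    · exact not_nondeg hij (serreRight_eq_edge.2 ⟨hi, hS⟩) (serreRight_eq_zero.2 hj) hr

end Coproduct

/-! ### The product of comparable cells -/

section Product

variable {R : Type u} [CommRing R] {n : ℕ}

/-- The order `[0] ≤ [0,1] ≤ [1]` on the cells of the interval. Cells of the cube are compared
factor by factor. -/
instance : PartialOrder Face where
  le a b := a = Face.zero ∨ a = b ∨ b = Face.one
  le_refl a := Or.inr (Or.inl rfl)
  le_trans a b c := by cases a <;> cases b <;> cases c <;> simp
  le_antisymm a b := by cases a <;> cases b <;> simp

theorem Face.le_iff {a b : Face} : a ≤ b ↔ a = Face.zero ∨ a = b ∨ b = Face.one := Iff.rfl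

theorem faceProd_eq_of_le {a b : Face} (h : a ≤ b) :
    faceProd R a b = if a = Face.zero ∧ b = Face.one then 1 else 0 := by
  rw [Face.le_iff] at h
  cases a <;> cases b <;> simp_all [faceProd]

theorem cubeProd_of_le {x y : CubeCell n} (h : x ≤ y) :
    cubeProd R n (Finsupp.single ![x, y] 1) = (-1 : R) ^ cubeDim x •
      ∑ l, if (∀ i, i < l → y i ≠ Face.edge) ∧ (∀ i, l < i → x i ≠ Face.edge) ∧
          x l = Face.zero ∧ y l = Face.one then
        Finsupp.single ![joinCell x y l] 1 else 0 := by
  simp only [cubeProd, Finsupp.linearCombination_single, one_smul, Matrix.cons_val_zero,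
    Matrix.cons_val_one]
  congr 1
  refine Finset.sum_congr rfl fun l _ => ?_
  rw [faceProd_eq_of_le (h l)]
  by_cases h1 : x l = Face.zero ∧ y l = Face.one
  · simp [h1]
  · rw [if_neg h1, if_neg fun h' => h1 h'.2.2]
    simp

theorem cubeProd_mem_supported {x y : CubeCell n} (h : x ≤ y) :
    cubeProd R n (Finsupp.single ![x, y] 1) ∈
      Finsupp.supported R R {z : Fin 1 → CubeCell n | ∀ w, x ≤ w → y ≤ w → z 0 ≤ w} := by
  rw [cubeProd_of_le h]
  refine Submodule.smul_mem _ _ (Submodule.sum_mem _ fun l _ => ?_)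
  split_ifs with hl
  · refine Finsupp.single_mem_supported _ _ fun w hxw hyw i => ?_
    simp only [Matrix.cons_val_fin_one, joinCell]
    split_ifs with h1 h2
    · exact hxw i
    · subst h2
      have := hyw i
      rw [hl.2.2.2, Face.le_iff] at this
      have hw : w i = Face.one := by simpa [eq_comm] using this
      exact Or.inr (Or.inr hw)
    · exact hyw i
  · exact Submodule.zero_mem _

theorem firstZero_le_firstZero {x y : CubeCell n} (h : x ≤ y) : firstZero x ≤ firstZero y := by
  by_contra hlt
  rw [not_le] at hlt
  obtain ⟨j, hj⟩ := Fin.exists_castSucc_eq.2 (hlt.trans_le (Fin.le_last _)).ne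
  refine ne_zero_of_lt_firstZero (hj ▸ hlt) ?_
  have := h j
  rw [apply_firstZero hj, Face.le_iff] at this
  simpa using this

theorem joinCell_apply_lt {x y : CubeCell n} {l i : Fin n} (h : i < l) :
    joinCell x y l i = x i := if_pos h

theorem joinCell_apply_self {x y : CubeCell n} {l : Fin n} :
    joinCell x y l l = Face.edge := by simp [joinCell]

theorem joinCell_apply_gt {x y : CubeCell n} {l i : Fin n} (h : l < i) :
    joinCell x y l i = y i := by
  rw [joinCell, if_neg h.not_gt, if_neg h.ne']

theorem simplexProd_single (s t : SimplexCell n) :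
    simplexProd R n (Finsupp.single ![s, t] 1) =
      if Disjoint s.1 t.1 then
        Finsupp.single ![⟨s.1 ∪ t.1, s.2.mono Finset.subset_union_left⟩]
          ((-1 : R) ^ (simplexDim s + ((s.1 ×ˢ t.1).filter fun p => p.2 < p.1).card)) else 0 := by
  rw [simplexProd, Finsupp.linearCombination_single, one_smul]
  rfl

/-- The image of `x ∗ y` for `x ≤ y`: the only term with a nonzero image is the one in which the
first factor `[0]` of `x` is multiplied with a factor `[1]` of `y`. -/
theorem commutes_prod {z : Fin 2 → CubeCell n} (hz : z 0 ≤ z 1) : Commutes R Graph.prod z := by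
  rw [vec_two_eq z, Commutes, tensorPower_CS_single_two]
  change tensorPower (CS R n) 1 (cubeProd R n _) = simplexProd R n _
  generalize z 0 = x at hz
  generalize z 1 = y at hz
  have hfz := firstZero_le_firstZero hz
  -- outside the first factor `[0]` of `x`, the terms have degenerate images
  have hzero : ∀ l : Fin n, l.castSucc ≠ firstZero x → tensorPower (CS R n) 1
      (if (∀ i, i < l → y i ≠ Face.edge) ∧ (∀ i, l < i → x i ≠ Face.edge) ∧
        x l = Face.zero ∧ y l = Face.one then
        Finsupp.single ![joinCell x y l] 1 else 0) = 0 := by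
    intro l hl
    split_ifs with h
    · have hlt : firstZero x < l.castSucc := lt_of_le_of_ne (firstZero_le h.2.2.1) hl.symm
      obtain ⟨j, hj⟩ := Fin.exists_castSucc_eq.2 (hlt.trans_le (Fin.le_last _)).ne
      have hjl : j < l := by rwa [← hj] at hlt
      rw [tensorPower_CS_single_one, if_neg]
      exact not_nondeg hjl joinCell_apply_self
        ((joinCell_apply_lt hjl).trans (apply_firstZero hj))
    · exact map_zero _
  rw [cubeProd_of_le hz, map_smul, map_sum]
  by_cases hex : ∃ p : Fin n, p.castSucc = firstZero x ∧ (∀ i, i < p → y i ≠ Face.edge) ∧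
      (∀ i, p < i → x i ≠ Face.edge) ∧ y p = Face.one
  · obtain ⟨p, hp, hy, hx, hyp⟩ := hex
    have hxp := apply_firstZero hp
    have hpy : p.castSucc < firstZero y := by
      refine lt_of_le_of_ne (hp ▸ hfz) fun h => ?_
      rw [apply_firstZero h] at hyp
      cases hyp
    have hxlt : ∀ i, x i = Face.edge → i < p := by
      intro i hi
      rcases lt_trichotomy i p with h | rfl | h
      · exact h
      · rw [hi] at hxp; cases hxp
      · exact absurd hi (hx i h)
    have hygt : ∀ i, y i = Face.edge → p < i := by
      intro i hi
      rcases lt_trichotomy i p with h | rfl | h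
      · exact absurd hi (hy i h)
      · rw [hi] at hyp; cases hyp
      · exact h
    have hnx : Nondeg x := fun i hi => by
      rw [← hp]
      exact Fin.castSucc_lt_castSucc_iff.2 (hxlt i hi)
    have hjz : firstZero (joinCell x y p) = firstZero y := by
      refine firstZero_eq (fun i hi => ?_) fun i hi => ?_
      · rcases lt_trichotomy i p with h | rfl | h
        · rw [joinCell_apply_lt h]
          refine ne_zero_of_lt_firstZero ?_
          rw [← hp]
          exact Fin.castSucc_lt_castSucc_iff.2 h
        · rw [joinCell_apply_self]; decide
        · rw [joinCell_apply_gt h]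
          exact ne_zero_of_lt_firstZero hi
      · have h : p < i := by rwa [← hi] at hpy
        rw [joinCell_apply_gt h]
        exact apply_firstZero hi
    have hje : ∀ i, joinCell x y p i = Face.edge ↔ x i = Face.edge ∨ i = p ∨ y i = Face.edge := by
      intro i
      rcases lt_trichotomy i p with h | rfl | h
      · rw [joinCell_apply_lt h]
        simp [h.ne, hy i h]
      · simp [joinCell_apply_self]
      · rw [joinCell_apply_gt h]
        simp [h.ne', hx i h]
    have hnj : Nondeg (joinCell x y p) ↔ Nondeg y := by
      unfold Nondeg
      rw [hjz]
      refine ⟨fun h i hi => h i ((hje i).2 (Or.inr (Or.inr hi))), fun h i hi => ?_⟩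
      rcases (hje i).1 hi with h' | rfl | h'
      · exact lt_trans (Fin.castSucc_lt_castSucc_iff.2 (hxlt i h')) hpy
      · exact hpy
      · exact h i h'
    rw [Finset.sum_eq_single p (fun l _ hl => hzero l fun h => hl
      (Fin.castSucc_injective _ (h.trans hp.symm))) (by simp), if_pos ⟨hy, hx, hxp, hyp⟩,
      tensorPower_CS_single_one]
    by_cases hny : Nondeg y
    · have hlt : ∀ a ∈ (csCell x).1, ∀ b ∈ (csCell y).1, a < b := by
        intro a ha b hb
        refine (le_firstZero_of_mem ha).trans_lt ?_
        rw [← hp]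
        rcases mem_csCell.1 hb with rfl | ⟨i, hi, _, rfl⟩
        · exact hpy
        · exact Fin.castSucc_lt_castSucc_iff.2 (hygt i hi)
      have hdisj : Disjoint (csCell x).1 (csCell y).1 :=
        Finset.disjoint_left.2 fun a ha hb => (hlt a ha a hb).false
      rw [if_pos (hnj.2 hny), if_pos ⟨hnx, hny⟩, simplexProd_single, if_pos hdisj,
        Finset.filter_false_of_mem, Finset.card_empty, add_zero,
        (nondeg_iff x).1 hnx, Finsupp.smul_single, smul_eq_mul, mul_one]
      · congr 1
        rw [show csCell (joinCell x y p) =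
          ⟨(csCell x).1 ∪ (csCell y).1, (csCell x).2.mono Finset.subset_union_left⟩ from ?_]
        apply Subtype.ext
        ext v
        simp only [Finset.mem_union]
        rw [mem_csCell, mem_csCell, mem_csCell, hjz]
        constructor
        · rintro (h | ⟨i, hi, hi', rfl⟩)
          · exact Or.inr (Or.inl h)
          · rcases (hje i).1 hi with h | rfl | h
            · exact Or.inl (Or.inr ⟨i, h, hnx i h, rfl⟩)
            · exact Or.inl (Or.inl hp)
            · exact Or.inr (Or.inr ⟨i, h, hi', rfl⟩)
        · rintro ((h | ⟨i, hi, hi', rfl⟩) | (h | ⟨i, hi, hi', rfl⟩))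
          · exact Or.inr ⟨p, joinCell_apply_self, hpy, hp.trans h.symm⟩
          · exact Or.inr ⟨i, (hje i).2 (Or.inl hi), hi'.trans_le hfz, rfl⟩
          · exact Or.inl h
          · exact Or.inr ⟨i, (hje i).2 (Or.inr (Or.inr hi)), hi', rfl⟩
      · rintro ⟨a, b⟩ hab h
        rw [Finset.mem_product] at hab
        exact (hlt a hab.1 b hab.2).not_gt h
    · rw [if_neg fun h => hny (hnj.1 h), if_neg fun h => hny h.2, map_zero, smul_zero]
  · have hl : ∀ l : Fin n, tensorPower (CS R n) 1
        (if (∀ i, i < l → y i ≠ Face.edge) ∧ (∀ i, l < i → x i ≠ Face.edge) ∧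
          x l = Face.zero ∧ y l = Face.one then
          Finsupp.single ![joinCell x y l] 1 else 0) = 0 := by
      intro l
      by_cases hl : l.castSucc = firstZero x
      · rw [if_neg fun h => hex ⟨l, hl, h.1, h.2.1, h.2.2.2⟩, map_zero]
      · exact hzero l hl
    rw [Finset.sum_eq_zero fun l _ => hl l, smul_zero]
    split_ifs with h
    · rw [simplexProd_single, if_neg]
      intro hdisj
      have hd : ∀ v, v ∈ (csCell x).1 → v ∉ (csCell y).1 := fun v hv =>
        Finset.disjoint_left.1 hdisj hv
      have hne : firstZero x ≠ Fin.last n := by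
        intro hlast
        refine hd _ (firstZero_mem_csCell x) ?_
        have : firstZero y = firstZero x := le_antisymm (hlast ▸ Fin.le_last _) hfz
        exact this ▸ firstZero_mem_csCell y
      obtain ⟨p, hp⟩ := Fin.exists_castSucc_eq.2 hne
      refine hex ⟨p, hp, fun i hi hyi => ?_, fun i hi hxi => ?_, ?_⟩
      · have hi' : i.castSucc < firstZero x := hp ▸ Fin.castSucc_lt_castSucc_iff.2 hi
        have hxi := hz i
        rw [hyi, Face.le_iff] at hxi
        rcases hxi with hxi | hxi | hxi
        · exact ne_zero_of_lt_firstZero hi' hxi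
        · exact hd _ (mem_csCell_of_edge h.1 hxi) (mem_csCell_of_edge h.2 hyi)
        · cases hxi
      · have := h.1 i hxi
        rw [← hp] at this
        exact hi.not_gt this
      · have hpx := firstZero_mem_csCell x
        rw [← hp] at hpx
        cases hyp : y p with
        | zero =>
          refine absurd ?_ (hd _ hpx)
          have : firstZero y = p.castSucc := le_antisymm (firstZero_le hyp) (hp ▸ hfz)
          exact this ▸ firstZero_mem_csCell y
        | one => rfl
        | edge => exact absurd (mem_csCell_of_edge h.2 hyp) (hd _ hpx)
    · rw [map_zero]

end Product

/-! ### Shuffle graphs and the operad generated by them -/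

section Shuffles

variable {R : Type u} [CommRing R] {n : ℕ}

/-- The terms of an iterated Serre coproduct are increasing tuples of cells that agree with the
given cell away from its factors `[0,1]`. -/
theorem combCoprod_mem_supported (k : ℕ) (x : CubeCell n) :
    (cubeBialgebra R n).eval (combCoprod k) (Finsupp.single ![x] 1) ∈ Finsupp.supported R R
      {y : Fin k → CubeCell n | Monotone y ∧ ∀ j i, x i ≠ Face.edge → y j i = x i} := by
  induction k generalizing x with
  | zero =>
    refine Finsupp.supported_mono ?_ (by simp : _ ∈ Finsupp.supported R R Set.univ)
    exact fun y _ => ⟨fun i => i.elim0, fun i => i.elim0⟩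
  | succ k ih =>
    cases k with
    | zero =>
      refine Finsupp.supported_mono ?_ ((cubeBialgebra R n).eval_id_mem_supported ![x])
      rintro y rfl
      exact ⟨Subsingleton.monotone (α := Fin 1) ![x], fun j i _ => by simp⟩
    | succ k =>
      have hco : (cubeBialgebra R n).eval Graph.coprod (Finsupp.single ![x] 1) ∈
          Finsupp.supported R R {y : Fin 2 → CubeCell n |
            ∃ S, y = Fin.append (m := 1) (n := 1) ![serreLeft x S] ![serreRight x S]} := by
        change cubeCoprod R n _ ∈ _
        simp only [cubeCoprod, Finsupp.linearCombination_single, one_smul]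
        refine Submodule.sum_mem _ fun S _ => Finsupp.single_mem_supported _ _ ⟨S, ?_⟩
        rw [← vec_eq_append]
        rfl
      refine MBialgebra.eval_comp_mem_supported _ hco ?_
      rintro _ ⟨S, rfl⟩
      refine Finsupp.supported_mono ?_ (MBialgebra.eval_juxt_mem_supported _ (ih (serreLeft x S))
        (MBialgebra.eval_id_mem_supported _ ![serreRight x S]))
      rintro _ ⟨u, ⟨hu, hu'⟩, _, rfl, rfl⟩
      have hle : ∀ j, u j ≤ serreRight x S := by
        intro j i
        have := hu' j i
        rw [Face.le_iff]
        unfold serreLeft serreRight at *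
        split_ifs at * <;> simp_all
      refine ⟨fun i j => ?_, fun j i hi => ?_⟩
      · refine Fin.addCases (fun i => ?_) (fun i => ?_) i <;>
          refine Fin.addCases (fun j => ?_) (fun j => ?_) j <;> intro hij
        · simpa using hu hij
        · simpa using hle i
        · exact absurd (castAdd_lt_natAdd j i) hij.not_gt
        · simp
      · refine Fin.addCases (fun j => ?_) (fun j => ?_) j
        · have := hu' j i
          simp_all [serreLeft]
        · simp [serreRight, hi]

theorem commutes_combCoprod (k : ℕ) (x : Fin 1 → CubeCell n) : Commutes R (combCoprod k) x := by
  induction k generalizing x with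
  | zero => exact commutes_counit x
  | succ k ih =>
    cases k with
    | zero => exact commutes_id x
    | succ k =>
      refine commutes_comp_of_forall (commutes_coprod x) fun y => ?_
      rw [tens_single_append (m := 1) (p := 1) y]
      exact commutes_juxt (ih _) (commutes_id _)

/-- Increasing tuples of cells have products that are bounded by all upper bounds of the tuple, so
that the iterated products of such tuples only involve products `x ∗ y` with `x ≤ y`. -/
theorem commutes_combProd (k : ℕ) {x : Fin (k + 1) → CubeCell n} (hx : Monotone x) :
    Commutes R (combProd k) x ∧
      (cubeBialgebra R n).eval (combProd k) (Finsupp.single x 1) ∈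
        Finsupp.supported R R {z : Fin 1 → CubeCell n | ∀ w, (∀ i, x i ≤ w) → z 0 ≤ w} := by
  induction k with
  | zero =>
    refine ⟨commutes_id x, ?_⟩
    refine Finsupp.supported_mono ?_ ((cubeBialgebra R n).eval_id_mem_supported x)
    rintro y rfl w hw
    exact hw 0
  | succ k ih =>
    rw [tens_single_append (m := k + 1) (p := 1) x]
    set u : Fin (k + 1) → CubeCell n := fun i => x (Fin.castAdd 1 i)
    set v : Fin 1 → CubeCell n := fun j => x (Fin.natAdd (k + 1) j)
    have hu : Monotone u := fun i j hij => hx hij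
    have huv : ∀ i, u i ≤ v 0 := fun i => hx (castAdd_lt_natAdd i 0).le
    obtain ⟨ih1, ih2⟩ := ih hu
    have hsupp := MBialgebra.eval_juxt_mem_supported _ ih2
      (MBialgebra.eval_id_mem_supported (cubeBialgebra R n) v)
    constructor
    · refine commutes_comp (commutes_juxt ih1 (commutes_id v)) hsupp ?_
      rintro _ ⟨z, hz, _, rfl, rfl⟩
      exact commutes_prod (hz _ huv)
    · refine MBialgebra.eval_comp_mem_supported _ hsupp ?_
      rintro _ ⟨z, hz, _, rfl, rfl⟩
      have hzv : z 0 ≤ v 0 := hz _ huv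
      rw [vec_one_eq z, vec_one_eq v, ← vec_eq_append]
      refine Finsupp.supported_mono ?_ (cubeProd_mem_supported hzv)
      intro y hy w hw
      refine hy w (hz w fun i => ?_) ?_
      · simpa using hw (Fin.castAdd 1 i)
      · simpa using hw (Fin.natAdd (k + 1) 0)

theorem commutes_prodBlock (r : ℕ) (ks : Fin r → ℕ) {x : Fin (total r ks) → CubeCell n}
    (hx : ∀ i j, i < j → blockOf r ks i = blockOf r ks j → x i ≤ x j) :
    Commutes R (prodBlock r ks) x := by
  induction r with
  | zero => exact commutes_id x
  | succ r ih =>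
    rw [tens_single_append (m := total r fun i => ks i.castSucc) (p := ks (Fin.last r) + 1) x]
    refine commutes_juxt (ih _ fun i j hij h => ?_) (commutes_combProd _ fun i j hij => ?_).1
    · refine hx _ _ hij ?_
      simp [blockOf, h]
    · rcases hij.eq_or_lt with rfl | hij
      · exact le_rfl
      · refine hx _ _ ((Fin.natAdd_lt_natAdd_iff _).2 hij) ?_
        simp [blockOf]

theorem commutes_shuffleGraph (r : ℕ) (ks : Fin r → ℕ) {σ : Equiv.Perm (Fin (total r ks))}
    (hσ : IsShuffle r ks σ) (x : Fin 1 → CubeCell n) : Commutes R (shuffleGraph r ks σ) x := by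
  refine commutes_comp (S := {y | ∃ z : Fin (total r ks) → CubeCell n, Monotone z ∧ y = z ∘ σ})
    (commutes_comp_of_forall (commutes_combCoprod _ x) fun y => commutes_perm _ y) ?_ ?_
  · rw [vec_one_eq x]
    refine MBialgebra.eval_comp_mem_supported _ (combCoprod_mem_supported _ _) ?_
    rintro z ⟨hz, -⟩
    rw [MBialgebra.eval, permHom_single]
    exact Finsupp.single_mem_supported _ _ ⟨z, hz, rfl⟩
  · rintro _ ⟨z, hz, rfl⟩
    exact commutes_prodBlock r ks fun i j hij h => hz (hσ i j hij h).le

theorem commutes_of_isShuffleGrafting {r : ℕ} {Γ : Graph 1 r} (hΓ : IsShuffleGrafting Γ) :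
    ∀ x : Fin 1 → CubeCell n, Commutes R Γ x := by
  induction hΓ with
  | id => exact commutes_id
  | shuffle r ks σ hσ => exact commutes_shuffleGraph r ks hσ
  | graft a b s Γ Γ' _ _ ih ih' =>
    refine fun x => commutes_comp_of_forall (ih x) fun y => ?_
    rw [tens_single_append y, tens_single_append fun i => y (Fin.castAdd b i)]
    exact commutes_juxt (commutes_juxt (commutes_id _) (ih' _)) (commutes_id _)
  | perm e Γ _ ih => exact fun x => commutes_comp_of_forall (ih x) fun y => commutes_perm e y

theorem tensorPower_CS_comp_eval {m r : ℕ} {Γ : Graph m r}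
    (h : ∀ x : Fin m → CubeCell n, Commutes R Γ x) :
    tensorPower (CS R n) r ∘ₗ (cubeBialgebra R n).eval Γ =
      (simplexBialgebra R n).eval Γ ∘ₗ tensorPower (CS R n) m :=
  tens_ext h

theorem MBialgebra.act_cls {B : Type} (A : MBialgebra R B) {m r : ℕ} (Γ : Graph m r) :
    A.act m r (cls R Γ) = A.eval Γ :=
  A.evalLin_gr Γ

theorem tensorPower_CS_comp_act (r : ℕ) {γ : PropM R 1 r} (hγ : γ ∈ shuffleOperad R r) :
    tensorPower (CS R n) r ∘ₗ (cubeBialgebra R n).act 1 r γ =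
      (simplexBialgebra R n).act 1 r γ ∘ₗ tensorPower (CS R n) 1 := by
  unfold shuffleOperad at hγ
  induction hγ using Submodule.span_induction with
  | mem γ hγ =>
    obtain ⟨Γ, hΓ, rfl⟩ := hγ
    rw [MBialgebra.act_cls, MBialgebra.act_cls]
    exact tensorPower_CS_comp_eval (commutes_of_isShuffleGrafting hΓ)
  | zero => simp
  | add γ δ _ _ hγ hδ =>
    rw [map_add, map_add, LinearMap.comp_add, LinearMap.add_comp, hγ, hδ]
  | smul c γ _ hγ => rw [map_smul, map_smul, LinearMap.comp_smul, LinearMap.smul_comp, hγ]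

end Shuffles

/-! ### The boundary -/

section ChainMap

variable {R : Type u} [CommRing R] {n : ℕ}

theorem csCell_congr {x y : CubeCell n} (hz : firstZero x = firstZero y)
    (he : edges x = edges y) : csCell x = csCell y := by
  apply Subtype.ext
  ext v
  rw [mem_csCell, mem_csCell, hz]
  simp only [← mem_edges, he]

theorem nondeg_congr {x y : CubeCell n} (hz : firstZero x = firstZero y)
    (he : edges x = edges y) : Nondeg x ↔ Nondeg y := by
  simp only [Nondeg, ← mem_edges, he, hz]

theorem firstZero_update_one {x : CubeCell n} {k : Fin n} (hk : x k = Face.edge) :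
    firstZero (Function.update x k Face.one) = firstZero x := by
  refine firstZero_eq (fun i hi => ?_) fun i hi => ?_
  · by_cases h : i = k
    · subst h; simp
    · rw [Function.update_of_ne h]
      exact ne_zero_of_lt_firstZero hi
  · have h0 := apply_firstZero hi
    have h : i ≠ k := by rintro rfl; rw [hk] at h0; cases h0
    rwa [Function.update_of_ne h]

theorem firstZero_update_zero_of_lt {x : CubeCell n} {k : Fin n} (hk : x k = Face.edge)
    (hlt : firstZero x < k.castSucc) :
    firstZero (Function.update x k Face.zero) = firstZero x := by
  refine firstZero_eq (fun i hi => ?_) fun i hi => ?_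
  · have h : i ≠ k := by rintro rfl; exact hi.not_gt hlt
    rw [Function.update_of_ne h]
    exact ne_zero_of_lt_firstZero hi
  · have h0 := apply_firstZero hi
    have h : i ≠ k := by rintro rfl; rw [hk] at h0; cases h0
    rwa [Function.update_of_ne h]

theorem firstZero_update_zero_of_gt {x : CubeCell n} {k : Fin n}
    (hlt : k.castSucc < firstZero x) :
    firstZero (Function.update x k Face.zero) = k.castSucc := by
  refine firstZero_eq (fun i hi => ?_) fun i hi => ?_
  · have h : i ≠ k := by rintro rfl; exact hi.false
    rw [Function.update_of_ne h]
    exact ne_zero_of_lt_firstZero (hi.trans hlt)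
  · obtain rfl := Fin.castSucc_injective _ hi
    simp

theorem csCell_of_nondeg {x : CubeCell n} (h : Nondeg x) :
    (csCell x).1 = insert (firstZero x) ((edges x).map Fin.castSuccEmb) := by
  simp only [csCell, Finset.filter_true_of_mem fun i hi => h i (mem_edges.1 hi)]

theorem simplexOrZero_coe (s : SimplexCell n) : simplexOrZero R s.1 = Finsupp.single s 1 :=
  dif_pos s.2

theorem CS_update_one {x : CubeCell n} (h : Nondeg x) {i : Fin n} (hi : x i = Face.edge) :
    CS R n (Finsupp.single (Function.update x i Face.one) 1) =
      simplexOrZero R ((csCell x).1.erase i.castSucc) := by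
  have hz1 := firstZero_update_one hi
  have he : edges (Function.update x i Face.one) = (edges x).erase i :=
    edges_update (by decide)
  have hnd : Nondeg (Function.update x i Face.one) := by
    intro j hj
    rw [← mem_edges, he, Finset.mem_erase, mem_edges] at hj
    rw [hz1]
    exact h j hj.2
  rw [CS_single, if_pos hnd, ← simplexOrZero_coe, csCell_of_nondeg hnd, csCell_of_nondeg h,
    hz1, he, Finset.map_erase, Finset.erase_insert_of_ne (h i hi).ne']
  rfl

/-- Among the faces `x_i = [0]`, only the one for the last factor `[0,1]` is not collapsed. -/
theorem sum_CS_update_zero {x : CubeCell n} (h : Nondeg x) :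
    ∑ i ∈ edges x, (-1 : R) ^ ((edges x).filter fun j => j < i).card •
      CS R n (Finsupp.single (Function.update x i Face.zero) 1) =
        -((-1 : R) ^ (edges x).card • simplexOrZero R ((edges x).map Fin.castSuccEmb)) := by
  rcases (edges x).eq_empty_or_nonempty with hE | hE
  · simp [hE, simplexOrZero]
  · obtain ⟨k, hm, hmax⟩ := (edges x).exists_max_image id hE
    have hzk := firstZero_update_zero_of_gt (h k (mem_edges.1 hm))
    have hlt : ∀ j ∈ (edges x).erase k, j < k := fun j hj =>
      lt_of_le_of_ne (hmax j (Finset.mem_erase.1 hj).2) (Finset.mem_erase.1 hj).1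
    have he : edges (Function.update x k Face.zero) = (edges x).erase k :=
      edges_update (by decide)
    rw [Finset.sum_eq_single k]
    · have hnd : Nondeg (Function.update x k Face.zero) := by
        intro j hj
        rw [← mem_edges, he] at hj
        rw [hzk]
        exact Fin.castSucc_lt_castSucc_iff.2 (hlt j hj)
      have hcell : (csCell (Function.update x k Face.zero)).1 =
          (edges x).map Fin.castSuccEmb := by
        rw [csCell_of_nondeg hnd, hzk, he, Finset.map_erase]
        exact Finset.insert_erase (Finset.mem_map_of_mem Fin.castSuccEmb hm)
      have hfilter : ((edges x).filter fun j => j < k) = (edges x).erase k := by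
        ext j
        rw [Finset.mem_filter]
        exact ⟨fun hj => Finset.mem_erase.2 ⟨hj.2.ne, hj.1⟩,
          fun hj => ⟨(Finset.mem_erase.1 hj).2, hlt j hj⟩⟩
      rw [CS_single, if_pos hnd, ← simplexOrZero_coe, hcell, hfilter,
        ← Finset.card_erase_add_one hm, pow_succ]
      simp
    · intro i hi hik
      rw [CS_single, if_neg, smul_zero]
      refine not_nondeg (hlt i (Finset.mem_erase.2 ⟨hik, hi⟩)) ?_ (Function.update_self ..)
      rw [Function.update_of_ne (Ne.symm hik)]
      exact mem_edges.1 hm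
    · exact fun h' => absurd hm h'

theorem CS_cubeBoundary_of_nondeg {x : CubeCell n} (h : Nondeg x) :
    CS R n (cubeBoundary R n (Finsupp.single x 1)) =
      simplexBoundary R n (CS R n (Finsupp.single x 1)) := by
  have hz : firstZero x ∉ (edges x).map Fin.castSuccEmb := by
    intro hmem
    obtain ⟨i, hi, hi'⟩ := Finset.mem_map.1 hmem
    exact (h i (mem_edges.1 hi)).ne hi'
  rw [cubeBoundary_single, map_sum, CS_single, if_pos h, simplexBoundary_single']
  simp only [map_smul, map_sub, smul_sub, Finset.sum_sub_distrib]
  rw [sum_CS_update_zero h, csCell_of_nondeg h, Finset.sum_insert hz, Finset.erase_insert hz,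
    sub_neg_eq_add, add_comm, Finset.sum_map]
  congr 1
  · rw [Finset.filter_insert, if_neg (lt_irrefl _), Finset.filter_true_of_mem, Finset.card_map]
    intro v hv
    obtain ⟨i, hi, rfl⟩ := Finset.mem_map.1 hv
    exact h i (mem_edges.1 hi)
  · refine Finset.sum_congr rfl fun i hi => ?_
    rw [CS_update_one h (mem_edges.1 hi), csCell_of_nondeg h, Finset.filter_insert,
      if_neg (show ¬ firstZero x < Fin.castSuccEmb i from (h i (mem_edges.1 hi)).not_gt),
      Finset.filter_map, Finset.card_map]
    rfl

theorem CS_comp_cubeBoundary : CS R n ∘ₗ cubeBoundary R n = simplexBoundary R n ∘ₗ CS R n := by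
  refine Finsupp.lhom_ext' fun x => LinearMap.ext_ring ?_
  simp only [LinearMap.comp_apply, Finsupp.lsingle_apply]
  by_cases h : Nondeg x
  · exact CS_cubeBoundary_of_nondeg h
  · rw [CS_single R x, if_neg h, map_zero, cubeBoundary_single, map_sum]
    refine Finset.sum_eq_zero fun k hk => ?_
    have hk' := mem_edges.1 hk
    rw [map_smul, map_sub]
    convert smul_zero _
    rw [sub_eq_zero, CS_single, CS_single]
    have he : edges (Function.update x k Face.one) = edges (Function.update x k Face.zero) := by
      rw [edges_update (by decide), edges_update (by decide)]
    obtain ⟨i, j, hji, hi, hj⟩ := exists_zero_of_not_nondeg h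
    rcases lt_or_ge (firstZero x) k.castSucc with hlt | hle
    · have hz : firstZero (Function.update x k Face.one) =
          firstZero (Function.update x k Face.zero) := by
        rw [firstZero_update_one hk', firstZero_update_zero_of_lt hk' hlt]
      simp only [nondeg_congr hz he, csCell_congr hz he]
    · have hik : i ≠ k := by
        rintro rfl
        exact ((firstZero_le hj).trans_lt (Fin.castSucc_lt_castSucc_iff.2 hji)).not_ge hle
      have hjk : j ≠ k := by rintro rfl; rw [hj] at hk'; cases hk'
      have hdeg : ∀ a, ¬ Nondeg (Function.update x k a) := fun a =>
        not_nondeg hji (by rwa [Function.update_of_ne hik]) (by rwa [Function.update_of_ne hjk])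
      rw [if_neg (hdeg _), if_neg (hdeg _)]

theorem CS_mem_supported (m : ℕ) : ∀ z ∈ Finsupp.supported R R {x : CubeCell n | cubeDim x = m},
    CS R n z ∈ Finsupp.supported R R {s : SimplexCell n | simplexDim s = m} := by
  refine fun z => map_mem_supported fun x (hx : cubeDim x = m) => ?_
  rw [CS_single]
  split_ifs with h
  · exact Finsupp.single_mem_supported _ _ (((nondeg_iff x).1 h).trans hx)
  · exact Submodule.zero_mem _

end ChainMap

/-! ### Contractions of the cube and of the simplex -/

section Homotopy

variable {R : Type u} [CommRing R]

section

variable {B B' : Type} {deg : B → ℕ} {d : (B →₀ R) →ₗ[R] (B →₀ R)} {hd : d ∘ₗ d = 0}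
  {hdeg : ∀ m, ∀ z ∈ Finsupp.supported R R {b : B | deg b = m + 1},
    d z ∈ Finsupp.supported R R {b : B | deg b = m}}
  {deg' : B' → ℕ} {d' : (B' →₀ R) →ₗ[R] (B' →₀ R)} {hd' : d' ∘ₗ d' = 0}
  {hdeg' : ∀ m, ∀ z ∈ Finsupp.supported R R {b : B' | deg' b = m + 1},
    d' z ∈ Finsupp.supported R R {b : B' | deg' b = m}}

theorem complexOf_d (m : ℕ) : (complexOf deg d hd hdeg).d (m + 1) m =
    ModuleCat.ofHom (d.restrict (hdeg m)) :=
  ChainComplex.of_d (fun m => ModuleCat.of R (Finsupp.supported R R {b : B | deg b = m}))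
    (fun m => ModuleCat.ofHom (d.restrict (hdeg m))) m

/-- The morphism of chain complexes given by a linear map of degree `0` that commutes with the
boundaries. -/
def complexMap (f : (B →₀ R) →ₗ[R] (B' →₀ R))
    (hf : ∀ m, ∀ z ∈ Finsupp.supported R R {b : B | deg b = m},
      f z ∈ Finsupp.supported R R {b : B' | deg' b = m})
    (hfd : f ∘ₗ d = d' ∘ₗ f) : complexOf deg d hd hdeg ⟶ complexOf deg' d' hd' hdeg' :=
  ChainComplex.ofHom (fun m => ModuleCat.ofHom (f.restrict (hf m))) fun m => by
    rw [complexOf_d, complexOf_d]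
    exact ModuleCat.hom_ext (LinearMap.ext fun z =>
      Subtype.ext (LinearMap.congr_fun hfd z.1).symm)

/-- The components of the homotopy given by a linear map of degree `1`. -/
def complexHomotopyHom (h : (B →₀ R) →ₗ[R] (B' →₀ R))
    (hh : ∀ m, ∀ z ∈ Finsupp.supported R R {b : B | deg b = m},
      h z ∈ Finsupp.supported R R {b : B' | deg' b = m + 1}) (i j : ℕ) :
    (complexOf deg d hd hdeg).X i ⟶ (complexOf deg' d' hd' hdeg').X j :=
  if hij : i + 1 = j then
    ModuleCat.ofHom (h.restrict (p := Finsupp.supported R R {b : B | deg b = i})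
      (q := Finsupp.supported R R {b : B' | deg' b = j}) (hij ▸ hh i)) else 0

theorem complexHomotopyHom_succ (h : (B →₀ R) →ₗ[R] (B' →₀ R))
    (hh : ∀ m, ∀ z ∈ Finsupp.supported R R {b : B | deg b = m},
      h z ∈ Finsupp.supported R R {b : B' | deg' b = m + 1}) (i : ℕ) :
    complexHomotopyHom (hd := hd) (hdeg := hdeg) (hd' := hd') (hdeg' := hdeg') h hh i (i + 1) =
      ModuleCat.ofHom (h.restrict (hh i)) :=
  dif_pos rfl

/-- The homotopy between two morphisms of chain complexes given by a linear map of degree `1`. -/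
def complexHomotopy {f g : (B →₀ R) →ₗ[R] (B' →₀ R)}
    {hf : ∀ m, ∀ z ∈ Finsupp.supported R R {b : B | deg b = m},
      f z ∈ Finsupp.supported R R {b : B' | deg' b = m}}
    {hg : ∀ m, ∀ z ∈ Finsupp.supported R R {b : B | deg b = m},
      g z ∈ Finsupp.supported R R {b : B' | deg' b = m}}
    {hfd : f ∘ₗ d = d' ∘ₗ f} {hgd : g ∘ₗ d = d' ∘ₗ g} (h : (B →₀ R) →ₗ[R] (B' →₀ R))
    (hh : ∀ m, ∀ z ∈ Finsupp.supported R R {b : B | deg b = m},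
      h z ∈ Finsupp.supported R R {b : B' | deg' b = m + 1})
    (hd0 : ∀ z ∈ Finsupp.supported R R {b : B | deg b = 0}, d z = 0)
    (hhd : d' ∘ₗ h + h ∘ₗ d = f - g) :
    Homotopy (complexMap (hd := hd) (hdeg := hdeg) (hd' := hd') (hdeg' := hdeg') f hf hfd)
      (complexMap g hg hgd) where
  hom := complexHomotopyHom h hh
  zero i j hij := dif_neg hij
  comm i := by
    have key := fun z => LinearMap.congr_fun hhd z
    simp only [LinearMap.add_apply, LinearMap.comp_apply, LinearMap.sub_apply] at key
    rw [Homotopy.prevD_chainComplex, complexHomotopyHom_succ, complexOf_d]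
    cases i with
    | zero =>
      rw [Homotopy.dNext_zero_chainComplex, zero_add]
      refine ModuleCat.hom_ext (LinearMap.ext fun z => Subtype.ext ?_)
      have := key z.1
      rw [hd0 _ z.2, map_zero, add_zero, eq_sub_iff_add_eq] at this
      exact this.symm
    | succ i =>
      rw [Homotopy.dNext_succ_chainComplex, complexHomotopyHom_succ, complexOf_d]
      refine ModuleCat.hom_ext (LinearMap.ext fun z => Subtype.ext ?_)
      have := key z.1
      rw [eq_sub_iff_add_eq, add_comm (d' _)] at this
      exact this.symm

end

variable (R) (n : ℕ)

/-- The projection of the cube to its face `x_l = 0`, as a map of cellular chains. -/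
def faceProj (l : Fin n) : (CubeCell n →₀ R) →ₗ[R] (CubeCell n →₀ R) :=
  Finsupp.linearCombination R fun x =>
    if x l = Face.edge then 0 else Finsupp.single (Function.update x l Face.zero) 1

/-- The homotopy from `faceProj` to the identity that sweeps the face `x_l = 1` through the cube:
it replaces the factor `[1]` in position `l` by `[0,1]`. -/
def faceSweep (l : Fin n) : (CubeCell n →₀ R) →ₗ[R] (CubeCell n →₀ R) :=
  Finsupp.linearCombination R fun x =>
    if x l = Face.one then (-1 : R) ^ ((edges x).filter fun j => j < l).card •
      Finsupp.single (Function.update x l Face.edge) 1 else 0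

/-- The projection of the cube to its vertex `(0, …, 0)`, as a map of cellular chains. -/
def cubePoint : (CubeCell n →₀ R) →ₗ[R] (CubeCell n →₀ R) :=
  Finsupp.linearCombination R fun x =>
    if cubeDim x = 0 then Finsupp.single (fun _ => Face.zero) 1 else 0

/-- The projection of the simplex to its vertex `[0]`, as a map of cellular chains. -/
def simplexPoint : (SimplexCell n →₀ R) →ₗ[R] (SimplexCell n →₀ R) :=
  Finsupp.linearCombination R fun s =>
    if simplexDim s = 0 then Finsupp.single ⟨{0}, Finset.singleton_nonempty 0⟩ 1 else 0

/-- The cone with apex `[0]`. -/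
def simplexCone : (SimplexCell n →₀ R) →ₗ[R] (SimplexCell n →₀ R) :=
  Finsupp.linearCombination R fun s =>
    if 0 ∈ s.1 then 0 else simplexOrZero R (insert 0 s.1)

variable {R n}

theorem faceProj_single (l : Fin n) (x : CubeCell n) : faceProj R n l (Finsupp.single x 1) =
    if x l = Face.edge then 0 else Finsupp.single (Function.update x l Face.zero) 1 := by
  simp [faceProj]

theorem faceSweep_single (l : Fin n) (x : CubeCell n) : faceSweep R n l (Finsupp.single x 1) =
    if x l = Face.one then (-1 : R) ^ ((edges x).filter fun j => j < l).card •
      Finsupp.single (Function.update x l Face.edge) 1 else 0 := by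
  simp [faceSweep]

theorem edges_update_edge (x : CubeCell n) (l : Fin n) :
    edges (Function.update x l Face.edge) = insert l (edges x) := by
  ext j
  by_cases h : j = l
  · subst h; simp [mem_edges]
  · simp [mem_edges, h]

theorem faceSweep_homotopy (l : Fin n) :
    cubeBoundary R n ∘ₗ faceSweep R n l + faceSweep R n l ∘ₗ cubeBoundary R n =
      LinearMap.id - faceProj R n l := by
  refine Finsupp.lhom_ext' fun x => LinearMap.ext_ring ?_
  simp only [LinearMap.comp_apply, Finsupp.lsingle_apply, LinearMap.add_apply,
    LinearMap.sub_apply, LinearMap.id_apply]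
  rw [faceSweep_single, faceProj_single, cubeBoundary_single, map_sum]
  simp only [map_smul, map_sub]
  have hsq : ∀ k : ℕ, (-1 : R) ^ k * (-1 : R) ^ k = 1 := fun k => by rw [← mul_pow]; simp
  cases hx : x l with
  | zero =>
    rw [if_neg (by decide), if_neg (by decide), map_zero, zero_add,
      show Function.update x l Face.zero = x by rw [← hx, Function.update_eq_self], sub_self]
    refine Finset.sum_eq_zero fun i hi => ?_
    have hil : l ≠ i := by rintro rfl; rw [mem_edges, hx] at hi; cases hi
    simp [faceSweep_single, Function.update_of_ne hil, hx]
  | edge =>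
    rw [if_neg (by decide), if_pos rfl, map_zero, zero_add, sub_zero,
      Finset.sum_eq_single l]
    · have hf : (edges (Function.update x l Face.one)).filter (fun j => j < l) =
          (edges x).filter fun j => j < l := by
        rw [edges_update (by decide), Finset.filter_erase, Finset.erase_eq_of_notMem (by simp)]
      rw [faceSweep_single, faceSweep_single, if_pos (by simp), if_neg (by simp), sub_zero, hf,
        smul_smul, hsq, one_smul, Function.update_idem, ← hx, Function.update_eq_self]
    · intro i _ hil
      simp [faceSweep_single, Function.update_of_ne hil.symm, hx]
    · exact fun h => absurd (mem_edges.2 hx) h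
  | one =>
    have hl : l ∉ edges x := by simp [mem_edges, hx]
    have hflt : (insert l (edges x)).filter (fun j => j < l) =
        (edges x).filter fun j => j < l := by simp [Finset.filter_insert]
    rw [if_pos rfl, if_neg (by decide), map_smul, cubeBoundary_single, edges_update_edge,
      Finset.sum_insert hl, hflt, smul_add, smul_smul, hsq, one_smul, Function.update_idem,
      Function.update_idem, ← hx, Function.update_eq_self, hx, add_assoc]
    convert add_zero _
    rw [Finset.smul_sum, ← Finset.sum_add_distrib]
    refine Finset.sum_eq_zero fun i hi => ?_
    have hil : i ≠ l := by rintro rfl; exact hl hi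
    have hs := sign_erase R (insert l (edges x)) (Finset.mem_insert_self l _)
      (Finset.mem_insert_of_mem hi) hil.symm
    rw [hflt, Finset.erase_insert hl, Finset.erase_insert_of_ne hil.symm,
      Finset.filter_insert (p := fun k => k < l), if_neg (lt_irrefl l)] at hs
    have hsw : ∀ a, a ≠ Face.edge → faceSweep R n l (Finsupp.single (Function.update x i a) 1) =
        (-1 : R) ^ (((edges x).erase i).filter fun j => j < l).card •
          Finsupp.single (Function.update (Function.update x l Face.edge) i a) 1 := by
      intro a ha
      rw [faceSweep_single, if_pos (by rwa [Function.update_of_ne hil.symm]), edges_update ha,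
        Function.update_comm hil]
    rw [hsw _ (by decide), hsw _ (by decide), ← smul_sub, smul_smul, smul_smul, ← add_smul]
    have h1 := hsq ((insert l (edges x)).filter fun k => k < i).card
    have h2 := hsq ((edges x).filter fun k => k < i).card
    refine smul_eq_zero_of_left ?_ _
    generalize (-1 : R) ^ ((insert l (edges x)).filter fun k => k < i).card = w at *
    generalize (-1 : R) ^ ((edges x).filter fun k => k < i).card = u at *
    generalize (-1 : R) ^ ((edges x).filter fun k => k < l).card = a at *
    generalize (-1 : R) ^ (((edges x).erase i).filter fun k => k < l).card = b at *
    -- `hs` is multiplied by `w * u` because the signs `w` and `u` are their own inverses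
    linear_combination w * u * hs - a * w * h2 - u * b * h1

theorem faceProj_comp_cubeBoundary (l : Fin n) :
    faceProj R n l ∘ₗ cubeBoundary R n = cubeBoundary R n ∘ₗ faceProj R n l := by
  have h : faceProj R n l = LinearMap.id -
      (cubeBoundary R n ∘ₗ faceSweep R n l + faceSweep R n l ∘ₗ cubeBoundary R n) := by
    rw [faceSweep_homotopy]
    abel
  have hsq := cubeBoundary_sq (R := R) (n := n)
  rw [h, LinearMap.sub_comp, LinearMap.comp_sub, LinearMap.add_comp, LinearMap.comp_add,
    LinearMap.comp_assoc, LinearMap.comp_assoc, hsq, ← LinearMap.comp_assoc, ← LinearMap.comp_assoc,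
    hsq, LinearMap.comp_id, LinearMap.id_comp, LinearMap.comp_zero, LinearMap.zero_comp, add_zero,
    zero_add, LinearMap.comp_assoc]

theorem faceProj_mem_supported (l : Fin n) (m : ℕ) :
    ∀ z ∈ Finsupp.supported R R {x : CubeCell n | cubeDim x = m},
      faceProj R n l z ∈ Finsupp.supported R R {x : CubeCell n | cubeDim x = m} := by
  refine fun z => map_mem_supported fun x (hx : cubeDim x = m) => ?_
  rw [faceProj_single]
  split_ifs with h
  · exact Submodule.zero_mem _
  · refine Finsupp.single_mem_supported _ _ ?_
    rw [Set.mem_ofPred_eq, cubeDim, edges_update (by decide),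
      Finset.erase_eq_of_notMem (by rwa [mem_edges])]
    exact hx

theorem faceSweep_mem_supported (l : Fin n) (m : ℕ) :
    ∀ z ∈ Finsupp.supported R R {x : CubeCell n | cubeDim x = m},
      faceSweep R n l z ∈ Finsupp.supported R R {x : CubeCell n | cubeDim x = m + 1} := by
  refine fun z => map_mem_supported fun x (hx : cubeDim x = m) => ?_
  rw [faceSweep_single]
  split_ifs with h
  · refine Submodule.smul_mem _ _ (Finsupp.single_mem_supported _ _ ?_)
    rw [Set.mem_ofPred_eq, cubeDim, edges_update_edge,
      Finset.card_insert_of_notMem (by simp [mem_edges, h])]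
    exact congrArg (· + 1) hx
  · exact Submodule.zero_mem _

/-- The cube is contracted to the vertex `(0, …, 0)` by projecting it to the faces `x_l = 0`, one
after the other. -/
theorem exists_cube_contraction : ∃ h : (CubeCell n →₀ R) →ₗ[R] (CubeCell n →₀ R),
    (∀ m, ∀ z ∈ Finsupp.supported R R {x : CubeCell n | cubeDim x = m},
      h z ∈ Finsupp.supported R R {x : CubeCell n | cubeDim x = m + 1}) ∧
    cubeBoundary R n ∘ₗ h + h ∘ₗ cubeBoundary R n = LinearMap.id - cubePoint R n := by
  have key : ∀ S : Finset (Fin n), ∃ h : (CubeCell n →₀ R) →ₗ[R] (CubeCell n →₀ R),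
      (∀ m, ∀ z ∈ Finsupp.supported R R {x : CubeCell n | cubeDim x = m},
        h z ∈ Finsupp.supported R R {x : CubeCell n | cubeDim x = m + 1}) ∧
      cubeBoundary R n ∘ₗ h + h ∘ₗ cubeBoundary R n = LinearMap.id -
        Finsupp.linearCombination R fun x => if ∀ i ∈ S, x i ≠ Face.edge then
          Finsupp.single (fun i => if i ∈ S then Face.zero else x i) 1 else 0 := by
    intro S
    induction S using Finset.induction_on with
    | empty =>
      refine ⟨0, fun m z _ => Submodule.zero_mem _, ?_⟩
      refine Finsupp.lhom_ext' fun x => LinearMap.ext_ring ?_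
      simp
    | insert l S hl ih =>
      obtain ⟨h, hh, hhd⟩ := ih
      refine ⟨faceSweep R n l + faceProj R n l ∘ₗ h, fun m z hz => ?_, ?_⟩
      · exact Submodule.add_mem _ (faceSweep_mem_supported l m z hz)
          (faceProj_mem_supported l _ _ (hh m z hz))
      · have h1 : cubeBoundary R n ∘ₗ (faceSweep R n l + faceProj R n l ∘ₗ h) +
            (faceSweep R n l + faceProj R n l ∘ₗ h) ∘ₗ cubeBoundary R n =
            (cubeBoundary R n ∘ₗ faceSweep R n l + faceSweep R n l ∘ₗ cubeBoundary R n) +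
              faceProj R n l ∘ₗ (cubeBoundary R n ∘ₗ h + h ∘ₗ cubeBoundary R n) := by
          rw [LinearMap.comp_add, LinearMap.add_comp, LinearMap.comp_add, ← LinearMap.comp_assoc,
            ← faceProj_comp_cubeBoundary, LinearMap.comp_assoc, LinearMap.comp_assoc]
          abel
        rw [h1, faceSweep_homotopy, hhd]
        refine Finsupp.lhom_ext' fun x => LinearMap.ext_ring ?_
        simp only [LinearMap.comp_apply, Finsupp.lsingle_apply, LinearMap.add_apply,
          LinearMap.sub_apply, LinearMap.id_apply, Finsupp.linearCombination_single, one_smul,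
          map_sub, sub_add_sub_cancel, Finset.forall_mem_insert]
        congr 1
        by_cases hS : ∀ i ∈ S, x i ≠ Face.edge
        · rw [if_pos hS, faceProj_single, if_neg hl]
          by_cases hx : x l = Face.edge
          · rw [if_pos hx, if_neg fun h => h.1 hx]
          · rw [if_neg hx, if_pos ⟨hx, hS⟩]
            congr 1
            funext i
            by_cases hi : i = l
            · subst hi; simp
            · simp [hi]
        · rw [if_neg hS, if_neg fun h => hS h.2, map_zero]
  obtain ⟨h, hh, hhd⟩ := key Finset.univ
  refine ⟨h, hh, hhd.trans ?_⟩
  congr 1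
  refine Finsupp.lhom_ext' fun x => LinearMap.ext_ring ?_
  simp [cubePoint, cubeDim, edges, Finset.filter_eq_empty_iff]

theorem cubeBoundary_eq_zero {z : CubeCell n →₀ R}
    (hz : z ∈ Finsupp.supported R R {x : CubeCell n | cubeDim x = 0}) :
    cubeBoundary R n z = 0 := by
  have := map_mem_supported (f := cubeBoundary R n) (t := ∅) (fun x (hx : cubeDim x = 0) => ?_) hz
  · simpa using this
  · rw [cubeBoundary_single, Finset.card_eq_zero.1 hx]
    simp

theorem simplexBoundary_eq_zero {z : SimplexCell n →₀ R}
    (hz : z ∈ Finsupp.supported R R {s : SimplexCell n | simplexDim s = 0}) :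
    simplexBoundary R n z = 0 := by
  have := map_mem_supported (f := simplexBoundary R n) (t := ∅)
    (fun s (hs : simplexDim s = 0) => ?_) hz
  · simpa using this
  · obtain ⟨v, hv⟩ := Finset.card_eq_one.1 (simplex_card hs)
    rw [simplexBoundary_single', hv]
    simp [simplexOrZero]

theorem simplexPoint_single (s : SimplexCell n) : simplexPoint R n (Finsupp.single s 1) =
    if simplexDim s = 0 then Finsupp.single ⟨{0}, Finset.singleton_nonempty 0⟩ 1 else 0 := by
  simp [simplexPoint]

theorem simplexCone_orZero {s : Finset (Fin (n + 1))} (hs : s.Nonempty) :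
    simplexCone R n (simplexOrZero R s) = if 0 ∈ s then 0 else simplexOrZero R (insert 0 s) := by
  simp [simplexOrZero, hs, simplexCone]

theorem simplexOrZero_empty : simplexOrZero R (∅ : Finset (Fin (n + 1))) = 0 := by
  simp [simplexOrZero]

theorem simplexCone_homotopy :
    simplexBoundary R n ∘ₗ simplexCone R n + simplexCone R n ∘ₗ simplexBoundary R n =
      LinearMap.id - simplexPoint R n := by
  refine Finsupp.lhom_ext' fun s => LinearMap.ext_ring ?_
  simp only [LinearMap.comp_apply, Finsupp.lsingle_apply, LinearMap.add_apply,
    LinearMap.sub_apply, LinearMap.id_apply]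
  rw [simplexPoint_single]
  have hs : Finsupp.single s (1 : R) = simplexOrZero R s.1 :=
    (simplexOrZero_coe s).symm
  have hp : Finsupp.single (⟨{0}, Finset.singleton_nonempty 0⟩ : SimplexCell n) (1 : R) =
    simplexOrZero R {0} :=
    (simplexOrZero_coe ⟨{0}, Finset.singleton_nonempty 0⟩).symm
  rw [hs, hp, simplexCone_orZero s.2, simplexBoundary_orZero, map_sum]
  simp only [map_smul]
  have hne := s.2
  generalize hE : s.1 = E at *
  have hdim : simplexDim s = 0 ↔ E.card = 1 := by
    have := s.2.card_pos
    rw [simplexDim, hE] at *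
    omega
  simp only [hdim]
  by_cases h0 : 0 ∈ E
  · rw [if_pos h0, map_zero, zero_add, Finset.sum_eq_single 0]
    · have hf : E.filter (fun w => w < 0) = ∅ := Finset.filter_false_of_mem fun w _ => by simp
      rw [hf, Finset.card_empty, pow_zero, one_smul]
      rcases (E.erase 0).eq_empty_or_nonempty with he | he
      · have hE0 : E = {0} := by rw [← Finset.insert_erase h0, he]; rfl
        rw [he, simplexOrZero_empty, map_zero, hE0]
        simp
      · rw [simplexCone_orZero he, if_neg (Finset.notMem_erase _ _), Finset.insert_erase h0,
          if_neg, sub_zero]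
        have := Finset.card_erase_add_one h0
        have := he.card_pos
        omega
    · intro v _ hv
      have h0' : 0 ∈ E.erase v := Finset.mem_erase.2 ⟨hv.symm, h0⟩
      rw [simplexCone_orZero ⟨0, h0'⟩, if_pos h0', smul_zero]
    · exact fun h => absurd h0 h
  · have hf : (insert 0 E).filter (fun w => w < 0) = ∅ :=
      Finset.filter_false_of_mem fun w _ => by simp
    rw [if_neg h0, simplexBoundary_orZero, Finset.sum_insert h0, hf, Finset.card_empty, pow_zero,
      one_smul, Finset.erase_insert h0, add_assoc, sub_eq_add_neg, ← Finset.sum_add_distrib]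
    congr 1
    have hterm : ∀ v ∈ E, (-1 : R) ^ ((insert 0 E).filter fun w => w < v).card •
        simplexOrZero R ((insert 0 E).erase v) =
          -((-1 : R) ^ (E.filter fun w => w < v).card •
            simplexOrZero R (insert 0 (E.erase v))) := by
      intro v hv
      have hv0 : v ≠ 0 := by rintro rfl; exact h0 hv
      rw [Finset.filter_insert, if_pos (Fin.pos_iff_ne_zero.2 hv0),
        Finset.card_insert_of_notMem (by simp [h0]), pow_succ,
        Finset.erase_insert_of_ne hv0.symm]
      simp
    by_cases hc : E.card = 1
    · obtain ⟨v, rfl⟩ := Finset.card_eq_one.1 hc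
      have := hterm v (by simp)
      rw [Finset.sum_singleton, this, if_pos hc]
      simp [simplexOrZero_empty, Finset.filter_singleton]
    · rw [if_neg hc, neg_zero]
      refine Finset.sum_eq_zero fun v hv => ?_
      have he : (E.erase v).Nonempty := by
        rw [← Finset.card_pos]
        have := Finset.card_erase_add_one hv
        have := hne.card_pos
        omega
      rw [hterm v hv, simplexCone_orZero he, if_neg fun h => h0 (Finset.mem_of_mem_erase h),
        neg_add_cancel]

theorem simplexCone_mem_supported (m : ℕ) :
    ∀ z ∈ Finsupp.supported R R {s : SimplexCell n | simplexDim s = m},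
      simplexCone R n z ∈ Finsupp.supported R R {s : SimplexCell n | simplexDim s = m + 1} := by
  refine fun z => map_mem_supported fun s (hs : simplexDim s = m) => ?_
  have h1 : Finsupp.single s (1 : R) = simplexOrZero R s.1 :=
    (simplexOrZero_coe s).symm
  rw [h1, simplexCone_orZero s.2]
  split_ifs with h
  · exact Submodule.zero_mem _
  · rw [simplexOrZero, dif_pos (Finset.insert_nonempty _ _)]
    refine Finsupp.single_mem_supported _ _ ?_
    rw [Set.mem_ofPred_eq, simplexDim, Finset.card_insert_of_notMem h, simplex_card hs]
    rfl

end Homotopy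

/-! ### The quasi-isomorphism -/

section QuasiIso

variable (R : Type u) [CommRing R] (n : ℕ)

/-- The map from the simplex to the vertex `(0, …, 0)` of the cube, as a map of cellular
chains. -/
def simplexToCube : (SimplexCell n →₀ R) →ₗ[R] (CubeCell n →₀ R) :=
  Finsupp.linearCombination R fun s =>
    if simplexDim s = 0 then Finsupp.single (fun _ => Face.zero) 1 else 0

variable {R n}

theorem simplexToCube_single (s : SimplexCell n) : simplexToCube R n (Finsupp.single s 1) =
    if simplexDim s = 0 then Finsupp.single (fun _ => Face.zero) 1 else 0 := by
  simp [simplexToCube]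

theorem cubeDim_zero : cubeDim (fun _ : Fin n => Face.zero) = 0 := by
  simp [cubeDim, edges]

theorem csCell_zero :
    csCell (fun _ : Fin n => Face.zero) = ⟨{0}, Finset.singleton_nonempty 0⟩ := by
  have : firstZero (fun _ : Fin n => Face.zero) = 0 :=
    firstZero_eq (fun i hi => absurd hi (Fin.not_lt_zero _)) fun _ _ => rfl
  apply Subtype.ext
  ext v
  rw [mem_csCell, this]
  simp

theorem CS_comp_simplexToCube : CS R n ∘ₗ simplexToCube R n = simplexPoint R n := by
  refine Finsupp.lhom_ext' fun s => LinearMap.ext_ring ?_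
  simp only [LinearMap.comp_apply, Finsupp.lsingle_apply]
  rw [simplexToCube_single, simplexPoint_single]
  split_ifs
  · have h : Nondeg (fun _ : Fin n => Face.zero) := fun i hi => by cases hi
    rw [CS_single, if_pos h, csCell_zero]
  · exact map_zero _

theorem simplexToCube_comp_CS : simplexToCube R n ∘ₗ CS R n = cubePoint R n := by
  refine Finsupp.lhom_ext' fun x => LinearMap.ext_ring ?_
  simp only [LinearMap.comp_apply, Finsupp.lsingle_apply]
  rw [CS_single, cubePoint, Finsupp.linearCombination_single, one_smul]
  by_cases h : Nondeg x
  · rw [if_pos h, simplexToCube_single, (nondeg_iff x).1 h]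
  · rw [if_neg h, map_zero, if_neg]
    intro h0
    refine h ((nondeg_iff x).2 ?_)
    have := simplexDim_csCell_le x
    omega

theorem simplexToCube_mem_supported (m : ℕ) :
    ∀ z ∈ Finsupp.supported R R {s : SimplexCell n | simplexDim s = m},
      simplexToCube R n z ∈ Finsupp.supported R R {x : CubeCell n | cubeDim x = m} := by
  refine fun z => map_mem_supported fun s (hs : simplexDim s = m) => ?_
  rw [simplexToCube_single]
  split_ifs with h
  · exact Finsupp.single_mem_supported _ _ (cubeDim_zero.trans (h.symm.trans hs))
  · exact Submodule.zero_mem _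

theorem cubeBoundary_comp_simplexToCube : cubeBoundary R n ∘ₗ simplexToCube R n = 0 := by
  refine Finsupp.lhom_ext' fun s => LinearMap.ext_ring ?_
  simp only [LinearMap.comp_apply, Finsupp.lsingle_apply]
  rw [simplexToCube_single]
  split_ifs
  · exact cubeBoundary_eq_zero (Finsupp.single_mem_supported _ _ cubeDim_zero)
  · exact map_zero _

theorem simplexToCube_comp_simplexPoint :
    simplexToCube R n ∘ₗ simplexPoint R n = simplexToCube R n := by
  refine Finsupp.lhom_ext' fun s => LinearMap.ext_ring ?_
  simp only [LinearMap.comp_apply, Finsupp.lsingle_apply]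
  rw [simplexToCube_single, simplexPoint_single]
  split_ifs
  · rw [simplexToCube_single, if_pos (by simp [simplexDim])]
  · exact map_zero _

/-- The projection of the simplex to `[0]` is homotopic to the identity, hence commutes with the
boundary, and its image consists of cycles. -/
theorem simplexToCube_comp_simplexBoundary : simplexToCube R n ∘ₗ simplexBoundary R n = 0 := by
  have hsq := simplexBoundary_sq (R := R) (n := n)
  have h1 : simplexPoint R n ∘ₗ simplexBoundary R n =
      simplexBoundary R n ∘ₗ simplexPoint R n := by
    have h : simplexPoint R n = LinearMap.id - (simplexBoundary R n ∘ₗ simplexCone R n +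
        simplexCone R n ∘ₗ simplexBoundary R n) := by
      rw [simplexCone_homotopy]
      abel
    rw [h, LinearMap.sub_comp, LinearMap.comp_sub, LinearMap.add_comp, LinearMap.comp_add,
      LinearMap.comp_assoc, LinearMap.comp_assoc, hsq, ← LinearMap.comp_assoc,
      ← LinearMap.comp_assoc, hsq, LinearMap.comp_id, LinearMap.id_comp, LinearMap.comp_zero,
      LinearMap.zero_comp, add_zero, zero_add, LinearMap.comp_assoc]
  have h2 : simplexBoundary R n ∘ₗ simplexPoint R n = 0 := by
    refine Finsupp.lhom_ext' fun s => LinearMap.ext_ring ?_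
    simp only [LinearMap.comp_apply, Finsupp.lsingle_apply]
    rw [simplexPoint_single]
    split_ifs
    · exact simplexBoundary_eq_zero (Finsupp.single_mem_supported _ _ (by simp [simplexDim]))
    · exact map_zero _
  rw [← simplexToCube_comp_simplexPoint, LinearMap.comp_assoc, h1, h2, LinearMap.comp_zero]

variable (R n)

/-- The morphism of chain complexes given by `CS`. -/
def csChainMap : cubeChains R n ⟶ simplexChains R n :=
  complexMap (CS R n) CS_mem_supported CS_comp_cubeBoundary

/-- The homotopy inverse of `csChainMap`, given by the vertex `(0, …, 0)` of the cube. -/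
def csChainInv : simplexChains R n ⟶ cubeChains R n :=
  complexMap (simplexToCube R n) simplexToCube_mem_supported
    (simplexToCube_comp_simplexBoundary.trans cubeBoundary_comp_simplexToCube.symm)

/-- Both complexes are contractible to a vertex, and `CS` maps vertices to vertices. -/
theorem quasiIso_csChainMap : QuasiIso (csChainMap R n) := by
  obtain ⟨h, hh, hhd⟩ := exists_cube_contraction (R := R) (n := n)
  have hcube : Homotopy
      (complexMap LinearMap.id (fun _ _ hz => hz) rfl : cubeChains R n ⟶ cubeChains R n)
      (complexMap (simplexToCube R n ∘ₗ CS R n)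
        (fun m _ hz => simplexToCube_mem_supported m _ (CS_mem_supported m _ hz))
        (by rw [LinearMap.comp_assoc, CS_comp_cubeBoundary, ← LinearMap.comp_assoc,
          simplexToCube_comp_simplexBoundary, ← LinearMap.comp_assoc,
          cubeBoundary_comp_simplexToCube, LinearMap.zero_comp]) :
          cubeChains R n ⟶ cubeChains R n) :=
    complexHomotopy h hh (fun _ => cubeBoundary_eq_zero) (by rw [hhd, simplexToCube_comp_CS])
  have hsimplex : Homotopy
      (complexMap LinearMap.id (fun _ _ hz => hz) rfl : simplexChains R n ⟶ simplexChains R n)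
      (complexMap (CS R n ∘ₗ simplexToCube R n)
        (fun m _ hz => CS_mem_supported m _ (simplexToCube_mem_supported m _ hz))
        (by rw [LinearMap.comp_assoc, simplexToCube_comp_simplexBoundary, ← LinearMap.comp_assoc,
          ← CS_comp_cubeBoundary, LinearMap.comp_assoc, cubeBoundary_comp_simplexToCube]) :
          simplexChains R n ⟶ simplexChains R n) :=
    complexHomotopy (simplexCone R n) simplexCone_mem_supported
      (fun _ => simplexBoundary_eq_zero) (by rw [simplexCone_homotopy, CS_comp_simplexToCube])
  have h1 : Homotopy (csChainMap R n ≫ csChainInv R n) (𝟙 _) := hcube.symm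
  have h2 : Homotopy (csChainInv R n ≫ csChainMap R n) (𝟙 _) := hsimplex.symm
  exact (HomotopyEquiv.mk (csChainMap R n) (csChainInv R n) h1 h2).quasiIso_hom

end QuasiIso

end CartanSerre

end

theorem theoremt (R : Type*) [CommRing R] (n : ℕ) :
    -- the Cartan–Serre map is cellular, and its degrees on cells are the coefficients of `CS`
    IsCellular (cs (n := n)) ∧
    (∀ (x : CubeCell n) (s : SimplexCell n) (h : simplexDim s = cubeDim x),
      HasDegree cs x s rfl h (cellDegree cs x s h)) ∧
    -- `CS` is a chain map and a quasi-isomorphism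
    (∃ φ : cubeChains R n ⟶ simplexChains R n,
      (∀ (m : ℕ) (z : (cubeChains R n).X m),
        simplexIncl R n m ((φ.f m).hom z) = CS R n (cubeIncl R n m z)) ∧
      QuasiIso φ) ∧
    -- `CS` commutes with the action of `forget(M_sh)`
    (∀ (r : ℕ), ∀ γ ∈ shuffleOperad R r,
      tensorPower (CS R n) r ∘ₗ (cubeBialgebra R n).act 1 r γ =
        (simplexBialgebra R n).act 1 r γ ∘ₗ tensorPower (CS R n) 1) ∧
    -- in particular with the operations `(∗^{k_1} ⊗ ⋯ ⊗ ∗^{k_r}) ∘ σ⁻¹ Δ^{k-1}`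
    (∀ (r : ℕ) (ks : Fin r → ℕ) (σ : Equiv.Perm (Fin (total r ks))), IsShuffle r ks σ →
      tensorPower (CS R n) r ∘ₗ (cubeBialgebra R n).eval (shuffleGraph r ks σ) =
        (simplexBialgebra R n).eval (shuffleGraph r ks σ) ∘ₗ tensorPower (CS R n) 1) := by
  refine ⟨isCellular_cs, fun x s h => ?_, ⟨csChainMap R n, fun m z => rfl,
    quasiIso_csChainMap R n⟩, fun r γ hγ => tensorPower_CS_comp_act r hγ,
    fun r ks σ hσ => tensorPower_CS_comp_eval (commutes_shuffleGraph r ks hσ)⟩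
  rw [cellDegree_cs]
  exact hasDegree_cs x s rfl h
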